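/- **Setting.** Let $d\ge 1$, $r\in\mathbb N_0$, $\Gamma=\mathbb Z^d$ with $\ell^1$-distance $d(\cdot,\cdot)$ (also used for $\mathrm{diam}$ and $\mathrm{dist}$), $\Lambda_k=\{-k,\dots,k\}^d$. Each $\Lambda_k$ carries a metric $d^{\Lambda_k}\le d$ with $d^{\Lambda_k}(x,y)=d(x,y)$ whenever $d(x,y)\le k$; $\mathrm{dist}^{\Lambda_k}$ is the corresponding distance of sets. For finite $X\subset\Gamma$ let $\mathcal A_X$ be the algebra of operators on the fermionic Fock space over $\ell^2(X,\mathbb C^r)$, i.e. the $*$-algebra generated by $1$ and the annihilation operators $a_{x,i}$, $x\in X$, $1\le i\le r$. Put $n_x=\sum_i a_{x,i}^*a_{x,i}$, $N_X=\sum_{x\in X}n_x$; $\mathcal A_X^+$ are the even elements of $\mathcal A_X$, and $\mathcal A_X^N\subset\mathcal A_X^+$ those that commute with $N_X$. $\mathcal A$ is the norm closure of $\bigcup_X\mathcal A_X^+$. $\mathcal S$ is the set of non-increasing $\zeta:[0,\infty)\to(0,\infty)$ with $\zeta(x+y)\ge\zeta(x)\zeta(y)$ that decay faster than any polynomial; $F_\zeta(\rho)=\zeta(\rho)(1+\rho)^{-(d+1)}$,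 $\zeta_\gamma(\rho)=\zeta(\rho^\gamma)$, and $$C_\zeta=\sup_k\sup_{x,y\in\Lambda_k}\sum_{z\in\Lambda_k}\frac{F_\zeta(d^{\Lambda_k}(x,z))F_\zeta(d^{\Lambda_k}(z,y))}{F_\zeta(d^{\Lambda_k}(x,y))}.$$ Let $I\subset\mathbb R$ be an open interval. An interaction $\Phi=(\Phi^{\Lambda_k})_k$ assigns to $t\in I$ and $X\subset\Lambda_k$ a self-adjoint $\Phi^{\Lambda_k}(t)(X)\in\mathcal A^N_X$. Put $$\|\Phi(t)\|_{\zeta}=\sup_k\sup_{x,y\in\Lambda_k}\sum_{X\subset\Lambda_k:\,x,y\in X}\frac{\|\Phi^{\Lambda_k}(t)(X)\|}{F_\zeta(d^{\Lambda_k}(x,y))},\qquad \|\Phi\|_{I,\zeta}=\sup_{t\in I}\|\Phi(t)\|_\zeta ,$$ and let $\|\varphi\|_{\zeta,\Lambda_M}=\sup_{x,y\in\Lambda_M}\sum_{X\subset\Lambda_M:\,x,y\in X}\|\varphi(X)\|/F_\zeta(d(x,y))$. We write $\Phi\in\mathcal B_{I,\zeta}$ if $\Phi$ is smooth in $t$ for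 every $k,X$ and there are $\zeta^{(i)}\in\mathcal S$ with $\zeta^{(0)}=\zeta$ and $\|\partial_t^i\Phi\|_{I,\zeta^{(i)}}<\infty$ for all $i\in\mathbb N_0$. A potential $v=(v^{\Lambda_k}(t,x))$, $x\in\Lambda_k$, is in $\mathcal V_I$ if it is real, smooth in $t$ and $\sup_{t\in I,k}$ of the Lipschitz constant of $\partial_t^iv^{\Lambda_k}(t,\cdot)$ with respect to $d^{\Lambda_k}$ is finite for all $i$; for $i=0$ it is denoted $C_v$. The superscript $^\circ$ means that all $d^{\Lambda_k}$ are replaced by $d$. *Thermodynamic limit:* for all $i,M$, $\sup_{t\in I}\|\partial_t^i(\Phi^{\Lambda_l}-\Phi^{\Lambda_k})(t)\|_{\zeta^{(i)},\Lambda_M}\to0$ as $k,l\to\infty$; resp. for all $M$, $v^{\Lambda_k}(t,\cdot)|_{\Lambda_M}$ does not depend on $k$ for $k\ge K(M)$. *Rapid thermodynamic limit with exponent $\gamma\in(0,1)$:* there is $\Psi\in\mathcal B^\circ_{I,\zeta}$ on the finite subsets of $\Gamma$ (with the same $\zeta^{(i)}$) such that for every $i$ there are $\lambda^{(i)},c^{(i)}>0$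 with $\sup_{t\in I}\|\partial_t^i(\Psi-\Phi^{\Lambda_k})(t)\|_{\zeta^{(i)},\Lambda_M}\le c^{(i)}\zeta^{(i)}(M^\gamma)$ for all $M\ge1$ and $k\ge M+\lambda^{(i)}M^\gamma$; resp. there are $v_\infty\in\mathcal V_I^\circ$ on $\Gamma$ and $\lambda_v>0$ with $v_\infty(t,\cdot)=v^{\Lambda_k}(t,\cdot)$ on $\Lambda_M$ for all $t\in I$, $M\ge1$, $k\ge M+\lambda_vM^\gamma$. Let $\zeta\in\mathcal S$, let $H_0^{\Lambda_k}(t)=\sum_{X\subset\Lambda_k}\Phi^{\Lambda_k}(t)(X)$ with $\Phi\in\mathcal B_{I,\zeta}$, let $v\in\mathcal V_I$, $H^{\Lambda_k}(t)=H_0^{\Lambda_k}(t)+\sum_{x\in\Lambda_k}v^{\Lambda_k}(t,x)n_x$, let $U^{\Lambda_k}(t,s)$ solve $\mathrm i\,\partial_tU^{\Lambda_k}(t,s)=H^{\Lambda_k}(t)U^{\Lambda_k}(t,s)$, $U^{\Lambda_k}(s,s)=1$, and let $\mathfrak U^{\Lambda_k}_{t,s}(A)=U^{\Lambda_k}(t,s)^*AU^{\Lambda_k}(t,s)$.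 Constants below may depend on $d$ and $r$; $s,t\in I$ are arbitrary. **(1) Lieb–Robinson bound.** There is $C$, depending only on $\zeta$, $\|\Phi\|_{I,\zeta}$ and $C_v$, such that for all $k$, $X,Y\subset\Lambda_k$, $A\in\mathcal A_X^+$, $B\in\mathcal A_Y^+$ $$\|[\mathfrak U^{\Lambda_k}_{t,s}(A),B]\|\le C\|A\|\|B\|\min(|X|,|Y|)\,e^{2C_\zeta|t-s|\|\Phi\|_{I,\zeta}}\,\zeta(\mathrm{dist}^{\Lambda_k}(X,Y)).$$ If $\zeta(\rho)=e^{-a\rho}$ with $a>0$ and $v_a=2a^{-1}C_\zeta\|\Phi\|_{I,\zeta}$, then the right side can be replaced by $C\|A\|\|B\|\min(|X|,|Y|)\,e^{a(v_a|t-s|-\mathrm{dist}^{\Lambda_k}(X,Y))}$. For (2) and (3) assume in addition that $d^{\Lambda_k}(x,y)\ge|x|_\infty-|y|_\infty$ for all $k$ and $x,y\in\Lambda_k$ (as for open, tube and torus geometries). **(2) Infinite volume.** If $\Phi$ and $v$ have a thermodynamic limit, then for all finite $X,Y\subset\Gamma$, $A\in\mathcal A_X^+$, $B\in\mathcal A_Y^+$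 the limit $\mathfrak U_{t,s}(A)=\lim_k\mathfrak U^{\Lambda_k}_{t,s}(A)$ exists in $\mathcal A$ and, with $C$ as in (1), $$\|[\mathfrak U_{t,s}(A),B]\|\le C\|A\|\|B\|\min(|X|,|Y|)\,e^{2C_\zeta|t-s|\|\Phi\|_{I,\zeta}}\,\zeta(\mathrm{dist}(X,Y)).$$ **(3) Rate of convergence.** If $\Phi$ and $v$ have a rapid thermodynamic limit with exponent $\gamma\in(0,1)$, then there are $\lambda_1>0$, $\lambda_2\in(0,1)$, $k_0\in\mathbb N$ and $C<\infty$, depending only on $\zeta$, $\|\Phi\|_{I,\zeta}$, $C_v$, $\gamma$ and the constants $\lambda^{(0)},c^{(0)},\lambda_v$, such that, with $m_k=\max\{\lceil k-\lambda_1k^\gamma\rceil,\lceil\lambda_2k\rceil\}$, for all $k\le l$, $X\subset\Lambda_k$ and $A\in\mathcal A_X^N$ $$\|(\mathfrak U^{\Lambda_l}_{t,s}-\mathfrak U^{\Lambda_k}_{t,s})(A)\|\le C\|A\|\max(1,\mathrm{diam}X)^{d+1}e^{2C_\zeta|t-s|\|\Phi\|_{I,\zeta}}|t-s|\;\zeta_\gamma\big(\mathrm{dist}^{\Lambda_l}(X,\Lambda_l\setminus\Lambda_{m_k})\big),$$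 and $\mathfrak U_{t,s}(A)=\lim_l\mathfrak U^{\Lambda_l}_{t,s}(A)$ exists and satisfies $$\|(\mathfrak U_{t,s}-\mathfrak U^{\Lambda_k}_{t,s})(A)\|\le C\|A\|\max(1,\mathrm{diam}X)^{d+1}e^{2C_\zeta|t-s|\|\Phi\|_{I,\zeta}}|t-s|\;\zeta_\gamma\big(\mathrm{dist}(X,\Gamma\setminus\Lambda_{m_k})\big).$$ Both estimates also hold for all $A\in\mathcal A_X^+$ if $k\ge k_0$ and $X\subset\Lambda_{m_k}$. (Distances to or from an empty set are read as $0$; the left sides vanish then.) -/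

import Mathlib

open Filter Topology
open scoped NNReal ENNReal ContDiff

noncomputable section

namespace LatticeFermions

/-! ### The lattice, its boxes and their metrics -/

/-- The lattice `ℤ^d`. -/
abbrev Zd (d : ℕ) : Type := Fin d → ℤ

/-- The centred box `Λ_k = {-k, …, k}^d`. -/
def cube (d k : ℕ) : Finset (Zd d) :=
  Fintype.piFinset fun _ => Finset.Icc (-(k : ℤ)) (k : ℤ)

/-- The `ℓ¹`-distance on the lattice, with values in `ℕ`. -/
def l1Dist {d : ℕ} (x y : Zd d) : ℕ := ∑ i, (x i - y i).natAbs

/-- The `ℓ¹`-distance on the lattice, with values in `ℝ`. -/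
def ell1 {d : ℕ} (x y : Zd d) : ℝ := (l1Dist x y : ℝ)

/-- The `ℓ¹`-diameter of a finite set. -/
def l1Diam {d : ℕ} (X : Finset (Zd d)) : ℕ := (X ×ˢ X).sup fun p => l1Dist p.1 p.2

/-- Distance of two sets with respect to a distance function `ρ`. (It is `0` if one of the sets is
empty.) -/
def setDist {d : ℕ} (ρ : Zd d → Zd d → ℝ) (X Y : Set (Zd d)) : ℝ :=
  sInf {δ : ℝ | ∃ x ∈ X, ∃ y ∈ Y, δ = ρ x y}

/-- `D k` is a metric on the box `Λ_k` which is dominated by the `ℓ¹`-distance and agrees with it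
at distances at most `k`, for every `k`. -/
structure IsBoxMetric {d : ℕ} (D : ℕ → Zd d → Zd d → ℝ) : Prop where
  eq_zero_iff : ∀ k, ∀ x ∈ cube d k, ∀ y ∈ cube d k, (D k x y = 0 ↔ x = y)
  symm : ∀ k, ∀ x ∈ cube d k, ∀ y ∈ cube d k, D k x y = D k y x
  triangle : ∀ k, ∀ x ∈ cube d k, ∀ y ∈ cube d k, ∀ z ∈ cube d k, D k x z ≤ D k x y + D k y z
  le_ell1 : ∀ k, ∀ x ∈ cube d k, ∀ y ∈ cube d k, D k x y ≤ ell1 x y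
  eq_ell1 : ∀ k, ∀ x ∈ cube d k, ∀ y ∈ cube d k, ell1 x y ≤ k → D k x y = ell1 x y

/-- The metrics do not bring the boundary of a box closer to its centre: `D k x y` is at least
`|x|_∞ - |y|_∞`. This holds for the `ℓ¹`-distance (open boundary conditions) and for the tube and
torus distances, where some or all coordinates are periodic with period `2k+1`. -/
def RespectsShells {d : ℕ} (D : ℕ → Zd d → Zd d → ℝ) : Prop :=
  ∀ k, ∀ x ∈ cube d k, ∀ y ∈ cube d k, ‖x‖ - ‖y‖ ≤ D k x y

/-! ### Fermionic Fock space and the local algebras -/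

/-- One-particle modes: a lattice site and an internal degree of freedom. -/
abbrev Mode (d r : ℕ) : Type := Zd d × Fin r

/-- Fermionic Fock space over `ℓ²(ℤ^d, ℂ^r)` in the occupation number representation: its standard
orthonormal basis is indexed by the finite sets of occupied modes. -/
abbrev Fock (d r : ℕ) : Type := lp (fun _ : Finset (Mode d r) => ℂ) 2

/-- Bounded operators on Fock space. All local algebras are realised inside this one algebra. -/
abbrev Op (d r : ℕ) : Type := Fock d r →L[ℂ] Fock d r

theorem sum_weighted_le {ι : Type*} (σ : Equiv.Perm ι) (c : ι → ℂ) (hc : ∀ S, ‖c S‖ ≤ 1)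
    (ψ : lp (fun _ : ι => ℂ) 2) (s : Finset ι) :
    ∑ S ∈ s, ‖c S * ψ (σ S)‖ ^ (2 : ℝ≥0∞).toReal ≤ ‖ψ‖ ^ (2 : ℝ≥0∞).toReal := by
  have h2 : 0 < (2 : ℝ≥0∞).toReal := by norm_num
  calc ∑ S ∈ s, ‖c S * ψ (σ S)‖ ^ (2 : ℝ≥0∞).toReal
      ≤ ∑ S ∈ s, ‖ψ (σ S)‖ ^ (2 : ℝ≥0∞).toReal := by
        refine Finset.sum_le_sum fun S _ => Real.rpow_le_rpow (norm_nonneg _) ?_ h2.le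
        rw [norm_mul]
        exact mul_le_of_le_one_left (norm_nonneg _) (hc S)
    _ = ∑ S ∈ s.map σ.toEmbedding, ‖ψ S‖ ^ (2 : ℝ≥0∞).toReal := by
        rw [Finset.sum_map]; rfl
    _ ≤ ‖ψ‖ ^ (2 : ℝ≥0∞).toReal := lp.sum_rpow_le_norm_rpow h2 ψ _

/-- The bounded operator `(Tψ)(S) = c(S) ψ(σ S)`, for a permutation `σ` of the index set and
coefficients `c` bounded by one. -/
def weightedPerm {ι : Type*} (σ : Equiv.Perm ι) (c : ι → ℂ) (hc : ∀ S, ‖c S‖ ≤ 1) :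
    lp (fun _ : ι => ℂ) 2 →L[ℂ] lp (fun _ : ι => ℂ) 2 :=
  LinearMap.mkContinuous
    { toFun := fun ψ => ⟨fun S => c S * ψ (σ S), memℓp_gen' (sum_weighted_le σ c hc ψ)⟩
      map_add' := fun ψ φ => by ext S; exact mul_add (c S) (ψ (σ S)) (φ (σ S))
      map_smul' := fun z ψ => by ext S; simp [mul_left_comm] }
    1
    (fun ψ => by
      rw [one_mul]
      exact lp.norm_le_of_forall_sum_le (by norm_num) (norm_nonneg _) (sum_weighted_le σ c hc ψ))

/-- Add the mode `m` to a set of modes if it is missing, remove it otherwise. -/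
def toggleMode {d r : ℕ} (m : Mode d r) : Equiv.Perm (Finset (Mode d r)) :=
  Function.Involutive.toPerm (fun S => symmDiff S {m}) fun S => symmDiff_symmDiff_cancel_right {m} S

/-- The fermionic sign, for the order in which the modes are enumerated by `Encodable.encode`. -/
def fermiSign {d r : ℕ} (m : Mode d r) (S : Finset (Mode d r)) : ℂ :=
  (-1) ^ (S.filter fun m' => Encodable.encode m' < Encodable.encode m).card

theorem norm_fermiSign_le {d r : ℕ} (m : Mode d r) (S : Finset (Mode d r)) :
    ‖if m ∈ S then (0 : ℂ) else fermiSign m S‖ ≤ 1 := by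
  split_ifs <;> simp [fermiSign]

theorem norm_parity_le {d r : ℕ} (S : Finset (Mode d r)) : ‖((-1) ^ S.card : ℂ)‖ ≤ 1 := by
  simp

/-- The annihilation operator `a_m`: `(a_m ψ)(S) = ± ψ(S ∪ {m})` if `m ∉ S`, and `0` if `m ∈ S`.
The creation operator is its adjoint `star (annihilate m)`. -/
def annihilate {d r : ℕ} (m : Mode d r) : Op d r :=
  weightedPerm (toggleMode m) (fun S => if m ∈ S then 0 else fermiSign m S) (norm_fermiSign_le m)

/-- The parity operator `(-1)^N` on Fock space. -/
def parity (d r : ℕ) : Op d r :=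
  weightedPerm (Equiv.refl _) (fun S => (-1) ^ S.card) norm_parity_le

/-- The occupation number `a_x^* a_x = ∑_i a_{x,i}^* a_{x,i}` of the site `x`. -/
def siteNumber {d : ℕ} (r : ℕ) (x : Zd d) : Op d r :=
  ∑ i : Fin r, star (annihilate (x, i)) * annihilate (x, i)

/-- The number operator `N_X`. -/
def number {d : ℕ} (r : ℕ) (X : Finset (Zd d)) : Op d r := ∑ x ∈ X, siteNumber r x

/-- The local algebra of `X`: the unital `*`-algebra generated by the annihilation operators of the
sites in `X`. It is canonically the algebra of all operators on the Fock space of `X`, and the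
inclusions between these algebras are the natural embeddings. -/
def localAlg {d : ℕ} (r : ℕ) (X : Finset (Zd d)) : StarSubalgebra ℂ (Op d r) :=
  StarAlgebra.adjoin ℂ {a | ∃ x ∈ X, ∃ i : Fin r, a = annihilate (x, i)}

/-- The even elements of the local algebra of `X`. -/
def evenAlg {d : ℕ} (r : ℕ) (X : Finset (Zd d)) : StarSubalgebra ℂ (Op d r) :=
  localAlg r X ⊓ StarSubalgebra.centralizer ℂ {parity d r}

/-- The elements of the local algebra of `X` that commute with the number operator `N_X`. -/
def gaugeAlg {d : ℕ} (r : ℕ) (X : Finset (Zd d)) : StarSubalgebra ℂ (Op d r) :=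
  localAlg r X ⊓ StarSubalgebra.centralizer ℂ {number r X}

/-- The (even) quasi-local algebra: the norm closure of the union of the even local algebras. -/
def quasiLocal (d r : ℕ) : Set (Op d r) :=
  closure {A | ∃ X : Finset (Zd d), A ∈ evenAlg r X}

/-! ### Weight functions and interactions -/

/-- Bounded, non-increasing, logarithmically superadditive functions `[0,∞) → (0,∞)` that decay
faster than any polynomial. Only the values on `[0,∞)` matter, and boundedness is implied by
monotonicity. -/
structure IsWeight (ζ : ℝ → ℝ) : Prop where
  pos : ∀ x, 0 ≤ x → 0 < ζ x
  anti : AntitoneOn ζ (Set.Ici 0)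
  superadd : ∀ x y, 0 ≤ x → 0 ≤ y → ζ x * ζ y ≤ ζ (x + y)
  decay : ∀ n : ℕ, Tendsto (fun x : ℝ => x ^ n * ζ x) atTop (𝓝 0)

/-- The function `F_ζ(ρ) = ζ(ρ) / (1 + ρ)^(d+1)`. -/
def Ffun (d : ℕ) (ζ : ℝ → ℝ) (ρ : ℝ) : ℝ := ζ ρ / (1 + ρ) ^ (d + 1)

/-- The convolution constant `C_ζ` of `F_ζ` for the box metrics `D`. -/
def convConst {d : ℕ} (D : ℕ → Zd d → Zd d → ℝ) (ζ : ℝ → ℝ) : ℝ :=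
  (⨆ k : ℕ, ⨆ x ∈ cube d k, ⨆ y ∈ cube d k,
    ENNReal.ofReal (∑ z ∈ cube d k,
      Ffun d ζ (D k x z) * Ffun d ζ (D k z y) / Ffun d ζ (D k x y))).toReal

/-- `‖φ‖_{ζ,0,Λ_M}` for the distance `ρ` and a map `φ` on finite sets. -/
def boxNorm {d r : ℕ} (ρ : Zd d → Zd d → ℝ) (ζ : ℝ → ℝ) (M : ℕ)
    (φ : Finset (Zd d) → Op d r) : ℝ≥0∞ :=
  ⨆ x ∈ cube d M, ⨆ y ∈ cube d M,
    ∑ X ∈ (cube d M).powerset with x ∈ X ∧ y ∈ X, ENNReal.ofReal (‖φ X‖ / Ffun d ζ (ρ x y))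

/-- The norm `sup_{t ∈ J} ‖d^i/dt^i Φ(t)‖_{ζ,0}` of a time-dependent interaction
`Φ = (Φ^{Λ_k})_k`, where `Φ k t X` stands for `Φ^{Λ_k}(t)(X)`. -/
def interactionNorm {d r : ℕ} (D : ℕ → Zd d → Zd d → ℝ) (J : Set ℝ) (ζ : ℝ → ℝ) (i : ℕ)
    (Φ : ℕ → ℝ → Finset (Zd d) → Op d r) : ℝ≥0∞ :=
  ⨆ t ∈ J, ⨆ k : ℕ, boxNorm (D k) ζ k fun X => iteratedDeriv i (fun τ => Φ k τ X) t

/-- `Φ` is a time-dependent interaction, smooth and bounded on `J` with the weights `ζ^{(i)}` for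
its time derivatives: `Φ ∈ 𝓑_{J,ζ,0}` with `ζ = ζ^{(0)}`. -/
structure SmoothBoundedWith {d r : ℕ} (D : ℕ → Zd d → Zd d → ℝ) (J : Set ℝ)
    (ζs : ℕ → ℝ → ℝ) (Φ : ℕ → ℝ → Finset (Zd d) → Op d r) : Prop where
  weight : ∀ i, IsWeight (ζs i)
  mem : ∀ k, ∀ t ∈ J, ∀ X ⊆ cube d k, Φ k t X ∈ gaugeAlg r X
  selfAdjoint : ∀ k, ∀ t ∈ J, ∀ X ⊆ cube d k, IsSelfAdjoint (Φ k t X)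
  smooth : ∀ k, ∀ X ⊆ cube d k, ContDiffOn ℝ ∞ (fun t => Φ k t X) J
  bounded : ∀ i, interactionNorm D J (ζs i) i Φ < ⊤

/-- `Φ ∈ 𝓑_{J,ζ,0}`. -/
def SmoothBounded {d r : ℕ} (D : ℕ → Zd d → Zd d → ℝ) (J : Set ℝ) (ζ : ℝ → ℝ)
    (Φ : ℕ → ℝ → Finset (Zd d) → Op d r) : Prop :=
  ∃ ζs : ℕ → ℝ → ℝ, ζs 0 = ζ ∧ SmoothBoundedWith D J ζs Φ

/-- `Φ ∈ 𝓑_{J,ζ,0}` has a thermodynamic limit: on every fixed box the interactions `Φ^{Λ_k}` and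
their time derivatives are Cauchy in `k`, uniformly in time. -/
def HasLimit {d r : ℕ} (D : ℕ → Zd d → Zd d → ℝ) (J : Set ℝ) (ζ : ℝ → ℝ)
    (Φ : ℕ → ℝ → Finset (Zd d) → Op d r) : Prop :=
  ∃ ζs : ℕ → ℝ → ℝ, ζs 0 = ζ ∧ SmoothBoundedWith D J ζs Φ ∧
    ∀ i M : ℕ, ∀ δ : ℝ, 0 < δ → ∃ K : ℕ, M ≤ K ∧ ∀ k l : ℕ, K ≤ k → K ≤ l →
      (⨆ t ∈ J, boxNorm ell1 (ζs i) M fun X => iteratedDeriv i (fun τ => Φ l τ X - Φ k τ X) t)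
        ≤ ENNReal.ofReal δ

/-- `Φ ∈ 𝓑_{J,ζ,0}` has a rapid thermodynamic limit with exponent `γ`: there is an infinite volume
interaction `Ψ`, bounded for open boundary conditions, such that for every `i` there are constants
`lam i, C i > 0` with
`sup_t ‖d^i/dt^i (Ψ - Φ^{Λ_k})(t)‖_{ζ^{(i)},0,Λ_M} ≤ C i * ζ^{(i)}(M^γ)` for all `M ≥ 1` and
`k ≥ M + lam i * M^γ`. The constants for `i = 0` are recorded as `lam₀` and `C₀`. -/
def HasRapidLimit {d r : ℕ} (D : ℕ → Zd d → Zd d → ℝ) (J : Set ℝ) (ζ : ℝ → ℝ) (γ : ℝ)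
    (lam₀ C₀ : ℝ) (Φ : ℕ → ℝ → Finset (Zd d) → Op d r) : Prop :=
  ∃ ζs : ℕ → ℝ → ℝ, ζs 0 = ζ ∧ SmoothBoundedWith D J ζs Φ ∧
    ∃ Ψ : ℝ → Finset (Zd d) → Op d r,
      SmoothBoundedWith (fun _ => ell1) J ζs (fun _ => Ψ) ∧
      ∃ lam C : ℕ → ℝ, lam 0 = lam₀ ∧ C 0 = C₀ ∧ ∀ i, 0 < lam i ∧ 0 < C i ∧
        ∀ M k : ℕ, 1 ≤ M → (M : ℝ) + lam i * (M : ℝ) ^ γ ≤ k →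
          (⨆ t ∈ J, boxNorm ell1 (ζs i) M fun X => iteratedDeriv i (fun τ => Ψ τ X - Φ k τ X) t)
            ≤ ENNReal.ofReal (C i * ζs i ((M : ℝ) ^ γ))

/-! ### Lipschitz potentials -/

/-- `sup_{t ∈ J} C_{d^i/dt^i v(t)}`, the Lipschitz constant of the `i`-th time derivative of a
time-dependent potential `v = (v^{Λ_k})_k`. -/
def lipConst {d : ℕ} (D : ℕ → Zd d → Zd d → ℝ) (J : Set ℝ) (i : ℕ)
    (v : ℕ → ℝ → Zd d → ℝ) : ℝ≥0∞ :=
  ⨆ t ∈ J, ⨆ k : ℕ, ⨆ x ∈ cube d k, ⨆ y ∈ cube d k, ENNReal.ofReal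
    (|iteratedDeriv i (fun τ => v k τ x) t - iteratedDeriv i (fun τ => v k τ y) t| / D k x y)

/-- `v ∈ 𝓥_J`: a smooth and bounded time-dependent Lipschitz potential. -/
structure IsLipschitzPotential {d : ℕ} (D : ℕ → Zd d → Zd d → ℝ) (J : Set ℝ)
    (v : ℕ → ℝ → Zd d → ℝ) : Prop where
  smooth : ∀ k, ∀ x ∈ cube d k, ContDiffOn ℝ ∞ (fun t => v k t x) J
  bounded : ∀ i, lipConst D J i v < ⊤

/-- A potential has a thermodynamic limit: on every fixed box it is eventually independent
of `k`. -/
def PotentialHasLimit {d : ℕ} (J : Set ℝ) (v : ℕ → ℝ → Zd d → ℝ) : Prop :=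
  ∀ M : ℕ, ∃ K : ℕ, M ≤ K ∧ ∀ k l : ℕ, K ≤ k → K ≤ l → ∀ t ∈ J, ∀ x ∈ cube d M, v l t x = v k t x

/-- A potential has a rapid thermodynamic limit with exponent `γ` (and constant `lam`). -/
def PotentialHasRapidLimit {d : ℕ} (J : Set ℝ) (γ lam : ℝ) (v : ℕ → ℝ → Zd d → ℝ) : Prop :=
  ∃ w : ℝ → Zd d → ℝ, IsLipschitzPotential (fun _ => ell1) J (fun _ => w) ∧
    0 < lam ∧ ∀ M k : ℕ, 1 ≤ M → (M : ℝ) + lam * (M : ℝ) ^ γ ≤ k →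
      ∀ t ∈ J, ∀ x ∈ cube d M, w t x = v k t x

/-! ### Dynamics -/

/-- The Hamiltonian `H^{Λ_k}(t) = ∑_{X ⊆ Λ_k} Φ^{Λ_k}(t)(X) + ∑_{x ∈ Λ_k} v^{Λ_k}(t,x) a_x^* a_x`. -/
def hamiltonian {d r : ℕ} (Φ : ℕ → ℝ → Finset (Zd d) → Op d r) (v : ℕ → ℝ → Zd d → ℝ)
    (k : ℕ) (t : ℝ) : Op d r :=
  ∑ X ∈ (cube d k).powerset, Φ k t X + ∑ x ∈ cube d k, ((v k t x : ℝ) : ℂ) • siteNumber r x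

/-- `U` solves the Schrödinger equation `i d/dt U(t,s) = H(t) U(t,s)`, `U(s,s) = 1`, on `J`. -/
def IsPropagator {d r : ℕ} (J : Set ℝ) (H : ℝ → Op d r) (U : ℝ → ℝ → Op d r) : Prop :=
  ∀ s ∈ J, U s s = 1 ∧
    ∀ t ∈ J, HasDerivAt (fun τ => U τ s) ((-Complex.I) • (H t * U t s)) t

/-- Heisenberg evolution `A ↦ U^* A U`. -/
def heisenberg {d r : ℕ} (U A : Op d r) : Op d r := star U * A * U

/-- The infinite volume dynamics `lim_k U^{Λ_k}(t,s)^* A U^{Λ_k}(t,s)`. -/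
def bulkDynamics {d r : ℕ} (U : ℕ → ℝ → ℝ → Op d r) (t s : ℝ) (A : Op d r) : Op d r :=
  limUnder atTop fun k => heisenberg (U k t s) A

/-- The setting: box metrics `D`, an open time interval `J`, `Φ ∈ 𝓑_{J,ζ,0}` of norm `N`,
a potential `v ∈ 𝓥_J` with Lipschitz constant `Cv`, and the solutions `U k` of the Schrödinger
equations for the Hamiltonians of `Φ` and `v` on the boxes `Λ_k`. -/
structure Setting {d r : ℕ} (ζ : ℝ → ℝ) (N Cv : ℝ≥0) (D : ℕ → Zd d → Zd d → ℝ)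
    (J : Set ℝ) (Φ : ℕ → ℝ → Finset (Zd d) → Op d r) (v : ℕ → ℝ → Zd d → ℝ)
    (U : ℕ → ℝ → ℝ → Op d r) : Prop where
  metric : IsBoxMetric D
  isOpen : IsOpen J
  interval : J.OrdConnected
  interaction : SmoothBounded D J ζ Φ
  norm_eq : interactionNorm D J ζ 0 Φ = N
  potential : IsLipschitzPotential D J v
  lip_eq : lipConst D J 0 v = Cv
  propagator : ∀ k, IsPropagator J (hamiltonian Φ v k) (U k)

/-- The exponential weight `e^{-a ρ}`. -/
def expWeight (a : ℝ) (ρ : ℝ) : ℝ := Real.exp (-(a * ρ))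

/-- The Lieb–Robinson velocity `v_a = 2 a⁻¹ C_{exp(-a·)} N`. -/
def lrVelocity {d : ℕ} (D : ℕ → Zd d → Zd d → ℝ) (a : ℝ) (N : ℝ≥0) : ℝ :=
  2 * a⁻¹ * convConst D (expWeight a) * N

/-- The index `max {⌈k - λ₁ k^γ⌉, ⌈λ₂ k⌉}`. -/
def innerIndex (γ lam₁ lam₂ : ℝ) (k : ℕ) : ℕ :=
  max ⌈(k : ℝ) - lam₁ * (k : ℝ) ^ γ⌉₊ ⌈lam₂ * (k : ℝ)⌉₊

/-- The observables for which the rate of convergence is claimed: either `A` commutes with the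
number operator of `X`, or `A` is even, `k ≥ k₀`, and `X` is contained in the inner box `Λ_m`. -/
def RateAdmissible {d r : ℕ} (k₀ k m : ℕ) (X : Finset (Zd d)) (A : Op d r) : Prop :=
  A ∈ gaugeAlg r X ∨ (A ∈ evenAlg r X ∧ k₀ ≤ k ∧ X ⊆ cube d m)

end LatticeFermions

end

open LatticeFermions

noncomputable section

/-! ### Fermionic algebra: anticommutation, locality and parity. -/

namespace LatticeFermions

variable {d r : ℕ}

/-! ### Weighted permutations and the canonical anticommutation relations -/

/-! The Lieb-Robinson bound comes from a differential inequality for the norms of the maps A ↦ [A,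
b(t)] on the local algebras 𝒜_X, taken for all X at once, where b(t) = U B U*. Unitary conjugation
preserves norms, so to first order in time only interaction terms that meet X can enlarge such a
norm. On-site terms map every 𝒜_X into itself under commutation: they merely rotate A inside 𝒜_X and
drop out (`commNorm_first_order`), so the Lieb-Robinson constant does not see the potential at all.
The convolution inequality for F_ζ makes exp(2 C_ζ N (t-s)) ∑ F_ζ(x,y) a supersolution of the
resulting system, and a Picard-type iteration shows that it is a majorant (`lieb_robinson_forward`).
The inputs are that even operators with disjoint supports commute (`evenAlg_commute`), that number
conserving local operators are even (`gaugeAlg_le_evenAlg`), and that F_ζ is summable uniformly over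
all admissible box metrics (`tail_sum_le`).

Two boxes Λ_k ⊆ Λ_l are compared by Duhamel's formula: the commutator of H_l - H_k with the evolved
observable is estimated by the Lieb-Robinson bound, kept in the form of a double sum of F_ζ.
Relative to an intermediate box Λ_M there are three errors (`norm_evolution_sub_le`): the difference
of the interactions inside Λ_M, the terms that leave Λ_M, reached from X by a two-step path, and the
difference of the potentials, which vanishes on Λ_M and grows linearly outside.

For a plain thermodynamic limit, M is fixed first and the linear growth is beaten by the
superpolynomial decay of ζ; this gives a Cauchy sequence. For a rapid limit, M is placed between m_k
and k so that k - M is at most a constant times M - m_k, and the spare factor 1/(1+h) in the lattice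
sums absorbs the linear growth. If k is small or X reaches out of Λ_{m_k}, the value of ζ is bounded
below, and a first order bound that uses only conservation of the particle number suffices. -/

theorem weightedPerm_apply {ι : Type*} (σ : Equiv.Perm ι) (c : ι → ℂ) (hc : ∀ S, ‖c S‖ ≤ 1)
    (ψ : lp (fun _ : ι => ℂ) 2) (S : ι) : weightedPerm σ c hc ψ S = c S * ψ (σ S) := rfl

theorem norm_weightedPerm_le {ι : Type*} (σ : Equiv.Perm ι) (c : ι → ℂ) (hc : ∀ S, ‖c S‖ ≤ 1) :
    ‖weightedPerm σ c hc‖ ≤ 1 :=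
  LinearMap.mkContinuous_norm_le _ zero_le_one _

theorem star_weightedPerm {ι : Type*} (σ : Equiv.Perm ι) (c : ι → ℂ) (hc : ∀ S, ‖c S‖ ≤ 1) :
    star (weightedPerm σ c hc) = weightedPerm σ.symm (fun S => star (c (σ.symm S)))
      (fun S => by rw [norm_star]; exact hc _) := by
  rw [ContinuousLinearMap.star_eq_adjoint, eq_comm, ContinuousLinearMap.eq_adjoint_iff]
  intro φ ψ
  rw [lp.inner_eq_tsum, lp.inner_eq_tsum, ← Equiv.tsum_eq σ]
  refine tsum_congr fun S => ?_
  simp only [weightedPerm_apply, Equiv.symm_apply_apply, RCLike.inner_apply, map_mul,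
    RCLike.star_def, RCLike.conj_conj]
  ring

theorem norm_star_op (A : Op d r) : ‖star A‖ = ‖A‖ := norm_star A

theorem op_ext {A B : Op d r} (h : ∀ ψ S, A ψ S = B ψ S) : A = B :=
  ContinuousLinearMap.ext fun ψ => lp.ext (funext fun S => h ψ S)

theorem toggleMode_symm (m : Mode d r) : (toggleMode m).symm = toggleMode m := rfl

theorem toggleMode_apply (m : Mode d r) (S : Finset (Mode d r)) :
    toggleMode m S = symmDiff S {m} := rfl

theorem mem_toggleMode {m m' : Mode d r} {S : Finset (Mode d r)} :
    m' ∈ toggleMode m S ↔ (m' ∈ S ∧ m' ≠ m ∨ m' = m ∧ m' ∉ S) := by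
  simp [toggleMode_apply, Finset.mem_symmDiff]

theorem mem_toggleMode_of_ne {m m' : Mode d r} (h : m' ≠ m) {S : Finset (Mode d r)} :
    m' ∈ toggleMode m S ↔ m' ∈ S := by
  simp [mem_toggleMode, h]

theorem mem_toggleMode_self {m : Mode d r} {S : Finset (Mode d r)} :
    m ∈ toggleMode m S ↔ m ∉ S := by
  simp [mem_toggleMode]

theorem toggleMode_toggleMode (m : Mode d r) (S : Finset (Mode d r)) :
    toggleMode m (toggleMode m S) = S :=
  (toggleMode m).left_inv S

theorem toggleMode_comm (m m' : Mode d r) (S : Finset (Mode d r)) :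
    toggleMode m (toggleMode m' S) = toggleMode m' (toggleMode m S) := by
  simp only [toggleMode_apply]
  exact symmDiff_right_comm _ _ _

/-- Source of all sign rules: the fermionic sign, the total parity and the parity outside a set are
the cases of different p. Since toggling is an involution, the case m ∈ S reduces to m ∉ S. -/
theorem neg_one_pow_card_filter_toggle (m : Mode d r) (S : Finset (Mode d r))
    (p : Mode d r → Prop) [DecidablePred p] :
    (-1 : ℂ) ^ ((toggleMode m S).filter p).card
      = (if p m then -1 else 1) * (-1) ^ (S.filter p).card := by
  have key : ∀ S : Finset (Mode d r), m ∉ S → (-1 : ℂ) ^ ((toggleMode m S).filter p).card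
      = (if p m then -1 else 1) * (-1) ^ (S.filter p).card := by
    intro S hS
    have : toggleMode m S = insert m S := by
      ext m'
      rw [mem_toggleMode, Finset.mem_insert]
      by_cases h : m' = m
      · subst h; simp [hS]
      · simp [h]
    rw [this, Finset.filter_insert]
    split_ifs with hp
    · rw [Finset.card_insert_of_notMem (by simp [hS]), pow_succ']
    · simp
  by_cases hS : m ∈ S
  · have h := key (toggleMode m S) (by rw [mem_toggleMode_self]; simpa using hS)
    rw [toggleMode_toggleMode] at h
    rw [h, ← mul_assoc]
    split_ifs <;> simp
  · exact key S hS

theorem neg_one_pow_card_toggle (m : Mode d r) (S : Finset (Mode d r)) :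
    (-1 : ℂ) ^ (toggleMode m S).card = -(-1) ^ S.card := by
  simpa using neg_one_pow_card_filter_toggle m S (fun _ => True)

theorem fermiSign_toggle (m m' : Mode d r) (S : Finset (Mode d r)) :
    fermiSign m (toggleMode m' S)
      = (if Encodable.encode m' < Encodable.encode m then -1 else 1) * fermiSign m S :=
  neg_one_pow_card_filter_toggle m' S _

theorem fermiSign_toggle_self (m : Mode d r) (S : Finset (Mode d r)) :
    fermiSign m (toggleMode m S) = fermiSign m S := by
  simp [fermiSign_toggle]

theorem star_fermiSign (m : Mode d r) (S : Finset (Mode d r)) :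
    star (fermiSign m S) = fermiSign m S := by
  simp [fermiSign]

theorem fermiSign_mul_self (m : Mode d r) (S : Finset (Mode d r)) :
    fermiSign m S * fermiSign m S = 1 := by
  simp [fermiSign, ← mul_pow]

/-- Exactly one of two distinct modes precedes the other in the enumeration, so exactly one of the
two exchange signs flips. This is the whole content of the anticommutation relations. -/
theorem fermiSign_exchange {m m' : Mode d r} (h : m ≠ m') (S : Finset (Mode d r)) :
    fermiSign m S * fermiSign m' (toggleMode m S)
      = -(fermiSign m' S * fermiSign m (toggleMode m' S)) := by
  have he : Encodable.encode m ≠ Encodable.encode m' := fun e => h (Encodable.encode_injective e)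
  rw [fermiSign_toggle, fermiSign_toggle]
  rcases lt_or_gt_of_ne he with hlt | hlt
  · rw [if_pos hlt, if_neg hlt.asymm]; ring
  · rw [if_pos hlt, if_neg hlt.asymm]; ring

theorem annihilate_apply (m : Mode d r) (ψ : Fock d r) (S : Finset (Mode d r)) :
    annihilate m ψ S = (if m ∈ S then 0 else fermiSign m S) * ψ (toggleMode m S) := rfl

theorem star_annihilate_apply (m : Mode d r) (ψ : Fock d r) (S : Finset (Mode d r)) :
    (star (annihilate m) : Op d r) ψ S
      = (if m ∈ S then fermiSign m S else 0) * ψ (toggleMode m S) := by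
  rw [annihilate, star_weightedPerm, weightedPerm_apply, toggleMode_symm]
  by_cases h : m ∈ S
  · rw [if_neg (by rw [mem_toggleMode_self]; simpa using h), if_pos h, star_fermiSign,
      fermiSign_toggle_self]
  · rw [if_pos (by rwa [mem_toggleMode_self]), if_neg h, star_zero]

theorem norm_annihilate_le (m : Mode d r) : ‖annihilate m‖ ≤ 1 := norm_weightedPerm_le _ _ _

theorem parity_apply (ψ : Fock d r) (S : Finset (Mode d r)) :
    parity d r ψ S = (-1) ^ S.card * ψ S := rfl

theorem star_parity : star (parity d r) = parity d r := by
  rw [parity, star_weightedPerm]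
  refine op_ext fun ψ S => ?_
  simp [weightedPerm_apply]

theorem parity_mul_parity : parity d r * parity d r = 1 := by
  refine op_ext fun ψ S => ?_
  simp only [mul_apply_eq_comp, parity_apply, ← mul_assoc, ← mul_pow]
  simp

theorem annihilate_anticomm {m m' : Mode d r} (h : m ≠ m') :
    annihilate m * annihilate m' = -(annihilate m' * annihilate m) := by
  refine op_ext fun ψ S => ?_
  simp only [mul_apply_eq_comp, neg_apply, lp.coeFn_neg,
    Pi.neg_apply, annihilate_apply, mem_toggleMode_of_ne h, mem_toggleMode_of_ne h.symm]
  have := fermiSign_exchange h S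
  rw [toggleMode_comm m' m]
  split_ifs
  all_goals first
    | ring1
    | linear_combination ψ (toggleMode m (toggleMode m' S)) * this

theorem annihilate_star_anticomm {m m' : Mode d r} (h : m ≠ m') :
    annihilate m * star (annihilate m') = -(star (annihilate m') * annihilate m) := by
  refine op_ext fun ψ S => ?_
  simp only [mul_apply_eq_comp, neg_apply, lp.coeFn_neg,
    Pi.neg_apply, annihilate_apply, star_annihilate_apply, mem_toggleMode_of_ne h,
    mem_toggleMode_of_ne h.symm]
  have := fermiSign_exchange h S
  rw [toggleMode_comm m' m]
  split_ifs
  all_goals first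
    | ring1
    | linear_combination ψ (toggleMode m (toggleMode m' S)) * this

theorem parity_annihilate (m : Mode d r) :
    parity d r * annihilate m = -(annihilate m * parity d r) := by
  refine op_ext fun ψ S => ?_
  simp only [mul_apply_eq_comp, neg_apply, lp.coeFn_neg,
    Pi.neg_apply, annihilate_apply, parity_apply, neg_one_pow_card_toggle]
  ring

/-! ### Locality -/

/-- Elements of a local algebra commute with distant annihilators up to the grading. -/
theorem annihilate_mul_localAlg {X : Finset (Zd d)} {A : Op d r} (hA : A ∈ localAlg r X)
    {m : Mode d r} (hm : m.1 ∉ X) :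
    annihilate m * A = parity d r * A * parity d r * annihilate m ∧
      star (annihilate m) * A = parity d r * A * parity d r * star (annihilate m) := by
  have PP := parity_mul_parity (d := d) (r := r)
  have Pa := parity_annihilate m
  have Ps : parity d r * star (annihilate m) = -(star (annihilate m) * parity d r) := by
    have := congrArg star Pa
    simp only [star_mul, star_neg, star_parity] at this
    rw [this, neg_neg]
  induction hA using StarAlgebra.adjoin_induction with
  | mem a ha =>
    obtain ⟨x, hx, i, rfl⟩ := ha
    have hne : m ≠ (x, i) := by rintro rfl; exact hm hx
    have h : parity d r * annihilate (x, i) * parity d r = -annihilate (x, i) := by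
      rw [parity_annihilate, neg_mul, mul_assoc, PP, mul_one]
    rw [h, neg_mul, neg_mul]
    refine ⟨annihilate_anticomm hne, ?_⟩
    rw [annihilate_star_anticomm hne.symm, neg_neg]
  | algebraMap c =>
    have hc := fun B : Op d r => Algebra.commutes c B
    have hP : parity d r * algebraMap ℂ (Op d r) c * parity d r = algebraMap ℂ (Op d r) c := by
      rw [← hc, mul_assoc, PP, mul_one]
    rw [hP]
    exact ⟨(hc _).symm, (hc _).symm⟩
  | add x y _ _ hx hy => simp only [mul_add, add_mul, hx.1, hx.2, hy.1, hy.2, and_self]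
  | mul x y _ _ hx hy =>
    have e : ∀ b : Op d r, parity d r * (x * y) * parity d r * b
        = parity d r * x * parity d r * (parity d r * y * parity d r * b) := by
      intro b
      calc parity d r * (x * y) * parity d r * b
          = parity d r * x * 1 * y * parity d r * b := by simp only [mul_one, mul_assoc]
        _ = _ := by rw [← PP]; simp only [mul_assoc]
    rw [e, e, ← hy.1, ← hy.2, ← mul_assoc, ← mul_assoc, ← mul_assoc, ← mul_assoc, hx.1, hx.2]
    exact ⟨rfl, rfl⟩
  | star x _ hx =>
    -- Taking adjoints turns the relation for c = b* into x* b = b P x* P. Conjugation by the parity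
    -- P, which anticommutes with b, moves b to the other side. Adjoints swap annihilators and
    -- creators, which is why the induction carries both relations.
    have key : ∀ b c : Op d r, parity d r * b = -(b * parity d r) →
        c * x = parity d r * x * parity d r * c → star c = b →
        b * star x = parity d r * star x * parity d r * b := by
      intro b c hb hc hcb
      have h1 := congrArg star hc
      simp only [star_mul, star_parity, hcb] at h1
      have h2 : parity d r * (star x * b) * parity d r
          = parity d r * (b * (parity d r * (star x * parity d r))) * parity d r := by rw [h1]
      have h3 : parity d r * (star x * b) * parity d r
          = -(parity d r * star x * parity d r * b) := by
        have : b * parity d r = -(parity d r * b) := by rw [hb, neg_neg]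
        simp only [mul_assoc, this, mul_neg]
      have h4 : parity d r * (b * (parity d r * (star x * parity d r))) * parity d r
          = -(b * star x) := by
        calc _ = (parity d r * b) * parity d r * star x * (parity d r * parity d r) := by
              simp only [mul_assoc]
          _ = _ := by rw [hb, PP, mul_one, neg_mul, mul_assoc b, PP, mul_one, neg_mul]
      rw [h3, h4] at h2
      exact (neg_injective h2).symm
    exact ⟨key _ _ Pa hx.2 (star_star _), key _ _ Ps hx.1 rfl⟩

theorem mem_evenAlg {X : Finset (Zd d)} {A : Op d r} :
    A ∈ evenAlg r X ↔ A ∈ localAlg r X ∧ parity d r * A = A * parity d r := by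
  rw [evenAlg, StarSubalgebra.mem_inf, StarSubalgebra.mem_centralizer_iff]
  simp [star_parity]

theorem localAlg_mono {X Y : Finset (Zd d)} (h : X ⊆ Y) : localAlg r X ≤ localAlg r Y := by
  refine StarAlgebra.adjoin_mono ?_
  rintro a ⟨x, hx, i, rfl⟩
  exact ⟨x, h hx, i, rfl⟩

theorem evenAlg_mono {X Y : Finset (Zd d)} (h : X ⊆ Y) : evenAlg r X ≤ evenAlg r Y :=
  inf_le_inf_right _ (localAlg_mono h)

/-- Even local operators commute with all local operators of disjoint support. -/
theorem evenAlg_commute_localAlg {X Y : Finset (Zd d)} (hXY : Disjoint X Y) {A B : Op d r}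
    (hA : A ∈ evenAlg r X) (hB : B ∈ localAlg r Y) : A * B = B * A := by
  have hcomm : ∀ A ∈ evenAlg r X, ∀ y ∈ Y, ∀ i : Fin r,
      annihilate (y, i) * A = A * annihilate (y, i) := by
    intro A hA y hy i
    rw [mem_evenAlg] at hA
    rw [(annihilate_mul_localAlg hA.1 (m := (y, i)) (Finset.disjoint_right.1 hXY hy)).1, hA.2,
      mul_assoc A, parity_mul_parity, mul_one]
  -- The centralizer requires commutation with A and with its adjoint; the latter is again even and
  -- local in X, so the same argument covers it.
  have hle : localAlg r Y ≤ StarSubalgebra.centralizer ℂ {A} := by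
    refine StarAlgebra.adjoin_le ?_
    rintro _ ⟨y, hy, i, rfl⟩
    rw [SetLike.mem_coe, StarSubalgebra.mem_centralizer_iff]
    rintro _ rfl
    exact ⟨(hcomm _ hA y hy i).symm, (hcomm _ (star_mem hA) y hy i).symm⟩
  exact ((StarSubalgebra.mem_centralizer_iff ℂ).1 (hle hB) A rfl).1

theorem evenAlg_commute {X Y : Finset (Zd d)} (hXY : Disjoint X Y) {A B : Op d r}
    (hA : A ∈ evenAlg r X) (hB : B ∈ evenAlg r Y) : A * B = B * A :=
  evenAlg_commute_localAlg hXY hA (mem_evenAlg.1 hB).1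

theorem annihilate_mem_localAlg {X : Finset (Zd d)} {x : Zd d} (hx : x ∈ X) (i : Fin r) :
    annihilate (x, i) ∈ localAlg r X :=
  StarAlgebra.subset_adjoin _ _ ⟨x, hx, i, rfl⟩

theorem siteNumber_mem_evenAlg {X : Finset (Zd d)} {x : Zd d} (hx : x ∈ X) :
    siteNumber r x ∈ evenAlg r X := by
  refine sum_mem fun i _ => mem_evenAlg.2
    ⟨mul_mem (star_mem (annihilate_mem_localAlg hx i)) (annihilate_mem_localAlg hx i), ?_⟩
  have h := parity_annihilate (d := d) (r := r) (x, i)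
  have h' := congrArg star h
  simp only [star_mul, star_neg, star_parity] at h'
  have h'' : parity d r * star (annihilate (x, i)) = -(star (annihilate (x, i)) * parity d r) := by
    rw [h', neg_neg]
  rw [← mul_assoc, h'', neg_mul, mul_assoc, h, mul_neg, neg_neg, mul_assoc]

theorem isSelfAdjoint_siteNumber (x : Zd d) : IsSelfAdjoint (siteNumber r x) := by
  rw [IsSelfAdjoint, siteNumber, star_sum]
  exact Finset.sum_congr rfl fun i _ => by rw [star_mul, star_star]

theorem norm_siteNumber_le (x : Zd d) : ‖siteNumber r x‖ ≤ r := by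
  calc ‖siteNumber r x‖ ≤ ∑ i : Fin r, ‖star (annihilate (x, i)) * annihilate (x, i)‖ :=
        norm_sum_le _ _
    _ ≤ ∑ _i : Fin r, (1 : ℝ) := Finset.sum_le_sum fun i _ => by
        refine (norm_mul_le _ _).trans ?_
        rw [norm_star_op]
        exact mul_le_one₀ (norm_annihilate_le _) (norm_nonneg _) (norm_annihilate_le _)
    _ = r := by simp

/-! ### Gauge invariant elements are even -/

theorem star_annihilate_mul_annihilate_apply (m : Mode d r) (ψ : Fock d r)
    (S : Finset (Mode d r)) :
    (star (annihilate m) * annihilate m : Op d r) ψ S = (if m ∈ S then 1 else 0) * ψ S := by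
  rw [mul_apply_eq_comp, star_annihilate_apply, annihilate_apply,
    toggleMode_toggleMode, fermiSign_toggle_self]
  by_cases h : m ∈ S
  · rw [if_pos h, if_pos h, if_neg (by rw [mem_toggleMode_self]; simpa using h), ← mul_assoc,
      fermiSign_mul_self]
  · rw [if_neg h, if_neg h, zero_mul, zero_mul]

theorem op_sum_apply {ι : Type*} (s : Finset ι) (f : ι → Op d r) (ψ : Fock d r)
    (S : Finset (Mode d r)) : (∑ i ∈ s, f i) ψ S = ∑ i ∈ s, f i ψ S := by
  classical
  induction s using Finset.induction_on with
  | empty => simp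
  | insert a s ha ih =>
    rw [Finset.sum_insert ha, Finset.sum_insert ha, add_apply, lp.coeFn_add,
      Pi.add_apply, ih]

theorem number_apply (X : Finset (Zd d)) (ψ : Fock d r) (S : Finset (Mode d r)) :
    number r X ψ S = ((S.filter fun m => m.1 ∈ X).card : ℂ) * ψ S := by
  have h : S.filter (fun m => m.1 ∈ X) = (X ×ˢ Finset.univ).filter fun m => m ∈ S := by
    ext m; simp [and_comm]
  rw [number, op_sum_apply, h, Finset.card_filter, Finset.sum_product, Nat.cast_sum,
    Finset.sum_mul]
  refine Finset.sum_congr rfl fun x _ => ?_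
  rw [siteNumber, op_sum_apply, Nat.cast_sum, Finset.sum_mul]
  refine Finset.sum_congr rfl fun i _ => ?_
  rw [star_annihilate_mul_annihilate_apply]
  simp

/-- The parity of the number of particles outside `X`. -/
def outerParity (r : ℕ) (X : Finset (Zd d)) : Op d r :=
  weightedPerm (Equiv.refl _) (fun S => (-1) ^ (S.filter fun m => m.1 ∉ X).card) (by simp)

theorem outerParity_apply (X : Finset (Zd d)) (ψ : Fock d r) (S : Finset (Mode d r)) :
    outerParity r X ψ S = (-1) ^ (S.filter fun m => m.1 ∉ X).card * ψ S := rfl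

/-- Toggling a mode over X does not change the occupation outside X. -/
theorem outerParity_commute {X : Finset (Zd d)} {A : Op d r} (hA : A ∈ localAlg r X) :
    outerParity r X * A = A * outerParity r X := by
  have hle : localAlg r X ≤ StarSubalgebra.centralizer ℂ {outerParity r X} := by
    refine StarAlgebra.adjoin_le ?_
    rintro _ ⟨x, hx, i, rfl⟩
    rw [SetLike.mem_coe, StarSubalgebra.mem_centralizer_iff]
    have hs : star (outerParity r X) = outerParity r X := by
      rw [outerParity, star_weightedPerm]
      refine op_ext fun ψ S => ?_
      simp [weightedPerm_apply]
    rintro _ rfl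
    rw [hs, and_self]
    refine op_ext fun ψ S => ?_
    simp only [mul_apply_eq_comp, annihilate_apply, outerParity_apply,
      neg_one_pow_card_filter_toggle]
    rw [if_neg (show ¬ (x ∉ X) by simpa using hx)]
    ring
  exact ((StarSubalgebra.mem_centralizer_iff ℂ).1 (hle hA) _ rfl).1

theorem op_ext_single {A B : Op d r}
    (h : ∀ S T, A (lp.single 2 T (1 : ℂ)) S = B (lp.single 2 T (1 : ℂ)) S) : A = B := by
  refine ContinuousLinearMap.ext fun ψ => ?_
  have hψ := lp.hasSum_single (p := 2) (by norm_num) ψ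
  have hA := hψ.mapL A
  have hB := hψ.mapL B
  refine hA.unique ?_
  convert hB using 2 with T
  have : (lp.single 2 T (ψ T) : Fock d r) = ψ T • lp.single 2 T (1 : ℂ) := by
    rw [← lp.single_smul]; simp
  rw [this, map_smul, map_smul]
  congr 1
  exact lp.ext (funext fun S => h S T)

/-- If `P` is diagonal, the matrix elements of `A P` are those of `A`, multiplied by the
diagonal elements of `P`. -/
theorem apply_diagonal_single {P : Op d r} {p : Finset (Mode d r) → ℂ}
    (hP : ∀ ψ S, P ψ S = p S * ψ S) (A : Op d r) (S T : Finset (Mode d r)) :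
    A (P (lp.single 2 T (1 : ℂ))) S = p T * A (lp.single 2 T (1 : ℂ)) S := by
  have : P (lp.single 2 T (1 : ℂ)) = p T • lp.single 2 T (1 : ℂ) := by
    refine lp.ext (funext fun S' => ?_)
    rw [hP, lp.coeFn_smul, Pi.smul_apply, smul_eq_mul]
    by_cases h : S' = T
    · rw [h]
    · simp [h]
  rw [this, map_smul, lp.coeFn_smul, Pi.smul_apply, smul_eq_mul]

theorem mem_gaugeAlg {X : Finset (Zd d)} {A : Op d r} (hA : A ∈ gaugeAlg r X) :
    A ∈ localAlg r X ∧ number r X * A = A * number r X := by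
  rw [gaugeAlg, StarSubalgebra.mem_inf, StarSubalgebra.mem_centralizer_iff] at hA
  exact ⟨hA.1, (hA.2 _ rfl).1⟩

/-- If the matrix element of A between S and T is nonzero, then S and T have equally many particles
in X, because A commutes with N_X, and the same parity outside X, because A is local in X. Together
the total parities agree. -/
theorem gaugeAlg_le_evenAlg (X : Finset (Zd d)) : gaugeAlg r X ≤ evenAlg r X := by
  intro A hA
  obtain ⟨hloc, hnum⟩ := mem_gaugeAlg hA
  refine mem_evenAlg.2 ⟨hloc, op_ext_single fun S T => ?_⟩
  set e := lp.single (E := fun _ : Finset (Mode d r) => ℂ) 2 T (1 : ℂ) with he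
  have h1 : number r X (A e) S = A (number r X e) S := by
    rw [← mul_apply_eq_comp, hnum, mul_apply_eq_comp]
  have h2 : outerParity r X (A e) S = A (outerParity r X e) S := by
    rw [← mul_apply_eq_comp, outerParity_commute hloc, mul_apply_eq_comp]
  rw [number_apply, apply_diagonal_single (number_apply X)] at h1
  rw [outerParity_apply, apply_diagonal_single (outerParity_apply X)] at h2
  rw [mul_apply_eq_comp, mul_apply_eq_comp, parity_apply,
    apply_diagonal_single parity_apply]
  have hsplit : ∀ S : Finset (Mode d r), (-1 : ℂ) ^ S.card
      = (-1) ^ (S.filter fun m => m.1 ∈ X).card * (-1) ^ (S.filter fun m => m.1 ∉ X).card := by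
    intro S
    rw [← pow_add, Finset.card_filter_add_card_filter_not]
  by_cases hz : A e S = 0
  · rw [hz, mul_zero, mul_zero]
  · have h1' := Nat.cast_injective (mul_right_cancel₀ hz h1)
    rw [hsplit S, hsplit T, h1', mul_assoc, h2, mul_assoc]

end LatticeFermions

/-! ### Summability of F_ζ for box metrics. -/

namespace LatticeFermions

variable {d r : ℕ}

/-! ### Lattice sums -/

/-- Comparison with the telescoping terms 2/(b+n) - 2/(b+n+1), which dominate 1/(b+n)² because b ≥
1. -/
theorem sum_nat_inv_sq_le {b : ℝ} (hb : 1 ≤ b) (K : ℕ) :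
    ∑ n ∈ Finset.range K, 1 / (b + n) ^ 2 ≤ 2 / b := by
  have h : ∑ n ∈ Finset.range K, 1 / (b + n) ^ 2 ≤ 2 / b - 2 / (b + K) := by
    induction K with
    | zero => simp
    | succ K ih =>
      rw [Finset.sum_range_succ]
      have hK : 0 < b + K := by positivity
      have hK' : 0 < b + (K + 1 : ℕ) := by positivity
      have : 1 / (b + K) ^ 2 ≤ 2 / (b + K) - 2 / (b + (K + 1 : ℕ)) := by
        rw [div_sub_div _ _ hK.ne' hK'.ne', div_le_div_iff₀ (by positivity) (by positivity)]
        push_cast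
        have : 0 ≤ (K : ℝ) := by positivity
        nlinarith
      linarith
  have : 0 ≤ 2 / (b + K) := by positivity
  linarith

theorem sum_nat_inv_pow_le {b : ℝ} (hb : 1 ≤ b) (p : ℕ) (s : Finset ℕ) :
    ∑ n ∈ s, 1 / (b + n) ^ (p + 2) ≤ 2 / b ^ (p + 1) := by
  have hb0 : 0 < b := by linarith
  obtain ⟨K, hK⟩ := s.exists_nat_subset_range
  calc ∑ n ∈ s, 1 / (b + n) ^ (p + 2) ≤ ∑ n ∈ Finset.range K, 1 / (b + n) ^ (p + 2) :=
        Finset.sum_le_sum_of_subset_of_nonneg hK fun _ _ _ => by positivity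
    _ ≤ ∑ n ∈ Finset.range K, 1 / b ^ p * (1 / (b + n) ^ 2) := by
        refine Finset.sum_le_sum fun n _ => ?_
        rw [pow_add, ← one_div_mul_one_div]
        gcongr
        simp
    _ ≤ 1 / b ^ p * (2 / b) := by
        rw [← Finset.mul_sum]
        exact mul_le_mul_of_nonneg_left (sum_nat_inv_sq_le hb K) (by positivity)
    _ = 2 / b ^ (p + 1) := by rw [pow_succ]; field_simp

theorem sum_int_inv_pow_le {b : ℝ} (hb : 1 ≤ b) (p : ℕ) (s : Finset ℤ) :
    ∑ n ∈ s, 1 / (b + n.natAbs) ^ (p + 2) ≤ 4 / b ^ (p + 1) := by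
  have key : ∀ t : Finset ℤ, Set.InjOn Int.natAbs t →
      ∑ n ∈ t, 1 / (b + n.natAbs) ^ (p + 2) ≤ 2 / b ^ (p + 1) := by
    intro t ht
    rw [← Finset.sum_image (f := fun n : ℕ => 1 / (b + n) ^ (p + 2)) ht]
    exact sum_nat_inv_pow_le hb p _
  rw [← Finset.sum_filter_add_sum_filter_not s (fun n => 0 ≤ n)]
  have h1 := key (s.filter fun n => 0 ≤ n) (by
    intro a ha c hc h
    simp only [Finset.coe_filter, Set.mem_ofPred_eq] at ha hc
    omega)
  have h2 := key (s.filter fun n => ¬ 0 ≤ n) (by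
    intro a ha c hc h
    simp only [Finset.coe_filter, Set.mem_ofPred_eq] at ha hc
    omega)
  calc _ ≤ 2 / b ^ (p + 1) + 2 / b ^ (p + 1) := add_le_add h1 h2
    _ = _ := by ring

/-- Induction on the dimension: summing over one coordinate costs a factor 4 and one power of the
denominator. -/
theorem sum_lattice_inv_pow_le (d : ℕ) (T : Finset (Zd d)) {a : ℝ} (ha : 1 ≤ a) :
    ∑ z ∈ T, 1 / (a + ∑ i, ((z i).natAbs : ℝ)) ^ (d + 1) ≤ 4 ^ d / a := by
  induction d with
  | zero =>
    have hT : T ⊆ {0} := fun z _ => by simp [Subsingleton.elim z 0]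
    refine (Finset.sum_le_sum_of_subset_of_nonneg hT fun _ _ _ => by positivity).trans ?_
    simp
  | succ d ih =>
    let T₀ : Finset ℤ := T.image fun z => z 0
    let T₁ : Finset (Zd d) := T.image Fin.tail
    have hinj : Set.InjOn (fun z : Zd (d + 1) => (Fin.tail z, z 0)) T := by
      intro z _ w _ h
      simp only [Prod.mk.injEq] at h
      rw [← Fin.cons_self_tail z, ← Fin.cons_self_tail w, h.1, h.2]
    have hsub : T.image (fun z : Zd (d + 1) => (Fin.tail z, z 0)) ⊆ T₁ ×ˢ T₀ := by
      intro q hq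
      obtain ⟨z, hz, rfl⟩ := Finset.mem_image.1 hq
      exact Finset.mem_product.2 ⟨Finset.mem_image_of_mem _ hz, Finset.mem_image_of_mem _ hz⟩
    let f : Zd d × ℤ → ℝ := fun q =>
      1 / (a + ∑ i, ((q.1 i).natAbs : ℝ) + (q.2.natAbs : ℝ)) ^ (d + 2)
    have hf : ∀ q, 0 ≤ f q := fun q => by positivity
    calc ∑ z ∈ T, 1 / (a + ∑ i, ((z i).natAbs : ℝ)) ^ (d + 1 + 1)
        = ∑ z ∈ T, f (Fin.tail z, z 0) := by
          refine Finset.sum_congr rfl fun z _ => ?_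
          simp only [f, Fin.sum_univ_succ, Fin.tail]
          rw [add_comm (((z 0).natAbs : ℝ)), ← add_assoc]
      _ = ∑ q ∈ T.image (fun z : Zd (d + 1) => (Fin.tail z, z 0)), f q :=
          (Finset.sum_image hinj).symm
      _ ≤ ∑ q ∈ T₁ ×ˢ T₀, f q :=
          Finset.sum_le_sum_of_subset_of_nonneg hsub fun q _ _ => hf q
      _ = ∑ w ∈ T₁, ∑ n ∈ T₀, f (w, n) := Finset.sum_product _ _ _
      _ ≤ ∑ w ∈ T₁, 4 * (1 / (a + ∑ i, ((w i).natAbs : ℝ)) ^ (d + 1)) := by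
          refine Finset.sum_le_sum fun w _ => ?_
          have hw : 0 ≤ ∑ i, ((w i).natAbs : ℝ) := Finset.sum_nonneg fun _ _ => by positivity
          refine (sum_int_inv_pow_le (b := a + ∑ i, ((w i).natAbs : ℝ)) (by linarith) d T₀).trans
            (le_of_eq ?_)
          ring
      _ ≤ 4 * (4 ^ d / a) := by
          rw [← Finset.mul_sum]
          exact mul_le_mul_of_nonneg_left (ih T₁) (by norm_num)
      _ = 4 ^ (d + 1) / a := by ring

/-! ### Box metrics -/

theorem mem_cube {k : ℕ} {x : Zd d} : x ∈ cube d k ↔ ∀ i, (x i).natAbs ≤ k := by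
  simp only [cube, Fintype.mem_piFinset, Finset.mem_Icc]
  exact forall_congr' fun i => by omega

theorem cube_mono {k l : ℕ} (h : k ≤ l) : cube d k ⊆ cube d l := fun x hx => by
  rw [mem_cube] at hx ⊢
  exact fun i => (hx i).trans h

theorem norm_le_iff_mem_cube {k : ℕ} {x : Zd d} : x ∈ cube d k ↔ ‖x‖ ≤ k := by
  rw [mem_cube, pi_norm_le_iff_of_nonneg (by positivity)]
  refine forall_congr' fun i => ?_
  rw [Int.norm_eq_abs, ← Int.cast_abs, Int.abs_eq_natAbs]
  norm_cast

/-- The supremum norm, with values in `ℕ`. -/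
def supNorm (x : Zd d) : ℕ := Finset.univ.sup fun i => (x i).natAbs

theorem mem_cube_iff_supNorm {k : ℕ} {x : Zd d} : x ∈ cube d k ↔ supNorm x ≤ k := by
  simp [mem_cube, supNorm]

theorem norm_eq_supNorm (x : Zd d) : ‖x‖ = supNorm x := by
  rw [supNorm]
  refine le_antisymm ?_ ?_
  · rw [← norm_le_iff_mem_cube, mem_cube]
    exact fun i => Finset.le_sup (f := fun i => (x i).natAbs) (Finset.mem_univ i)
  · by_contra! hlt
    have hpos : 0 < Finset.univ.sup fun i => (x i).natAbs :=
      Nat.cast_pos.1 ((norm_nonneg x).trans_lt hlt)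
    obtain ⟨i, -, -⟩ := Finset.lt_sup_iff.1 hpos
    obtain ⟨j, -, hj⟩ := Finset.exists_mem_eq_sup Finset.univ ⟨i, Finset.mem_univ i⟩
      fun i => (x i).natAbs
    have := norm_le_pi_norm x j
    rw [Int.norm_eq_abs, ← Int.cast_abs, Int.abs_eq_natAbs, Int.cast_natCast, ← hj] at this
    exact absurd this (not_le.2 hlt)

theorem succ_le_norm_of_notMem_cube {k : ℕ} {x : Zd d} (h : x ∉ cube d k) :
    (k : ℝ) + 1 ≤ ‖x‖ := by
  rw [norm_le_iff_mem_cube, not_le] at h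
  rw [norm_eq_supNorm] at h ⊢
  exact_mod_cast h

theorem ell1_eq_sum (x y : Zd d) : ell1 x y = ∑ i, (((x - y) i).natAbs : ℝ) := by
  simp [ell1, l1Dist]

theorem l1Dist_self (x : Zd d) : l1Dist x x = 0 := by simp [l1Dist]

namespace IsBoxMetric

variable {D : ℕ → Zd d → Zd d → ℝ} {k : ℕ}

theorem self_eq (hD : IsBoxMetric D) {x : Zd d} (hx : x ∈ cube d k) : D k x x = 0 :=
  (hD.eq_zero_iff k x hx x hx).2 rfl

theorem nonneg (hD : IsBoxMetric D) {x y : Zd d} (hx : x ∈ cube d k) (hy : y ∈ cube d k) :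
    0 ≤ D k x y := by
  have := hD.triangle k x hx y hy x hx
  rw [hD.self_eq hx, hD.symm k y hy x hx] at this
  linarith

end IsBoxMetric

/-- A bound for the sums `∑_y (1 + D k x y)^{-(d+1)}`. -/
def latticeConst (d : ℕ) : ℝ := (2 * d : ℕ) ^ d * (3 ^ (d + 1) * 4 ^ d)

theorem latticeConst_nonneg (d : ℕ) : 0 ≤ latticeConst d := by unfold latticeConst; positivity

/-- The metric is known to be the ℓ¹-distance only up to distance k, so the box is cut into (2d)^d
cells of ℓ¹-diameter at most k. If y₀ is the point nearest to x in the part of T in a cell, then |y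
- y₀|₁ ≤ 2 D(x,y) there, hence 1 + h + |y - y₀|₁ ≤ 3 (1 + D(x,y)), and a translated lattice sum
remains. The power d+1 leaves the gain 1/(1+h), which later pays for linearly growing potentials. -/
theorem tail_sum_le (hd : 1 ≤ d) {D : ℕ → Zd d → Zd d → ℝ} (hD : IsBoxMetric D) {k : ℕ}
    {x : Zd d} (hx : x ∈ cube d k) {h : ℝ} (hh : 0 ≤ h) {T : Finset (Zd d)} (hT : T ⊆ cube d k)
    (hTh : ∀ y ∈ T, h ≤ D k x y) :
    ∑ y ∈ T, 1 / (1 + D k x y) ^ (d + 1) ≤ latticeConst d / (1 + h) := by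
  classical
  -- Side length of the cells: coordinates within a cell differ by at most q - 1 = ⌊k/d⌋, so
  -- ℓ¹-distances are at most k, while d q > k, so 2d cells per direction cover the box.
  set q : ℕ := k / d + 1 with hq
  let cell : Zd d → Zd d := fun y i => (y i + k) / q
  let cells : Finset (Zd d) := Fintype.piFinset fun _ => Finset.Ico (0 : ℤ) (2 * d : ℕ)
  have hkq : k < d * q := by
    rw [hq, mul_add, mul_one]
    have := Nat.div_add_mod k d
    have := Nat.mod_lt k (show 0 < d by omega)
    omega
  have hmaps : ∀ y ∈ T, cell y ∈ cells := by
    intro y hy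
    have hy' := mem_cube.1 (hT hy)
    refine Fintype.mem_piFinset.2 fun i => Finset.mem_Ico.2 ⟨?_, ?_⟩
    · exact Int.ediv_nonneg (by have := hy' i; omega) (by positivity)
    · refine Int.ediv_lt_of_lt_mul (by positivity) ?_
      have h1 := hy' i
      have h2 : ((k : ℤ)) < d * q := by exact_mod_cast hkq
      push_cast
      have : y i + k ≤ 2 * k := by omega
      nlinarith
  have hcell : ∀ y ∈ T, ∀ w ∈ T, cell y = cell w → D k y w = ell1 y w := by
    intro y hy w hw hyw
    refine hD.eq_ell1 k y (hT hy) w (hT hw) ?_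
    have hi : ∀ i, (y i - w i).natAbs ≤ k / d := by
      intro i
      have hqpos : (0 : ℤ) < q := by positivity
      have e : (y i + k) / (q : ℤ) = (w i + k) / q := congrFun hyw i
      have h1 := Int.emod_add_mul_ediv (y i + k) q
      have h2 := Int.emod_add_mul_ediv (w i + k) q
      rw [e] at h1
      have h3 := Int.emod_nonneg (y i + k) hqpos.ne'
      have h4 := Int.emod_nonneg (w i + k) hqpos.ne'
      have h5 := Int.emod_lt_of_pos (y i + k) hqpos
      have h6 := Int.emod_lt_of_pos (w i + k) hqpos
      omega
    have : l1Dist y w ≤ d * (k / d) := by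
      calc l1Dist y w ≤ ∑ _i : Fin d, k / d := Finset.sum_le_sum fun i _ => hi i
        _ = d * (k / d) := by simp
    exact Nat.cast_le.2 (this.trans (Nat.mul_div_le k d))
  have hfib : ∀ c ∈ cells, ∑ y ∈ T with cell y = c, 1 / (1 + D k x y) ^ (d + 1)
      ≤ 3 ^ (d + 1) * 4 ^ d / (1 + h) := by
    intro c _
    rcases (T.filter fun y => cell y = c).eq_empty_or_nonempty with he | hne
    · rw [he, Finset.sum_empty]; positivity
    obtain ⟨y₀, hy₀, hmin⟩ := Finset.exists_min_image _ (fun y => D k x y) hne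
    rw [Finset.mem_filter] at hy₀
    have hbound : ∀ y ∈ T.filter (fun y => cell y = c), 1 / (1 + D k x y) ^ (d + 1)
        ≤ 3 ^ (d + 1) * (1 / (1 + h + ∑ i, (((y - y₀) i).natAbs : ℝ)) ^ (d + 1)) := by
      intro y hy
      have hm := hmin y hy
      rw [Finset.mem_filter] at hy
      have h0 := hTh y hy.1
      have htri := hD.triangle k y (hT hy.1) x hx y₀ (hT hy₀.1)
      rw [hcell y hy.1 y₀ hy₀.1 (hy.2.trans hy₀.2.symm), ell1_eq_sum,
        hD.symm k y (hT hy.1) x hx] at htri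
      have hs : 0 ≤ ∑ i, (((y - y₀) i).natAbs : ℝ) := Finset.sum_nonneg fun _ _ => by positivity
      rw [mul_one_div, ← div_pow, ← one_div_pow]
      refine pow_le_pow_left₀ (one_div_nonneg.2 (by linarith)) ?_ _
      rw [div_le_div_iff₀ (by linarith) (by positivity)]
      linarith
    calc ∑ y ∈ T with cell y = c, 1 / (1 + D k x y) ^ (d + 1)
        ≤ ∑ y ∈ T with cell y = c,
          3 ^ (d + 1) * (1 / (1 + h + ∑ i, (((y - y₀) i).natAbs : ℝ)) ^ (d + 1)) :=
          Finset.sum_le_sum hbound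
      _ = 3 ^ (d + 1) * ∑ z ∈ (T.filter fun y => cell y = c).image (fun y => y - y₀),
          1 / (1 + h + ∑ i, ((z i).natAbs : ℝ)) ^ (d + 1) := by
          rw [← Finset.mul_sum, Finset.sum_image]
          exact fun a _ b _ hab => sub_left_injective hab
      _ ≤ 3 ^ (d + 1) * (4 ^ d / (1 + h)) :=
          mul_le_mul_of_nonneg_left (sum_lattice_inv_pow_le d _ (by linarith)) (by positivity)
      _ = _ := by ring
  calc ∑ y ∈ T, 1 / (1 + D k x y) ^ (d + 1)
      = ∑ c ∈ cells, ∑ y ∈ T with cell y = c, 1 / (1 + D k x y) ^ (d + 1) :=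
        (Finset.sum_fiberwise_of_maps_to hmaps _).symm
    _ ≤ ∑ _c ∈ cells, 3 ^ (d + 1) * 4 ^ d / (1 + h) := Finset.sum_le_sum hfib
    _ = latticeConst d / (1 + h) := by
        have : cells.card = (2 * d) ^ d := by
          simp only [cells, Fintype.card_piFinset, Int.card_Ico, sub_zero, Int.toNat_natCast,
            Finset.prod_const, Finset.card_univ, Fintype.card_fin]
        rw [Finset.sum_const, this, nsmul_eq_mul, latticeConst]
        push_cast
        ring

/-! ### The functions `F_ζ` -/

theorem IsWeight.le_of_le {ζ : ℝ → ℝ} (hζ : IsWeight ζ) {x y : ℝ} (hx : 0 ≤ x) (hxy : x ≤ y) :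
    ζ y ≤ ζ x :=
  hζ.anti (Set.mem_Ici.2 hx) (Set.mem_Ici.2 (hx.trans hxy)) hxy

theorem Ffun_pos {ζ : ℝ → ℝ} (hζ : IsWeight ζ) {ρ : ℝ} (hρ : 0 ≤ ρ) : 0 < Ffun d ζ ρ :=
  div_pos (hζ.pos ρ hρ) (by positivity)

theorem Ffun_zero (ζ : ℝ → ℝ) : Ffun d ζ 0 = ζ 0 := by simp [Ffun]

theorem Ffun_eq (ζ : ℝ → ℝ) (ρ : ℝ) : Ffun d ζ ρ = ζ ρ * (1 / (1 + ρ) ^ (d + 1)) := by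
  rw [Ffun, mul_one_div]

theorem tail_sum_Ffun_le (hd : 1 ≤ d) {D : ℕ → Zd d → Zd d → ℝ} (hD : IsBoxMetric D) {ζ : ℝ → ℝ}
    (hζ : IsWeight ζ) {k : ℕ} {x : Zd d} (hx : x ∈ cube d k) {h : ℝ} (hh : 0 ≤ h)
    {T : Finset (Zd d)} (hT : T ⊆ cube d k) (hTh : ∀ y ∈ T, h ≤ D k x y) :
    ∑ y ∈ T, Ffun d ζ (D k x y) ≤ ζ h * (latticeConst d / (1 + h)) := by
  calc ∑ y ∈ T, Ffun d ζ (D k x y) ≤ ∑ y ∈ T, ζ h * (1 / (1 + D k x y) ^ (d + 1)) := by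
        refine Finset.sum_le_sum fun y hy => ?_
        rw [Ffun_eq]
        have := hD.nonneg hx (hT hy)
        exact mul_le_mul_of_nonneg_right (hζ.le_of_le hh (hTh y hy)) (by positivity)
    _ ≤ _ := by
        rw [← Finset.mul_sum]
        exact mul_le_mul_of_nonneg_left (tail_sum_le hd hD hx hh hT hTh) (hζ.pos h hh).le

theorem sum_Ffun_le (hd : 1 ≤ d) {D : ℕ → Zd d → Zd d → ℝ} (hD : IsBoxMetric D) {ζ : ℝ → ℝ}
    (hζ : IsWeight ζ) {k : ℕ} {x : Zd d} (hx : x ∈ cube d k) {T : Finset (Zd d)}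
    (hT : T ⊆ cube d k) : ∑ y ∈ T, Ffun d ζ (D k x y) ≤ ζ 0 * latticeConst d := by
  simpa using tail_sum_Ffun_le hd hD hζ hx le_rfl hT fun y hy => hD.nonneg hx (hT hy)

/-- The ζ-factors are handled by superadditivity and the triangle inequality. For the polynomial
factors, 1 + c is at most twice the larger of 1 + a and 1 + b, and that factor cancels. The
resulting bound does not involve ζ. -/
theorem Ffun_mul_le {D : ℕ → Zd d → Zd d → ℝ} (hD : IsBoxMetric D) {ζ : ℝ → ℝ}
    (hζ : IsWeight ζ) {k : ℕ} {x y z : Zd d} (hx : x ∈ cube d k) (hy : y ∈ cube d k)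
    (hz : z ∈ cube d k) :
    Ffun d ζ (D k x z) * Ffun d ζ (D k z y) / Ffun d ζ (D k x y)
      ≤ 2 ^ (d + 1) * (1 / (1 + D k x z) ^ (d + 1) + 1 / (1 + D k y z) ^ (d + 1)) := by
  have hxz := hD.nonneg hx hz
  have hzy := hD.nonneg hz hy
  have hxy := hD.nonneg hx hy
  have htri := hD.triangle k x hx z hz y hy
  rw [div_le_iff₀ (Ffun_pos hζ hxy), ← hD.symm k z hz y hy, Ffun_eq, Ffun_eq, Ffun_eq]
  have hζζ : ζ (D k x z) * ζ (D k z y) ≤ ζ (D k x y) :=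
    (hζ.superadd _ _ hxz hzy).trans (hζ.le_of_le hxy htri)
  set a := D k x z
  set b := D k z y
  set c := D k x y
  have hpow : (1 + c) ^ (d + 1) ≤ 2 ^ (d + 1) * ((1 + a) ^ (d + 1) + (1 + b) ^ (d + 1)) := by
    have hmax : 1 + c ≤ 2 * max (1 + a) (1 + b) := by
      have := le_max_left (1 + a) (1 + b)
      have := le_max_right (1 + a) (1 + b)
      linarith
    refine (pow_le_pow_left₀ (by positivity) hmax _).trans ?_
    rw [mul_pow]
    gcongr
    rcases max_cases (1 + a) (1 + b) with h | h
    · rw [h.1]; linarith [pow_nonneg (show 0 ≤ 1 + b by positivity) (d + 1)]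
    · rw [h.1]; linarith [pow_nonneg (show 0 ≤ 1 + a by positivity) (d + 1)]
  have hfrac : 1 / (1 + a) ^ (d + 1) * (1 / (1 + b) ^ (d + 1))
      ≤ 2 ^ (d + 1) * (1 / (1 + a) ^ (d + 1) + 1 / (1 + b) ^ (d + 1))
        * (1 / (1 + c) ^ (d + 1)) := by
    have ha : 0 < (1 + a) ^ (d + 1) := by positivity
    have hb : 0 < (1 + b) ^ (d + 1) := by positivity
    have hc : 0 < (1 + c) ^ (d + 1) := by positivity
    rw [mul_one_div _ ((1 + c) ^ (d + 1)), le_div_iff₀ hc]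
    calc 1 / (1 + a) ^ (d + 1) * (1 / (1 + b) ^ (d + 1)) * (1 + c) ^ (d + 1)
        ≤ 1 / (1 + a) ^ (d + 1) * (1 / (1 + b) ^ (d + 1))
          * (2 ^ (d + 1) * ((1 + a) ^ (d + 1) + (1 + b) ^ (d + 1))) :=
          mul_le_mul_of_nonneg_left hpow (by positivity)
      _ = _ := by field_simp; ring
  calc ζ a * (1 / (1 + a) ^ (d + 1)) * (ζ b * (1 / (1 + b) ^ (d + 1)))
      = ζ a * ζ b * (1 / (1 + a) ^ (d + 1) * (1 / (1 + b) ^ (d + 1))) := by ring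
    _ ≤ ζ c * (2 ^ (d + 1) * (1 / (1 + a) ^ (d + 1) + 1 / (1 + b) ^ (d + 1))
        * (1 / (1 + c) ^ (d + 1))) :=
        mul_le_mul hζζ hfrac (by positivity) (hζ.pos c hxy).le
    _ = _ := by ring

theorem sum_Ffun_mul_le (hd : 1 ≤ d) {D : ℕ → Zd d → Zd d → ℝ} (hD : IsBoxMetric D) {ζ : ℝ → ℝ}
    (hζ : IsWeight ζ) {k : ℕ} {x y : Zd d} (hx : x ∈ cube d k) (hy : y ∈ cube d k) :
    ∑ z ∈ cube d k, Ffun d ζ (D k x z) * Ffun d ζ (D k z y)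
      ≤ convConst D ζ * Ffun d ζ (D k x y) := by
  -- Finiteness has to come first: `convConst` is a `toReal`, which would turn an infinite supremum
  -- into 0.
  have hfin : (⨆ k : ℕ, ⨆ x ∈ cube d k, ⨆ y ∈ cube d k,
      ENNReal.ofReal (∑ z ∈ cube d k,
        Ffun d ζ (D k x z) * Ffun d ζ (D k z y) / Ffun d ζ (D k x y))) ≠ ⊤ := by
    refine ne_top_of_le_ne_top (ENNReal.ofReal_ne_top
      (r := 2 ^ (d + 1) * (latticeConst d + latticeConst d))) ?_
    refine iSup_le fun k => iSup₂_le fun x hx => iSup₂_le fun y hy => ENNReal.ofReal_le_ofReal ?_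
    refine (Finset.sum_le_sum fun z hz => Ffun_mul_le hD hζ hx hy hz).trans ?_
    rw [← Finset.mul_sum, Finset.sum_add_distrib]
    have h1 := tail_sum_le hd hD hx le_rfl subset_rfl fun y hy => hD.nonneg hx hy
    have h2 := tail_sum_le hd hD hy le_rfl subset_rfl fun z hz => hD.nonneg hy hz
    rw [add_zero, div_one] at h1 h2
    gcongr
  have hle : ∑ z ∈ cube d k, Ffun d ζ (D k x z) * Ffun d ζ (D k z y) / Ffun d ζ (D k x y)
      ≤ convConst D ζ := by
    rw [convConst, ← ENNReal.ofReal_le_iff_le_toReal hfin]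
    exact le_iSup_of_le k (le_iSup₂_of_le x hx (le_iSup₂_of_le y hy le_rfl))
  rw [← Finset.sum_div, div_le_iff₀ (Ffun_pos hζ (hD.nonneg hx hy))] at hle
  exact hle

theorem convConst_nonneg (D : ℕ → Zd d → Zd d → ℝ) (ζ : ℝ → ℝ) : 0 ≤ convConst D ζ :=
  ENNReal.toReal_nonneg

/-! ### Diameters and set distances -/

theorem l1Dist_le_l1Diam {X : Finset (Zd d)} {x y : Zd d} (hx : x ∈ X) (hy : y ∈ X) :
    l1Dist x y ≤ l1Diam X :=
  Finset.le_sup (f := fun p : Zd d × Zd d => l1Dist p.1 p.2)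
    (Finset.mem_product.2 ⟨hx, hy⟩ : (x, y) ∈ X ×ˢ X)

theorem card_le_diam_pow (X : Finset (Zd d)) :
    (X.card : ℝ) ≤ 3 ^ d * ((max 1 (l1Diam X) : ℕ) : ℝ) ^ d := by
  rcases X.eq_empty_or_nonempty with rfl | ⟨x₀, hx₀⟩
  · simp
  have hsub : X ⊆ (cube d (l1Diam X)).image fun z => z + x₀ := by
    intro x hx
    refine Finset.mem_image.2 ⟨x - x₀, mem_cube.2 fun i => ?_, sub_add_cancel _ _⟩
    exact (Finset.single_le_sum (f := fun i => (x i - x₀ i).natAbs) (fun _ _ => Nat.zero_le _)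
      (Finset.mem_univ i)).trans (l1Dist_le_l1Diam hx hx₀)
  have hcard : X.card ≤ (2 * l1Diam X + 1) ^ d := by
    refine (Finset.card_le_card hsub).trans (Finset.card_image_le.trans (le_of_eq ?_))
    simp only [cube, Fintype.card_piFinset, Int.card_Icc, Finset.prod_const, Finset.card_univ,
      Fintype.card_fin]
    congr 1
    omega
  have : X.card ≤ 3 ^ d * (max 1 (l1Diam X)) ^ d := by
    rw [← mul_pow]
    exact hcard.trans (Nat.pow_le_pow_left (by omega) d)
  exact_mod_cast this

theorem setDist_nonneg {ρ : Zd d → Zd d → ℝ} {X Y : Set (Zd d)}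
    (h : ∀ x ∈ X, ∀ y ∈ Y, 0 ≤ ρ x y) : 0 ≤ setDist ρ X Y := by
  refine Real.sInf_nonneg ?_
  rintro _ ⟨x, hx, y, hy, rfl⟩
  exact h x hx y hy

theorem setDist_le {ρ : Zd d → Zd d → ℝ} {X Y : Set (Zd d)}
    (h : ∀ x ∈ X, ∀ y ∈ Y, 0 ≤ ρ x y) {x y : Zd d} (hx : x ∈ X) (hy : y ∈ Y) :
    setDist ρ X Y ≤ ρ x y := by
  refine csInf_le ⟨0, ?_⟩ ⟨x, hx, y, hy, rfl⟩
  rintro _ ⟨x, hx, y, hy, rfl⟩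
  exact h x hx y hy

end LatticeFermions

/-! ### Commutator growth and the Lieb-Robinson bound in a C*-algebra. -/

namespace LatticeFermions

variable {𝔄 : Type*} [CStarAlgebra 𝔄] {ι : Type*} [DecidableEq ι]

/-! ### Commutators in associative algebras -/

section Commutator

variable {R : Type*} [Ring R]

theorem comm_add_left (a b c : R) : ⁅a + b, c⁆ = ⁅a, c⁆ + ⁅b, c⁆ := by
  simp only [Ring.lie_def, add_mul, mul_add]; abel

theorem comm_add_right (a b c : R) : ⁅a, b + c⁆ = ⁅a, b⁆ + ⁅a, c⁆ := by
  simp only [Ring.lie_def, add_mul, mul_add]; abel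

theorem comm_neg_left (a b : R) : ⁅-a, b⁆ = -⁅a, b⁆ := by
  simp only [Ring.lie_def, neg_mul, mul_neg]; abel

theorem comm_sub_left (a b c : R) : ⁅a - b, c⁆ = ⁅a, c⁆ - ⁅b, c⁆ := by
  simp only [Ring.lie_def, sub_mul, mul_sub]; abel

theorem comm_sub_right (a b c : R) : ⁅a, b - c⁆ = ⁅a, b⁆ - ⁅a, c⁆ := by
  simp only [Ring.lie_def, sub_mul, mul_sub]; abel

theorem comm_skew (a b : R) : -⁅a, b⁆ = ⁅b, a⁆ := by
  simp only [Ring.lie_def]; abel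

theorem comm_leibniz (a b c : R) : ⁅a, ⁅b, c⁆⁆ = ⁅⁅a, b⁆, c⁆ + ⁅b, ⁅a, c⁆⁆ := by
  simp only [Ring.lie_def, sub_mul, mul_sub, mul_assoc]; abel

theorem comm_sum_left {κ : Type*} (s : Finset κ) (f : κ → R) (a : R) :
    ⁅∑ i ∈ s, f i, a⁆ = ∑ i ∈ s, ⁅f i, a⁆ := by
  simp only [Ring.lie_def, Finset.sum_mul, Finset.mul_sum, Finset.sum_sub_distrib]

theorem comm_sum_right {κ : Type*} (s : Finset κ) (f : κ → R) (a : R) :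
    ⁅a, ∑ i ∈ s, f i⁆ = ∑ i ∈ s, ⁅a, f i⁆ := by
  simp only [Ring.lie_def, Finset.sum_mul, Finset.mul_sum, Finset.sum_sub_distrib]

theorem comm_smul_left [Algebra ℂ R] (c : ℂ) (a b : R) : ⁅c • a, b⁆ = c • ⁅a, b⁆ := by
  simp only [Ring.lie_def, smul_mul_assoc, mul_smul_comm, smul_sub]

theorem comm_smul_right [Algebra ℂ R] (c : ℂ) (a b : R) : ⁅a, c • b⁆ = c • ⁅a, b⁆ := by
  simp only [Ring.lie_def, smul_mul_assoc, mul_smul_comm, smul_sub]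

theorem comm_eq_zero {a b : R} (h : a * b = b * a) : ⁅a, b⁆ = 0 := by
  rw [Ring.lie_def, h, sub_self]

end Commutator

/-! ### Growth of norms along differential equations -/

/-- If a Lipschitz function `p` grows along `f` to first order at most like `B`, then it stays
below `B`. -/
theorem le_of_first_order_bound {E : Type*} [NormedAddCommGroup E] [NormedSpace ℝ E]
    {p : E → ℝ} {c : ℝ} (hp : ∀ x y, p x ≤ p y + c * ‖x - y‖)
    {f f' : ℝ → E} {a b : ℝ} (hf : ∀ x ∈ Set.Icc a b, HasDerivAt f (f' x) x) {B B' : ℝ → ℝ}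
    (ha : p (f a) ≤ B a) (hB : ∀ x, HasDerivAt B (B' x) x)
    (bound : ∀ x ∈ Set.Icc a b, ∃ κ : ℝ, ∀ h : ℝ, 0 < h → h ≤ 1 →
      p (f x + h • f' x) ≤ p (f x) + h * B' x + κ * h ^ 2) :
    ∀ x ∈ Set.Icc a b, p (f x) ≤ B x := by
  have hp' : ∀ x y, p x ≤ p y + |c| * ‖x - y‖ := fun x y =>
    (hp x y).trans (by gcongr; exact le_abs_self c)
  have hpc : Continuous p := by
    refine (LipschitzWith.of_le_add_mul' |c| fun x y => ?_).continuous
    rw [dist_eq_norm]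
    exact hp' x y
  -- The composition p ∘ f need not be differentiable, so its right lower slope is estimated
  -- instead. The gap r - B' x is split in halves: one for the quadratic error κ (z - x)², one for
  -- the o(z - x) error of the linearisation of f, multiplied by the Lipschitz constant.
  refine fun x hx => image_le_of_liminf_slope_right_le_deriv_boundary (f := fun x => p (f x))
    (fun x hx => (hpc.continuousAt.comp (hf x hx).continuousAt).continuousWithinAt) ha
    (fun x _ => (hB x).continuousAt.continuousWithinAt)
    (fun x _ => (hB x).hasDerivWithinAt) ?_ hx
  intro x hx r hr
  obtain ⟨κ, hκ⟩ := bound x (Set.Ico_subset_Icc_self hx)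
  set ε := (r - B' x) / 2 with hε
  have hεpos : 0 < ε := by rw [hε]; linarith
  have hδpos : 0 < ε / (|c| + 1) := by positivity
  have h1 : ∀ᶠ z in 𝓝[>] x, ‖f z - f x - (z - x) • f' x‖ ≤ ε / (|c| + 1) * ‖z - x‖ :=
    ((hf x (Set.Ico_subset_Icc_self hx)).isLittleO.def hδpos).filter_mono nhdsWithin_le_nhds
  have h2 : ∀ᶠ z in 𝓝[>] x, κ * (z - x) < ε := by
    have : Tendsto (fun z => κ * (z - x)) (𝓝 x) (𝓝 (κ * (x - x))) :=
      (continuous_const.mul (continuous_id.sub continuous_const)).tendsto x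
    rw [sub_self, mul_zero] at this
    exact (this.eventually (gt_mem_nhds hεpos)).filter_mono nhdsWithin_le_nhds
  have h3 : ∀ᶠ z in 𝓝[>] x, z < x + 1 :=
    (gt_mem_nhds (by linarith : x < x + 1)).filter_mono nhdsWithin_le_nhds
  refine Eventually.frequently ?_
  filter_upwards [h1, h2, h3, self_mem_nhdsWithin] with z hz1 hz2 hz3 hz4
  have hpos : 0 < z - x := sub_pos.2 hz4
  rw [slope_def_field, div_lt_iff₀ hpos]
  have hk := hκ (z - x) hpos (by linarith)
  rw [Real.norm_of_nonneg hpos.le] at hz1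
  have h4 : p (f z) ≤ p (f x + (z - x) • f' x) + |c| * ‖f z - f x - (z - x) • f' x‖ := by
    rw [sub_sub]
    exact hp' _ _
  have h5 : |c| * ‖f z - f x - (z - x) • f' x‖ ≤ ε * (z - x) := by
    refine (mul_le_mul_of_nonneg_left hz1 (abs_nonneg c)).trans ?_
    rw [← mul_assoc]
    refine mul_le_mul_of_nonneg_right ?_ hpos.le
    rw [mul_div_assoc', div_le_iff₀ (by positivity)]
    linarith
  have hre : r = B' x + 2 * ε := by rw [hε]; ring
  rw [hre]
  nlinarith

theorem norm_comm_le (A B : 𝔄) : ‖⁅A, B⁆‖ ≤ 2 * ‖A‖ * ‖B‖ := by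
  rw [Ring.lie_def]
  calc ‖A * B - B * A‖ ≤ ‖A * B‖ + ‖B * A‖ := norm_sub_le _ _
    _ ≤ ‖A‖ * ‖B‖ + ‖B‖ * ‖A‖ := add_le_add (norm_mul_le _ _) (norm_mul_le _ _)
    _ = _ := by ring

/-- An inequality only, because the algebra may be trivial. -/
theorem norm_one_le : ‖(1 : 𝔄)‖ ≤ 1 := by
  have h : ‖(1 : 𝔄)‖ = ‖(1 : 𝔄)‖ * ‖(1 : 𝔄)‖ := by
    simpa using CStarRing.norm_star_mul_self (x := (1 : 𝔄))
  by_contra! h1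
  nlinarith

/-- Infinitesimal unitary conjugation preserves norms up to second order. -/
theorem norm_sub_smul_comm_le {K : 𝔄} (hK : IsSelfAdjoint K) (G : 𝔄) (h : ℝ) :
    ‖G - ((h : ℂ) * Complex.I) • ⁅K, G⁆‖ ≤ (1 + 2 * h ^ 2 * ‖K‖ ^ 2) * ‖G‖ := by
  set c : ℂ := (h : ℂ) * Complex.I with hc
  have hcc : c * c = -(h ^ 2 : ℝ) := by
    rw [hc]; push_cast; linear_combination (h : ℂ) ^ 2 * Complex.I_mul_I
  have hstar : star c = -c := by simp [hc]
  -- First order approximation of the unitary e^{-ihK}. Its square norm is that of 1 + h²K², and u G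
  -- u* differs from G - ih[K,G] only by h² K G K.
  set u : 𝔄 := 1 - c • K with hu
  have hus : star u = 1 + c • K := by
    rw [hu, star_sub, star_one, star_smul, hK.star_eq, hstar, neg_smul, sub_neg_eq_add]
  have hKK : ‖K * K‖ ≤ ‖K‖ ^ 2 := by rw [sq]; exact norm_mul_le _ _
  have hn1 : ‖u‖ * ‖u‖ ≤ 1 + h ^ 2 * ‖K‖ ^ 2 := by
    rw [← CStarRing.norm_star_mul_self, hus, hu]
    have : (1 + c • K) * (1 - c • K) = 1 + ((h ^ 2 : ℝ) : ℂ) • (K * K) := by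
      rw [mul_sub, mul_one, add_mul, one_mul, smul_mul_smul_comm, hcc, neg_smul]
      abel
    rw [this]
    refine (norm_add_le _ _).trans ?_
    rw [norm_smul, Complex.norm_real, Real.norm_of_nonneg (sq_nonneg h)]
    exact add_le_add norm_one_le
      (mul_le_mul_of_nonneg_left hKK (sq_nonneg h))
  have hdecomp : G - c • ⁅K, G⁆ = u * G * star u - ((h ^ 2 : ℝ) : ℂ) • (K * G * K) := by
    rw [hus, hu, Ring.lie_def, sub_mul, one_mul, mul_add, mul_one, sub_mul, smul_mul_assoc,
      smul_mul_smul_comm, hcc, mul_smul_comm, smul_sub, neg_smul]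
    abel
  have hKGK : ‖K * G * K‖ ≤ ‖K‖ ^ 2 * ‖G‖ := by
    calc ‖K * G * K‖ ≤ ‖K‖ * ‖G‖ * ‖K‖ :=
          (norm_mul_le _ _).trans (mul_le_mul_of_nonneg_right (norm_mul_le _ _) (norm_nonneg _))
      _ = _ := by ring
  have huGu : ‖u * G * star u‖ ≤ (1 + h ^ 2 * ‖K‖ ^ 2) * ‖G‖ := by
    calc ‖u * G * star u‖ ≤ ‖u‖ * ‖G‖ * ‖star u‖ :=
          (norm_mul_le _ _).trans (mul_le_mul_of_nonneg_right (norm_mul_le _ _) (norm_nonneg _))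
      _ = ‖u‖ * ‖u‖ * ‖G‖ := by rw [norm_star]; ring
      _ ≤ _ := mul_le_mul_of_nonneg_right hn1 (norm_nonneg _)
  rw [hdecomp]
  refine (norm_sub_le _ _).trans ?_
  rw [norm_smul, Complex.norm_real, Real.norm_of_nonneg (sq_nonneg h)]
  have := mul_le_mul_of_nonneg_left hKGK (sq_nonneg h)
  linarith

theorem real_smul_neg_I_smul (h : ℝ) (A : 𝔄) :
    h • ((-Complex.I) • A) = -(((h : ℂ) * Complex.I) • A) := by
  rw [← Complex.coe_smul, smul_smul, mul_neg, neg_smul]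

/-- For t < s the reflected curve x ↦ f(-x) runs forward in time; this is why the first order bound
is required for both signs of h. -/
theorem le_of_first_order_bound_two_sided {E : Type*} [NormedAddCommGroup E] [NormedSpace ℝ E]
    {p : E → ℝ} {c : ℝ} (hp : ∀ x y, p x ≤ p y + c * ‖x - y‖) {f f' : ℝ → E} {s t ρ : ℝ}
    (hf : ∀ x ∈ Set.uIcc s t, HasDerivAt f (f' x) x)
    (bound : ∀ x ∈ Set.uIcc s t, ∃ κ : ℝ, ∀ h : ℝ, |h| ≤ 1 →
      p (f x + h • f' x) ≤ p (f x) + |h| * ρ + κ * h ^ 2) :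
    p (f t) ≤ p (f s) + ρ * |t - s| := by
  have key : ∀ (g g' : ℝ → E) (a b : ℝ), a ≤ b → (∀ x ∈ Set.Icc a b, HasDerivAt g (g' x) x) →
      (∀ x ∈ Set.Icc a b, ∃ κ : ℝ, ∀ h : ℝ, 0 < h → h ≤ 1 →
        p (g x + h • g' x) ≤ p (g x) + h * ρ + κ * h ^ 2) → p (g b) ≤ p (g a) + ρ * (b - a) := by
    intro g g' a b hab hg hbd
    refine le_of_first_order_bound hp hg (B := fun x => p (g a) + ρ * (x - a)) (B' := fun _ => ρ)
      (by simp) (fun x => ?_) hbd b (Set.right_mem_Icc.2 hab)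
    simpa using (((hasDerivAt_id x).sub_const a).const_mul ρ).const_add (p (g a))
  rcases le_total s t with hst | hts
  · rw [Set.uIcc_of_le hst] at hf bound
    rw [abs_of_nonneg (sub_nonneg.2 hst)]
    refine key f f' s t hst hf fun x hx => ?_
    obtain ⟨κ, hκ⟩ := bound x hx
    refine ⟨κ, fun h h0 h1 => ?_⟩
    simpa [abs_of_pos h0] using hκ h (by rwa [abs_of_pos h0])
  · rw [Set.uIcc_of_ge hts] at hf bound
    have hmem : ∀ x ∈ Set.Icc (-s) (-t), -x ∈ Set.Icc t s := fun x hx =>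
      ⟨by linarith [hx.2], by linarith [hx.1]⟩
    have h := key (fun x => f (-x)) (fun x => -f' (-x)) (-s) (-t) (by linarith)
      (fun x hx => ((hf _ (hmem x hx)).scomp x (hasDerivAt_neg x)).congr_deriv (by simp))
      (fun x hx => ?_)
    · simp only [neg_neg] at h
      rw [abs_of_nonpos (by linarith)]
      linarith
    · obtain ⟨κ, hκ⟩ := bound _ (hmem x hx)
      refine ⟨κ, fun h h0 h1 => ?_⟩
      simpa [abs_of_pos h0] using hκ (-h) (by rwa [abs_neg, abs_of_pos h0])

/-- Norm bound for solutions of `f' = -i [K, f] + R` with selfadjoint `K`. -/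
theorem norm_le_of_comm_derivative {f R K : ℝ → 𝔄} {s t : ℝ}
    (hK : ∀ x ∈ Set.uIcc s t, IsSelfAdjoint (K x))
    (hf : ∀ x ∈ Set.uIcc s t, HasDerivAt f ((-Complex.I) • ⁅K x, f x⁆ + R x) x) {ρ : ℝ}
    (hR : ∀ x ∈ Set.uIcc s t, ‖R x‖ ≤ ρ) : ‖f t‖ ≤ ‖f s‖ + ρ * |t - s| := by
  refine le_of_first_order_bound_two_sided (p := fun A => ‖A‖) (c := 1)
    (fun A A' => by rw [one_mul]; exact norm_le_norm_add_norm_sub' A A') hf fun x hx => ?_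
  refine ⟨2 * ‖K x‖ ^ 2 * ‖f x‖, fun h _ => ?_⟩
  rw [smul_add, real_smul_neg_I_smul, ← add_assoc, ← sub_eq_add_neg]
  refine (norm_add_le _ _).trans ?_
  rw [norm_smul, Real.norm_eq_abs]
  have h1 := norm_sub_smul_comm_le (hK x hx) (f x) h
  have h2 := mul_le_mul_of_nonneg_left (hR x hx) (abs_nonneg h)
  linarith

/-! ### Commutators with local algebras -/

/-- The norm of the map `A ↦ [A, B]` on a subspace `S`. -/
def commNorm (S : Submodule ℂ 𝔄) (B : 𝔄) : ℝ :=
  ‖((ContinuousLinearMap.mul ℂ 𝔄).flip B - ContinuousLinearMap.mul ℂ 𝔄 B).comp S.subtypeL‖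

theorem commNorm_nonneg (S : Submodule ℂ 𝔄) (B : 𝔄) : 0 ≤ commNorm S B :=
  ContinuousLinearMap.opNorm_nonneg _

theorem norm_comm_le_commNorm {S : Submodule ℂ 𝔄} {A : 𝔄} (hA : A ∈ S) (B : 𝔄) :
    ‖⁅A, B⁆‖ ≤ commNorm S B * ‖A‖ :=
  (((ContinuousLinearMap.mul ℂ 𝔄).flip B - ContinuousLinearMap.mul ℂ 𝔄 B).comp
    S.subtypeL).le_opNorm ⟨A, hA⟩

theorem commNorm_le_of {S : Submodule ℂ 𝔄} {B : 𝔄} {M : ℝ} (hM : 0 ≤ M)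
    (h : ∀ A ∈ S, ‖⁅A, B⁆‖ ≤ M * ‖A‖) : commNorm S B ≤ M :=
  ContinuousLinearMap.opNorm_le_bound _ hM fun A => h A A.2

/-- Supplies the Lipschitz continuity in B that `le_of_first_order_bound` demands of the functional.
-/
theorem commNorm_le_add (S : Submodule ℂ 𝔄) (B B' : 𝔄) :
    commNorm S B ≤ commNorm S B' + 2 * ‖B - B'‖ := by
  have h0 := commNorm_nonneg S B'
  refine commNorm_le_of (by positivity) fun A hA => ?_
  calc ‖⁅A, B⁆‖ = ‖⁅A, B'⁆ + ⁅A, B - B'⁆‖ := by rw [← comm_add_right, add_sub_cancel]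
    _ ≤ commNorm S B' * ‖A‖ + 2 * ‖A‖ * ‖B - B'‖ :=
        (norm_add_le _ _).trans (add_le_add (norm_comm_le_commNorm hA B') (norm_comm_le _ _))
    _ = _ := by ring

/-- A family of subspaces of operators localised in finite sets. -/
def IsLocalNet (𝒜 : Finset ι → Submodule ℂ 𝔄) : Prop :=
  ∀ X Y : Finset ι, Disjoint X Y → ∀ A ∈ 𝒜 X, ∀ B ∈ 𝒜 Y, ⁅A, B⁆ = 0

/-- Growth of the commutators with a local algebra, to first order in time. On-site potentials do
not contribute. -/
theorem commNorm_first_order {𝒜 : Finset ι → Submodule ℂ 𝔄} (h𝒜 : IsLocalNet 𝒜) {Λ X : Finset ι}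
    {Φ : Finset ι → 𝔄} {V : 𝔄} (hVs : IsSelfAdjoint V) (hVX : ∀ A ∈ 𝒜 X, ⁅V, A⁆ ∈ 𝒜 X) (hΦ : ∀ Z ⊆ Λ, Φ Z ∈ 𝒜 Z) (hΦs : ∀ Z ⊆ Λ, IsSelfAdjoint (Φ Z))
    (B : 𝔄) :
    ∃ κ : ℝ, ∀ h : ℝ, 0 < h → h ≤ 1 →
      commNorm (𝒜 X) (B - ((h : ℂ) * Complex.I) • ⁅∑ Z ∈ Λ.powerset, Φ Z + V, B⁆)
        ≤ commNorm (𝒜 X) B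
          + h * (2 * ∑ Z ∈ Λ.powerset with ¬ Disjoint Z X, ‖Φ Z‖ * commNorm (𝒜 Z) B)
          + κ * h ^ 2 := by
  -- K collects what acts on A at most through V. It may be arbitrarily large, since it enters only
  -- through infinitesimal unitary conjugations.
  set K := ∑ Z ∈ Λ.powerset with Disjoint Z X, Φ Z + V with hKdef
  set H₂ := ∑ Z ∈ Λ.powerset with ¬ Disjoint Z X, Φ Z with hH₂
  set c := commNorm (𝒜 X) B with hc
  have hc0 : 0 ≤ c := commNorm_nonneg _ _
  have hKs : IsSelfAdjoint K := by
    refine IsSelfAdjoint.add (isSelfAdjoint_sum _ fun Z hZ => ?_) hVs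
    exact hΦs Z (Finset.mem_powerset.1 (Finset.mem_filter.1 hZ).1)
  have hsplit : ∑ Z ∈ Λ.powerset, Φ Z + V = K + H₂ := by
    rw [hKdef, hH₂, add_right_comm, Finset.sum_filter_add_sum_filter_not]
  set τ := ∑ Z ∈ Λ.powerset with ¬ Disjoint Z X, ‖Φ Z‖ * commNorm (𝒜 Z) B with hτ
  have hτ0 : 0 ≤ τ := Finset.sum_nonneg fun _ _ => mul_nonneg (norm_nonneg _) (commNorm_nonneg _ _)
  refine ⟨(2 * ‖K‖ ^ 2 + 2 * ‖V‖ ^ 2 + 4 * ‖K‖ ^ 2 * ‖V‖ ^ 2) * c + 8 * ‖K‖ * ‖V‖ * ‖B‖,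
    fun h h0 h1 => commNorm_le_of (by positivity) fun A hA => ?_⟩
  set i : ℂ := (h : ℂ) * Complex.I with hi
  have hin : ‖i‖ = h := by rw [hi]; simp [abs_of_pos h0]
  have hAK : ⁅A, K⁆ = ⁅A, V⁆ := by
    rw [hKdef, comm_add_right, comm_sum_right, Finset.sum_eq_zero, zero_add]
    intro Z hZ
    rw [Finset.mem_filter, Finset.mem_powerset] at hZ
    exact h𝒜 X Z hZ.2.symm A hA _ (hΦ Z hZ.1)
  -- Infinitesimal rotation of A by the on-site terms. It stays in 𝒜 X and its norm changes only at
  -- second order, so V costs nothing at first order.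
  set A' := A + i • ⁅V, A⁆ with hA'
  have hA'mem : A' ∈ 𝒜 X :=
    add_mem hA (Submodule.smul_mem _ _ (hVX A hA))
  have hA'norm : ‖A'‖ ≤ (1 + 2 * h ^ 2 * ‖V‖ ^ 2) * ‖A‖ := by
    have := norm_sub_smul_comm_le hVs A (-h)
    rw [neg_sq] at this
    refine le_trans (le_of_eq ?_) this
    rw [hA', hi]
    push_cast
    rw [neg_mul, neg_smul, sub_neg_eq_add]
  -- By the Jacobi identity, the first term is an infinitesimal conjugation of [A', B], the second
  -- is quadratic in h, and only the third, with the terms that meet X, contributes growth at first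
  -- order.
  have hdecomp : ⁅A, B - i • ⁅K + H₂, B⁆⁆
      = (⁅A', B⁆ - i • ⁅K, ⁅A', B⁆⁆) + i • ⁅K, ⁅i • ⁅V, A⁆, B⁆⁆ - i • ⁅A, ⁅H₂, B⁆⁆ := by
    have e1 : ⁅A', B⁆ = ⁅A, B⁆ - i • ⁅⁅A, K⁆, B⁆ := by
      rw [hA', comm_add_left, comm_smul_left, hAK, ← comm_skew V A, comm_neg_left, smul_neg, sub_neg_eq_add]
    have e2 : ⁅i • ⁅V, A⁆, B⁆ = ⁅A', B⁆ - ⁅A, B⁆ := by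
      rw [hA', comm_add_left, add_sub_cancel_left]
    rw [e2, comm_sub_right, comm_smul_right, comm_add_left, comm_add_right, comm_leibniz A K B,
      comm_sub_right K, e1]
    simp only [smul_add, smul_sub]
    abel
  have t1 : ‖⁅A', B⁆ - i • ⁅K, ⁅A', B⁆⁆‖
      ≤ (1 + 2 * h ^ 2 * ‖K‖ ^ 2) * (c * ((1 + 2 * h ^ 2 * ‖V‖ ^ 2) * ‖A‖)) :=
    (norm_sub_smul_comm_le hKs _ h).trans (mul_le_mul_of_nonneg_left
      ((norm_comm_le_commNorm hA'mem B).trans (mul_le_mul_of_nonneg_left hA'norm hc0))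
      (by positivity))
  have t2 : ‖i • ⁅K, ⁅i • ⁅V, A⁆, B⁆⁆‖ ≤ h * (2 * ‖K‖ * (2 * (h * (2 * ‖V‖ * ‖A‖)) * ‖B‖)) := by
    rw [norm_smul, hin]
    refine mul_le_mul_of_nonneg_left ((norm_comm_le _ _).trans ?_) h0.le
    refine mul_le_mul_of_nonneg_left ((norm_comm_le _ _).trans ?_) (by positivity)
    rw [norm_smul, hin]
    have := norm_comm_le V A
    gcongr
  have t3 : ‖i • ⁅A, ⁅H₂, B⁆⁆‖ ≤ h * (2 * ‖A‖ * τ) := by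
    rw [norm_smul, hin]
    refine mul_le_mul_of_nonneg_left ((norm_comm_le _ _).trans ?_) h0.le
    refine mul_le_mul_of_nonneg_left ?_ (by positivity)
    rw [hH₂, comm_sum_left]
    refine (norm_sum_le _ _).trans (Finset.sum_le_sum fun Z hZ => ?_)
    rw [Finset.mem_filter, Finset.mem_powerset] at hZ
    rw [mul_comm]
    exact norm_comm_le_commNorm (hΦ Z hZ.1) B
  rw [hsplit, hdecomp]
  refine (norm_sub_le _ _).trans ((add_le_add ((norm_add_le _ _).trans (add_le_add t1 t2)) t3).trans
    ?_)
  -- The two conjugation factors multiply to a quartic term; it is absorbed because h ≤ 1.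
  have h4 : h ^ 4 ≤ h ^ 2 := pow_le_pow_of_le_one h0.le h1 (by norm_num)
  have h5 : 0 ≤ 4 * ‖K‖ ^ 2 * ‖V‖ ^ 2 * c * ‖A‖ := by positivity
  have h6 := mul_le_mul_of_nonneg_right h4 h5
  linarith

/-! ### The Lieb-Robinson bound -/

/-- A sum over sets that meet `X` is bounded by a sum over the points of `X`. -/
theorem sum_not_disjoint_le {P : Finset (Finset ι)} {X : Finset ι}
    {g : Finset ι → ℝ} (hg : ∀ Z ∈ P, 0 ≤ g Z) :
    ∑ Z ∈ P with ¬ Disjoint Z X, g Z ≤ ∑ x ∈ X, ∑ Z ∈ P with x ∈ Z, g Z := by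
  simp only [Finset.sum_filter]
  rw [Finset.sum_comm]
  refine Finset.sum_le_sum fun Z hZ => ?_
  rw [ite_not]
  split_ifs with h
  rotate_left
  · obtain ⟨x, hxZ, hxX⟩ := Finset.not_disjoint_iff.1 h
    refine le_trans (le_of_eq ?_) (Finset.single_le_sum (f := fun x => if x ∈ Z then g Z else 0)
      (fun y _ => ?_) hxX)
    · simp [hxZ]
    · split_ifs
      · exact hg Z hZ
      · exact le_rfl
  · refine Finset.sum_nonneg fun y _ => ?_
    split_ifs
    · exact hg Z hZ
    · exact le_rfl

/-- Sums over sets, weighted with a sum over the points of the set, written as sums over points. -/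
theorem sum_mul_sum_eq {P : Finset (Finset ι)} {Λ : Finset ι} (w : Finset ι → ℝ)
    (g : ι → ℝ) :
    ∑ Z ∈ P, w Z * ∑ z ∈ Λ with z ∈ Z, g z = ∑ z ∈ Λ, g z * ∑ Z ∈ P with z ∈ Z, w Z := by
  simp only [Finset.mul_sum, Finset.sum_filter, mul_ite, mul_zero]
  rw [Finset.sum_comm]
  refine Finset.sum_congr rfl fun z _ => Finset.sum_congr rfl fun Z _ => ?_
  simp only [mul_comm]

theorem hasDerivAt_pow_div_factorial (L a : ℝ) (n : ℕ) (x : ℝ) :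
    HasDerivAt (fun t => (L * (t - a)) ^ (n + 1) / (n + 1).factorial)
      (L * ((L * (x - a)) ^ n / n.factorial)) x := by
  have h := (((hasDerivAt_id x).sub_const a).const_mul L).pow (n + 1)
  have h2 := h.div_const ((n + 1).factorial : ℝ)
  refine h2.congr_deriv ?_
  have : (n.factorial : ℝ) ≠ 0 := by positivity
  rw [Nat.factorial_succ]
  push_cast
  simp only [id]
  field_simp

/-- The bounds for all X ⊆ Λ form a coupled linear system: X is driven by the sets Z that meet it.
By the convolution inequality the majorant μ satisfies ∑ ‖Φ(Z)‖ μ(Z) ≤ C N μ(X), so it grows fast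
enough, at rate 2 C N, to dominate. Comparison with μ is by iteration. -/
theorem lieb_robinson_forward {𝒜 : Finset ι → Submodule ℂ 𝔄} (h𝒜 : IsLocalNet 𝒜)
    {Λ : Finset ι} {Φ : ℝ → Finset ι → 𝔄} {V b : ℝ → 𝔄} {s T : ℝ} (hsT : s ≤ T)
    (hVs : ∀ t ∈ Set.Icc s T, IsSelfAdjoint (V t))
    (hVX : ∀ t ∈ Set.Icc s T, ∀ X ⊆ Λ, ∀ A ∈ 𝒜 X, ⁅V t, A⁆ ∈ 𝒜 X)
    (hΦ : ∀ t ∈ Set.Icc s T, ∀ Z ⊆ Λ, Φ t Z ∈ 𝒜 Z)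
    (hΦs : ∀ t ∈ Set.Icc s T, ∀ Z ⊆ Λ, IsSelfAdjoint (Φ t Z))
    (hb : ∀ t ∈ Set.Icc s T, HasDerivAt b
      ((-Complex.I) • ⁅∑ Z ∈ Λ.powerset, Φ t Z + V t, b t⁆) t)
    {F : ι → ι → ℝ} {f₀ C N : ℝ} (hf₀ : 0 < f₀)
    (hF : ∀ x ∈ Λ, ∀ y ∈ Λ, 0 ≤ F x y) (hFd : ∀ x ∈ Λ, F x x = f₀)
    (hN0 : 0 ≤ N) (hconv : ∀ x ∈ Λ, ∀ y ∈ Λ, ∑ z ∈ Λ, F x z * F z y ≤ C * F x y)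
    (hN : ∀ t ∈ Set.Icc s T, ∀ x ∈ Λ, ∀ y ∈ Λ,
      ∑ Z ∈ Λ.powerset with x ∈ Z ∧ y ∈ Z, ‖Φ t Z‖ ≤ N * F x y)
    {Y : Finset ι} (hY : Y ⊆ Λ)
    (hcomm : ∀ W ⊆ Λ, Disjoint W Y → ∀ A ∈ 𝒜 W, ⁅A, b s⁆ = 0)
    {X : Finset ι} (hX : X ⊆ Λ) {A : 𝔄} (hA : A ∈ 𝒜 X) :
    ‖⁅A, b T⁆‖ ≤ 2 / f₀ * ‖A‖ * ‖b s‖ * Real.exp (2 * C * (T - s) * N)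
      * ∑ x ∈ X, ∑ y ∈ Y, F x y := by
  set β := ‖b s‖ with hβ
  have hβ0 : 0 ≤ β := norm_nonneg _
  have hHs : ∀ t ∈ Set.Icc s T,
      IsSelfAdjoint (∑ Z ∈ Λ.powerset, Φ t Z + V t) := fun t ht =>
    (isSelfAdjoint_sum _ fun Z hZ => hΦs t ht Z (Finset.mem_powerset.1 hZ)).add
      (hVs t ht)
  have hbnorm : ∀ t ∈ Set.Icc s T, ‖b t‖ ≤ β := by
    intro t ht
    have hsub : Set.uIcc s t ⊆ Set.Icc s T := by
      rw [Set.uIcc_of_le ht.1]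
      exact Set.Icc_subset_Icc_right ht.2
    have := norm_le_of_comm_derivative (f := b) (R := fun _ => 0) (ρ := 0)
      (fun x hx => hHs x (hsub hx)) (fun x hx => by rw [add_zero]; exact hb x (hsub hx))
      (fun x _ => by simp)
    simpa using this
  let G : ι → ℝ := fun x => ∑ y ∈ Y, F x y
  have hG0 : ∀ x ∈ Λ, 0 ≤ G x := fun x hx => Finset.sum_nonneg fun y hy => hF x hx y (hY hy)
  let μ : Finset ι → ℝ → ℝ := fun X t =>
    2 * β / f₀ * Real.exp (2 * C * (t - s) * N) * ∑ x ∈ X, G x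
  have hμ0 : ∀ X ⊆ Λ, ∀ t, 0 ≤ μ X t := fun X hX t =>
    mul_nonneg (by positivity) (Finset.sum_nonneg fun x hx => hG0 x (hX hx))
  have hμd : ∀ X, ∀ t, HasDerivAt (μ X) (2 * C * N * μ X t) t := by
    intro X t
    have h := ((((((hasDerivAt_id t).sub_const s).const_mul (2 * C)).mul_const N).exp).const_mul
      (2 * β / f₀)).mul_const (∑ x ∈ X, G x)
    refine h.congr_deriv ?_
    simp only [μ, id]
    ring
  have hsumG : ∀ t ∈ Set.Icc s T, ∀ X ⊆ Λ,
      ∑ Z ∈ Λ.powerset with ¬ Disjoint Z X, ‖Φ t Z‖ * ∑ z ∈ Z, G z ≤ C * N * ∑ x ∈ X, G x := by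
    intro t ht X hX
    have hfil : ∀ Z ∈ Λ.powerset, ∑ z ∈ Z, G z = ∑ z ∈ Λ with z ∈ Z, G z := fun Z hZ => by
      rw [Finset.filter_mem_eq_inter, Finset.inter_eq_right.2 (Finset.mem_powerset.1 hZ)]
    refine (sum_not_disjoint_le fun Z hZ => mul_nonneg (norm_nonneg _)
      (Finset.sum_nonneg fun z hz => hG0 z (Finset.mem_powerset.1 hZ hz))).trans ?_
    rw [Finset.mul_sum]
    refine Finset.sum_le_sum fun x hx => ?_
    have hx' := hX hx
    rw [Finset.sum_congr rfl fun Z hZ => by rw [hfil Z (Finset.mem_filter.1 hZ).1],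
      sum_mul_sum_eq]
    calc ∑ z ∈ Λ, G z * ∑ Z ∈ Λ.powerset.filter (x ∈ ·) with z ∈ Z, ‖Φ t Z‖
        ≤ ∑ z ∈ Λ, G z * (N * F x z) := by
          refine Finset.sum_le_sum fun z hz => mul_le_mul_of_nonneg_left ?_ (hG0 z hz)
          rw [Finset.filter_filter]
          exact hN t ht x hx' z hz
      _ = N * ∑ y ∈ Y, ∑ z ∈ Λ, F x z * F z y := by
          rw [Finset.sum_comm, Finset.mul_sum]
          refine Finset.sum_congr rfl fun z _ => ?_
          simp only [G, Finset.sum_mul, Finset.mul_sum]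
          exact Finset.sum_congr rfl fun y _ => by ring
      _ ≤ N * ∑ y ∈ Y, C * F x y :=
          mul_le_mul_of_nonneg_left (Finset.sum_le_sum fun y hy => hconv x hx' y (hY hy)) hN0
      _ = C * N * G x := by rw [← Finset.mul_sum]; ring
  -- A crude bound for the total coupling. It depends on the volume but occurs only in the remainder
  -- of the iteration, which tends to 0.
  set L := 2 * (N * ∑ x ∈ Λ, F x x) with hL
  have hL0 : 0 ≤ L := by
    have : 0 ≤ ∑ x ∈ Λ, F x x := Finset.sum_nonneg fun x hx => hF x hx x hx
    positivity
  have hsumL : ∀ t ∈ Set.Icc s T, ∀ X ⊆ Λ,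
      2 * ∑ Z ∈ Λ.powerset with ¬ Disjoint Z X, ‖Φ t Z‖ ≤ L := by
    intro t ht X hX
    refine mul_le_mul_of_nonneg_left ?_ (by norm_num)
    refine (sum_not_disjoint_le fun Z _ => norm_nonneg _).trans ?_
    rw [Finset.mul_sum]
    refine (Finset.sum_le_sum fun x hx => ?_).trans (Finset.sum_le_sum_of_subset_of_nonneg hX
      fun x hx _ => mul_nonneg hN0 (hF x hx x hx))
    simpa using hN t ht x (hX hx) x (hX hx)
  -- If X meets Y, the double sum contains a diagonal term f₀, so the prefactor 2/f₀ makes μ at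
  -- least the trivial bound 2‖b s‖; otherwise the commutator vanishes.
  have hinit : ∀ X ⊆ Λ, commNorm (𝒜 X) (b s) ≤ μ X s := by
    intro X hX
    refine commNorm_le_of (hμ0 X hX s) fun A hA => ?_
    by_cases hdis : Disjoint X Y
    · rw [hcomm X hX hdis A hA, norm_zero]
      exact mul_nonneg (hμ0 X hX s) (norm_nonneg _)
    · obtain ⟨x, hxX, hxY⟩ := Finset.not_disjoint_iff.1 hdis
      have h1 : f₀ ≤ ∑ x ∈ X, G x := by
        rw [← hFd x (hX hxX)]
        exact (Finset.single_le_sum (f := fun y => F x y)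
          (fun y hy => hF x (hX hxX) y (hY hy)) hxY).trans
          (Finset.single_le_sum (f := G) (fun x hx => hG0 x (hX hx)) hxX)
      have h2 : 2 * β ≤ μ X s := by
        simp only [μ, sub_self, mul_zero, zero_mul, Real.exp_zero, mul_one]
        rw [div_mul_eq_mul_div, le_div_iff₀ hf₀]
        exact mul_le_mul_of_nonneg_left h1 (by positivity)
      calc ‖⁅A, b s⁆‖ ≤ 2 * ‖A‖ * β := norm_comm_le _ _
        _ = 2 * β * ‖A‖ := by ring
        _ ≤ _ := mul_le_mul_of_nonneg_right h2 (norm_nonneg _)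
  -- Inserting the n-th bound into the differential inequality reproduces μ and integrates the
  -- remainder once more. The case n = 0 is the trivial commutator bound.
  have hpicard : ∀ n : ℕ, ∀ X ⊆ Λ, ∀ t ∈ Set.Icc s T,
      commNorm (𝒜 X) (b t) ≤ μ X t + 2 * β * ((L * (t - s)) ^ n / n.factorial) := by
    intro n
    induction n with
    | zero =>
      intro X hX t ht
      have h1 : commNorm (𝒜 X) (b t) ≤ 2 * β := by
        refine commNorm_le_of (by positivity) fun A _ => (norm_comm_le _ _).trans ?_
        have := hbnorm t ht
        have h := mul_le_mul_of_nonneg_left this (show 0 ≤ 2 * ‖A‖ by positivity)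
        linarith
      have h2 := hμ0 X hX t
      simpa using h1.trans (le_add_of_nonneg_left h2)
    | succ n ih =>
      intro X hX
      refine le_of_first_order_bound (commNorm_le_add (𝒜 X)) hb
        (B' := fun t => 2 * C * N * μ X t + 2 * β * (L * ((L * (t - s)) ^ n / n.factorial)))
        ?_ (fun x => (hμd X x).add ((hasDerivAt_pow_div_factorial L s n x).const_mul _)) ?_
      · simpa using hinit X hX
      · intro x hx
        obtain ⟨κ, hκ⟩ := commNorm_first_order h𝒜 (X := X) (hVs x hx) (hVX x hx X hX) (hΦ x hx) (hΦs x hx) (b x)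
        refine ⟨κ, fun h h0 h1 => ?_⟩
        rw [real_smul_neg_I_smul, ← sub_eq_add_neg]
        refine (hκ h h0 h1).trans ?_
        gcongr
        set E := 2 * β * ((L * (x - s)) ^ n / n.factorial) with hE
        have hE0 : 0 ≤ E := by
          have : 0 ≤ x - s := sub_nonneg.2 hx.1
          positivity
        have hEL : 2 * β * (L * ((L * (x - s)) ^ n / n.factorial)) = L * E := by rw [hE]; ring
        rw [hEL]
        calc 2 * ∑ Z ∈ Λ.powerset with ¬ Disjoint Z X, ‖Φ x Z‖ * commNorm (𝒜 Z) (b x)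
            ≤ 2 * ∑ Z ∈ Λ.powerset with ¬ Disjoint Z X, ‖Φ x Z‖ * (μ Z x + E) := by
              refine mul_le_mul_of_nonneg_left (Finset.sum_le_sum fun Z hZ => ?_) (by norm_num)
              exact mul_le_mul_of_nonneg_left
                (ih Z (Finset.mem_powerset.1 (Finset.mem_filter.1 hZ).1) x hx) (norm_nonneg _)
          _ = 2 * (2 * β / f₀ * Real.exp (2 * C * (x - s) * N)) *
                (∑ Z ∈ Λ.powerset with ¬ Disjoint Z X, ‖Φ x Z‖ * ∑ z ∈ Z, G z)
              + (2 * ∑ Z ∈ Λ.powerset with ¬ Disjoint Z X, ‖Φ x Z‖) * E := by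
              rw [Finset.mul_sum, Finset.mul_sum, Finset.mul_sum, Finset.sum_mul,
                ← Finset.sum_add_distrib]
              refine Finset.sum_congr rfl fun Z _ => ?_
              simp only [μ]
              ring
          _ ≤ 2 * (2 * β / f₀ * Real.exp (2 * C * (x - s) * N)) * (C * N * ∑ x ∈ X, G x)
              + L * E :=
              add_le_add (mul_le_mul_of_nonneg_left (hsumG x hx X hX) (by positivity))
                (mul_le_mul_of_nonneg_right (hsumL x hx X hX) hE0)
          _ = 2 * C * N * μ X x + L * E := by simp only [μ]; ring
  have hlim : commNorm (𝒜 X) (b T) ≤ μ X T := by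
    have h1 : Tendsto (fun n : ℕ => μ X T + 2 * β * ((L * (T - s)) ^ n / n.factorial)) atTop
        (𝓝 (μ X T + 2 * β * 0)) :=
      ((FloorSemiring.tendsto_pow_div_factorial_atTop (L * (T - s))).const_mul _).const_add _
    rw [mul_zero, add_zero] at h1
    exact ge_of_tendsto' h1 fun n => hpicard n X hX T (Set.right_mem_Icc.2 hsT)
  calc ‖⁅A, b T⁆‖ ≤ commNorm (𝒜 X) (b T) * ‖A‖ := norm_comm_le_commNorm hA _
    _ ≤ μ X T * ‖A‖ := mul_le_mul_of_nonneg_right hlim (norm_nonneg _)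
    _ = _ := by simp only [μ, G]; ring

end LatticeFermions

/-! ### Unitary propagators, Duhamel's formula and time reversal. -/

namespace LatticeFermions

variable {𝔄 : Type*} [CStarAlgebra 𝔄] {ι : Type*} [DecidableEq ι]

/-! ### Propagators in C*-algebras -/

/-- `U` solves `i d/dt U(t,s) = H(t) U(t,s)`, `U(s,s) = 1` on `J`, for a selfadjoint `H`. -/
structure IsUnitaryPropagator (J : Set ℝ) (H : ℝ → 𝔄) (U : ℝ → ℝ → 𝔄) : Prop where
  ordConnected : J.OrdConnected
  isOpen : IsOpen J
  selfAdjoint : ∀ t ∈ J, IsSelfAdjoint (H t)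
  self_eq : ∀ s ∈ J, U s s = 1
  hasDerivAt : ∀ s ∈ J, ∀ t ∈ J,
    HasDerivAt (fun τ => U τ s) ((-Complex.I) • (H t * U t s)) t

theorem star_neg_I_smul_mul {H E : 𝔄} (hH : IsSelfAdjoint H) :
    star ((-Complex.I) • (H * E)) = Complex.I • (star E * H) := by
  rw [star_smul, star_mul, hH.star_eq]
  simp

/-- The derivative of E* E vanishes since H is selfadjoint. Applied to U it gives isometry; applied
to a difference of two solutions it gives uniqueness. -/
theorem star_mul_self_eq_of_schroedinger {J : Set ℝ} (hJ : J.OrdConnected) {H E : ℝ → 𝔄}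
    (hH : ∀ t ∈ J, IsSelfAdjoint (H t))
    (hE : ∀ t ∈ J, HasDerivAt E ((-Complex.I) • (H t * E t)) t) {s t : ℝ} (hs : s ∈ J)
    (ht : t ∈ J) : star (E t) * E t = star (E s) * E s := by
  have hsub : Set.uIcc s t ⊆ J := hJ.uIcc_subset hs ht
  have h := norm_le_of_comm_derivative (f := fun τ => star (E τ) * E τ - star (E s) * E s)
    (R := fun _ => 0) (K := fun _ => 0) (s := s) (t := t) (ρ := 0) (fun _ _ => IsSelfAdjoint.zero _)
    (fun x hx => by
      have hx' := hE x (hsub hx)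
      refine ((hx'.star.mul hx').sub_const _).congr_deriv ?_
      rw [star_neg_I_smul_mul (hH x (hsub hx)), comm_eq_zero (by simp), smul_zero, add_zero,
        smul_mul_assoc, mul_smul_comm, neg_smul, mul_assoc, add_neg_cancel])
    (fun x _ => by simp)
  rw [sub_self, norm_zero, zero_mul, add_zero] at h
  exact sub_eq_zero.1 (norm_le_zero_iff.1 h)

/-- Heisenberg evolution in a C*-algebra. -/
abbrev conjStar (U A : 𝔄) : 𝔄 := star U * A * U

namespace IsUnitaryPropagator

variable {J : Set ℝ} {H : ℝ → 𝔄} {U : ℝ → ℝ → 𝔄}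

theorem star_mul_self (hU : IsUnitaryPropagator J H U) {s t : ℝ} (hs : s ∈ J) (ht : t ∈ J) :
    star (U t s) * U t s = 1 := by
  rw [star_mul_self_eq_of_schroedinger hU.ordConnected hU.selfAdjoint (hU.hasDerivAt s hs) hs ht,
    hU.self_eq s hs, star_one, one_mul]

theorem norm_le_one (hU : IsUnitaryPropagator J H U) {s t : ℝ} (hs : s ∈ J) (ht : t ∈ J) :
    ‖U t s‖ ≤ 1 := by
  have h := CStarRing.norm_star_mul_self (x := U t s)
  rw [hU.star_mul_self hs ht] at h
  have h1 := norm_one_le (𝔄 := 𝔄)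
  by_contra! h2
  nlinarith

theorem norm_star_le_one (hU : IsUnitaryPropagator J H U) {s t : ℝ} (hs : s ∈ J) (ht : t ∈ J) :
    ‖star (U t s)‖ ≤ 1 := by
  rw [norm_star]; exact hU.norm_le_one hs ht

/-- The Schrödinger evolution of operators satisfies the von Neumann equation. -/
theorem hasDerivAt_conj (hU : IsUnitaryPropagator J H U) {s t : ℝ} (hs : s ∈ J) (ht : t ∈ J)
    (B : 𝔄) : HasDerivAt (fun τ => U τ s * B * star (U τ s))
      ((-Complex.I) • ⁅H t, U t s * B * star (U t s)⁆) t := by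
  have h := hU.hasDerivAt s hs t ht
  refine ((h.mul_const B).mul h.star).congr_deriv ?_
  rw [star_neg_I_smul_mul (hU.selfAdjoint t ht), Ring.lie_def, smul_mul_assoc, smul_mul_assoc,
    mul_smul_comm, smul_sub, neg_smul, neg_smul, neg_smul, sub_neg_eq_add]
  simp only [mul_assoc]

/-- An isometry in a C*-algebra need not be unitary. However, U U* - 1 solves the homogeneous von
Neumann equation and starts at 0. -/
theorem self_mul_star (hU : IsUnitaryPropagator J H U) {s t : ℝ} (hs : s ∈ J) (ht : t ∈ J) :
    U t s * star (U t s) = 1 := by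
  have hsub : Set.uIcc s t ⊆ J := hU.ordConnected.uIcc_subset hs ht
  have h := norm_le_of_comm_derivative (f := fun τ => U τ s * 1 * star (U τ s) - 1)
    (R := fun _ => 0) (K := H) (s := s) (t := t) (ρ := 0)
    (fun x hx => hU.selfAdjoint x (hsub hx))
    (fun x hx => by
      refine ((hU.hasDerivAt_conj hs (hsub hx) 1).sub_const _).congr_deriv ?_
      rw [add_zero, comm_sub_right, comm_eq_zero (b := (1 : 𝔄)) (by simp), sub_zero])
    (fun x _ => by simp)
  simp only [mul_one, hU.self_eq s hs, star_one, sub_self, norm_zero, zero_mul, add_zero] at h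
  exact sub_eq_zero.1 (norm_le_zero_iff.1 h)

/-- In τ, both U(τ,s) and U(τ,t) U(s,t)* solve the same equation and agree at τ = s; now take τ = t.
This gives differentiability in the second argument, which the definition of a propagator does not
provide. -/
theorem eq_star (hU : IsUnitaryPropagator J H U) {s t : ℝ} (hs : s ∈ J) (ht : t ∈ J) :
    U t s = star (U s t) := by
  have h := star_mul_self_eq_of_schroedinger hU.ordConnected hU.selfAdjoint
    (E := fun τ => U τ s - U τ t * star (U s t))
    (fun τ hτ => by
      refine ((hU.hasDerivAt s hs τ hτ).sub ((hU.hasDerivAt t ht τ hτ).mul_const _)).congr_deriv ?_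
      rw [smul_mul_assoc, mul_sub, smul_sub, mul_assoc]) hs ht
  simp only [hU.self_eq s hs, hU.self_eq t ht, hU.self_mul_star ht hs, sub_self, star_zero,
    zero_mul, one_mul] at h
  exact sub_eq_zero.1 ((CStarRing.star_mul_self_eq_zero_iff _).1 h)

/-- The Heisenberg evolution, as a function of the initial time. -/
theorem hasDerivAt_conjStar (hU : IsUnitaryPropagator J H U) {s t : ℝ} (hs : s ∈ J) (ht : t ∈ J)
    (A : 𝔄) : HasDerivAt (fun σ => conjStar (U t σ) A)
      ((-Complex.I) • ⁅H s, conjStar (U t s) A⁆) s := by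
  have e : ∀ σ ∈ J, conjStar (U t σ) A = U σ t * A * star (U σ t) := fun σ hσ => by
    rw [conjStar, hU.eq_star hσ ht, star_star]
  rw [e s hs]
  exact (hU.hasDerivAt_conj ht hs A).congr_of_eventuallyEq
    (Filter.eventuallyEq_of_mem (hU.isOpen.mem_nhds hs) e)

/-- Moves the evolution from A to B, so that A stays in a fixed local algebra. -/
theorem norm_comm_conjStar_le (hU : IsUnitaryPropagator J H U) {s t : ℝ} (hs : s ∈ J) (ht : t ∈ J)
    (A B : 𝔄) : ‖⁅conjStar (U t s) A, B⁆‖ ≤ ‖⁅A, U t s * B * star (U t s)⁆‖ := by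
  have e : ⁅conjStar (U t s) A, B⁆
      = star (U t s) * ⁅A, U t s * B * star (U t s)⁆ * U t s := by
    have h1 := hU.star_mul_self hs ht
    simp only [Ring.lie_def, conjStar, mul_sub, sub_mul]
    congr 1
    · calc star (U t s) * A * U t s * B = star (U t s) * A * U t s * B * 1 := by rw [mul_one]
        _ = _ := by rw [← h1]; simp only [mul_assoc]
    · calc B * (star (U t s) * A * U t s) = 1 * B * (star (U t s) * A * U t s) := by rw [one_mul]
        _ = _ := by rw [← h1]; simp only [mul_assoc]
  rw [e]
  calc _ ≤ ‖star (U t s)‖ * ‖⁅A, U t s * B * star (U t s)⁆‖ * ‖U t s‖ :=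
        (norm_mul_le _ _).trans (mul_le_mul_of_nonneg_right (norm_mul_le _ _) (norm_nonneg _))
    _ ≤ 1 * ‖⁅A, U t s * B * star (U t s)⁆‖ * 1 := by
        have := hU.norm_le_one hs ht
        have := hU.norm_star_le_one hs ht
        gcongr
    _ = _ := by ring

/-- Duhamel's formula, as an estimate. -/
theorem norm_conjStar_sub_le (hU : IsUnitaryPropagator J H U) {H' : ℝ → 𝔄} {U' : ℝ → ℝ → 𝔄}
    (hU' : IsUnitaryPropagator J H' U') {s t : ℝ} (hs : s ∈ J) (ht : t ∈ J) {A : 𝔄} {ρ : ℝ}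
    (hρ : ∀ u ∈ Set.uIcc s t, ‖⁅H u - H' u, conjStar (U' t u) A⁆‖ ≤ ρ) :
    ‖conjStar (U t s) A - conjStar (U' t s) A‖ ≤ ρ * |t - s| := by
  have hsub : Set.uIcc t s ⊆ J := hU.ordConnected.uIcc_subset ht hs
  -- The running variable is the initial time, from t to s: at u = t both evolutions equal A, and
  -- the generator difference is the inhomogeneity.
  have h := norm_le_of_comm_derivative (f := fun u => conjStar (U t u) A - conjStar (U' t u) A)
    (R := fun u => (-Complex.I) • ⁅H u - H' u, conjStar (U' t u) A⁆) (K := H) (s := t) (t := s)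
    (ρ := ρ) (fun x hx => hU.selfAdjoint x (hsub hx))
    (fun x hx => by
      refine ((hU.hasDerivAt_conjStar (hsub hx) ht A).sub
        (hU'.hasDerivAt_conjStar (hsub hx) ht A)).congr_deriv ?_
      rw [comm_sub_right, comm_sub_left, smul_sub, smul_sub]
      abel)
    (fun x hx => by
      rw [norm_smul, norm_neg, Complex.norm_I, one_mul]
      exact hρ x (by rwa [Set.uIcc_comm]))
  simp only [hU.self_eq t ht, hU'.self_eq t ht, sub_self, norm_zero, zero_add] at h
  rwa [abs_sub_comm] at h

theorem norm_conjStar_sub_self_le (hU : IsUnitaryPropagator J H U) {s t : ℝ} (hs : s ∈ J)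
    (ht : t ∈ J) {A : 𝔄} {ρ : ℝ} (hρ : ∀ u ∈ Set.uIcc s t, ‖⁅H u, A⁆‖ ≤ ρ) :
    ‖conjStar (U t s) A - A‖ ≤ ρ * |t - s| := by
  have h1 : IsUnitaryPropagator J (fun _ => (0 : 𝔄)) (fun _ _ => 1) :=
    ⟨hU.ordConnected, hU.isOpen, fun _ _ => IsSelfAdjoint.zero _, fun _ _ => rfl,
      fun s _ t _ => (hasDerivAt_const t (1 : 𝔄)).congr_deriv (by simp)⟩
  have h := hU.norm_conjStar_sub_le h1 (A := A) hs ht (ρ := ρ) (fun u hu => by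
    simpa [conjStar] using hρ u hu)
  simpa [conjStar] using h

/-- If the generators leave a subspace invariant, so does the Heisenberg evolution, up to
closures. -/
theorem conjStar_mem_closure (hU : IsUnitaryPropagator J H U) {S : Submodule ℂ 𝔄}
    (hS : ∀ t ∈ J, ∀ σ ∈ S, ⁅H t, σ⁆ ∈ S) {s t : ℝ} (hs : s ∈ J) (ht : t ∈ J) {A : 𝔄}
    (hA : A ∈ S) : conjStar (U t s) A ∈ closure (S : Set 𝔄) := by
  have hne : (S : Set 𝔄).Nonempty := ⟨0, S.zero_mem⟩
  have hsub : Set.uIcc t s ⊆ J := hU.ordConnected.uIcc_subset ht hs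
  have h := le_of_first_order_bound_two_sided (p := fun B : 𝔄 => Metric.infDist B (S : Set 𝔄))
    (c := 1) (ρ := 0) (f := fun u => conjStar (U t u) A) (s := t) (t := s)
    (fun x y => by
      rw [one_mul, ← dist_eq_norm]
      exact Metric.infDist_le_infDist_add_dist)
    (fun x hx => hU.hasDerivAt_conjStar (hsub hx) ht A)
    (fun x hx => ?_)
  · simp only [hU.self_eq t ht, conjStar, star_one, one_mul, mul_one, zero_mul, add_zero,
      Metric.infDist_zero_of_mem (show A ∈ (S : Set 𝔄) from hA)] at h
    exact (Metric.mem_closure_iff_infDist_zero hne).2 (le_antisymm h Metric.infDist_nonneg)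
  · set a := conjStar (U t x) A with ha
    refine ⟨2 * ‖H x‖ ^ 2 * Metric.infDist a S, fun h _ => ?_⟩
    rw [real_smul_neg_I_smul, ← sub_eq_add_neg, mul_zero, add_zero]
    have hc : 0 < 1 + 2 * h ^ 2 * ‖H x‖ ^ 2 := by positivity
    -- The infinitesimal conjugation maps S into itself and expands distances only at second order,
    -- so the distance to S has no first order growth.
    have hle : Metric.infDist (a - ((h : ℂ) * Complex.I) • ⁅H x, a⁆) S
        / (1 + 2 * h ^ 2 * ‖H x‖ ^ 2) ≤ Metric.infDist a S := by
      refine (Metric.le_infDist hne).2 fun σ hσ => ?_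
      rw [div_le_iff₀ hc]
      have hmem : σ - ((h : ℂ) * Complex.I) • ⁅H x, σ⁆ ∈ S :=
        S.sub_mem hσ (S.smul_mem _ (hS x (hsub hx) σ hσ))
      refine (Metric.infDist_le_dist_of_mem hmem).trans ?_
      rw [dist_eq_norm, dist_eq_norm, mul_comm ‖a - σ‖]
      refine le_trans (le_of_eq ?_) (norm_sub_smul_comm_le (hU.selfAdjoint x (hsub hx)) (a - σ) h)
      rw [comm_sub_right, smul_sub]
      congr 1
      abel
    rw [div_le_iff₀ hc] at hle
    linarith

end IsUnitaryPropagator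

/-- The Lieb-Robinson bound for Heisenberg dynamics generated by a local interaction `Φ` and
on-site terms `V`. -/
theorem lieb_robinson {𝒜 : Finset ι → Submodule ℂ 𝔄} (h𝒜 : IsLocalNet 𝒜)
    {Λ : Finset ι} {J : Set ℝ} {Φ : ℝ → Finset ι → 𝔄} {V : ℝ → 𝔄} {U : ℝ → ℝ → 𝔄}
    (hU : IsUnitaryPropagator J (fun t => ∑ Z ∈ Λ.powerset, Φ t Z + V t) U)
    (hVs : ∀ t ∈ J, IsSelfAdjoint (V t))
    (hVX : ∀ t ∈ J, ∀ X ⊆ Λ, ∀ A ∈ 𝒜 X, ⁅V t, A⁆ ∈ 𝒜 X)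
    (hΦ : ∀ t ∈ J, ∀ Z ⊆ Λ, Φ t Z ∈ 𝒜 Z)
    (hΦs : ∀ t ∈ J, ∀ Z ⊆ Λ, IsSelfAdjoint (Φ t Z))
    {F : ι → ι → ℝ} {f₀ C N : ℝ} (hf₀ : 0 < f₀)
    (hF : ∀ x ∈ Λ, ∀ y ∈ Λ, 0 ≤ F x y) (hFd : ∀ x ∈ Λ, F x x = f₀)
    (hN0 : 0 ≤ N) (hconv : ∀ x ∈ Λ, ∀ y ∈ Λ, ∑ z ∈ Λ, F x z * F z y ≤ C * F x y)
    (hN : ∀ t ∈ J, ∀ x ∈ Λ, ∀ y ∈ Λ,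
      ∑ Z ∈ Λ.powerset with x ∈ Z ∧ y ∈ Z, ‖Φ t Z‖ ≤ N * F x y)
    {Y : Finset ι} (hY : Y ⊆ Λ) {B : 𝔄}
    (hcomm : ∀ W ⊆ Λ, Disjoint W Y → ∀ A ∈ 𝒜 W, ⁅A, B⁆ = 0)
    {X : Finset ι} (hX : X ⊆ Λ) {A : 𝔄} (hA : A ∈ 𝒜 X) {s t : ℝ} (hs : s ∈ J) (ht : t ∈ J) :
    ‖⁅conjStar (U t s) A, B⁆‖ ≤ 2 / f₀ * ‖A‖ * ‖B‖ * Real.exp (2 * C * |t - s| * N)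
      * ∑ x ∈ X, ∑ y ∈ Y, F x y := by
  refine (hU.norm_comm_conjStar_le hs ht A B).trans ?_
  have hinit : U s s * B * star (U s s) = B := by rw [hU.self_eq s hs]; simp
  rcases le_total s t with hst | hts
  · have hsub : Set.Icc s t ⊆ J := hU.ordConnected.out hs ht
    have h := lieb_robinson_forward h𝒜 (b := fun τ => U τ s * B * star (U τ s)) hst
      (fun t ht => hVs t (hsub ht)) (fun t ht => hVX t (hsub ht)) (fun t ht => hΦ t (hsub ht))
      (fun t ht => hΦs t (hsub ht)) (fun τ hτ => hU.hasDerivAt_conj hs (hsub hτ) B) hf₀ hF hFd hN0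
      hconv (fun t ht => hN t (hsub ht)) hY (by simpa only [hinit] using hcomm) hX hA
    rw [abs_of_nonneg (sub_nonneg.2 hst)]
    simpa only [hinit] using h
  -- For t ≤ s time is reversed: τ ↦ U(-τ, s) is generated by the negative Hamiltonian, and the sign
  -- affects none of the hypotheses.
  · have hsub : Set.Icc t s ⊆ J := hU.ordConnected.out ht hs
    have hmem : ∀ x ∈ Set.Icc (-s) (-t), -x ∈ J := fun x hx =>
      hsub ⟨by linarith [hx.2], by linarith [hx.1]⟩
    have h := lieb_robinson_forward h𝒜 (b := fun τ => U (-τ) s * B * star (U (-τ) s))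
      (Φ := fun τ Z => -Φ (-τ) Z) (V := fun τ => -V (-τ)) (neg_le_neg hts)
      (fun t ht => (hVs _ (hmem t ht)).neg)
      (fun t ht X hX A hA => by
        rw [comm_neg_left]; exact Submodule.neg_mem _ (hVX _ (hmem t ht) X hX A hA))
      (fun t ht Z hZ => Submodule.neg_mem _ (hΦ _ (hmem t ht) Z hZ))
      (fun t ht Z hZ => (hΦs _ (hmem t ht) Z hZ).neg)
      (fun τ hτ => by
        refine ((hU.hasDerivAt_conj hs (hmem τ hτ) B).scomp τ (hasDerivAt_neg τ)).congr_deriv ?_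
        rw [Finset.sum_neg_distrib, ← neg_add, comm_neg_left, smul_neg, neg_smul, one_smul])
      hf₀ hF hFd hN0 hconv
      (fun t ht x hx y hy => by simpa only [norm_neg] using hN _ (hmem t ht) x hx y hy)
      hY (by simpa only [neg_neg, hinit] using hcomm) hX hA
    simp only [neg_neg, hinit] at h
    rw [abs_of_nonpos (by linarith)]
    rwa [neg_sub_neg, ← neg_sub t s] at h

/-! ### Commutators with differences of Hamiltonians -/

theorem norm_comm_sum_le {P : Finset (Finset ι)} {Λ : Finset ι} {Φ : Finset ι → 𝔄} {a : 𝔄}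
    {g : ι → ℝ} (h : ∀ Z ∈ P, ‖⁅Φ Z, a⁆‖ ≤ ‖Φ Z‖ * ∑ y ∈ Λ with y ∈ Z, g y) :
    ‖⁅∑ Z ∈ P, Φ Z, a⁆‖ ≤ ∑ y ∈ Λ, g y * ∑ Z ∈ P with y ∈ Z, ‖Φ Z‖ := by
  rw [comm_sum_left, ← sum_mul_sum_eq]
  exact (norm_sum_le _ _).trans (Finset.sum_le_sum h)

/-- The hypothesis `ha` is the shape of a Lieb-Robinson bound for a: a density g, summed over the
support. Exchanging the sums over sets and points reduces everything to the strength of each part of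
the difference at a single point: interactions inside ΛM, terms leaving ΛM, and potentials. -/
theorem norm_comm_hamiltonian_sub_le {𝒜 : Finset ι → Submodule ℂ 𝔄} {ΛM Λk Λl : Finset ι}
    (hMk : ΛM ⊆ Λk) (hkl : Λk ⊆ Λl) {Φl Φk : Finset ι → 𝔄}
    (hΦl : ∀ Z ⊆ Λl, Φl Z ∈ 𝒜 Z) (hΦk : ∀ Z ⊆ Λk, Φk Z ∈ 𝒜 Z) {vl vk : ι → ℝ} {n : ι → 𝔄}
    {r : ℝ} (hn : ∀ x, n x ∈ 𝒜 {x}) (hnr : ∀ x, ‖n x‖ ≤ r) {a : 𝔄} {g : ι → ℝ}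
    (hg : ∀ y ∈ Λk, 0 ≤ g y)
    (ha : ∀ (Y : Finset ι), ∀ B ∈ 𝒜 Y, ‖⁅B, a⁆‖ ≤ ‖B‖ * ∑ y ∈ Λk with y ∈ Y, g y)
    {η : ℝ} (hη0 : 0 ≤ η) {βl βk w : ι → ℝ}
    (hη : ∀ y ∈ ΛM, ∑ Z ∈ ΛM.powerset with y ∈ Z, ‖Φl Z - Φk Z‖ ≤ η)
    (hβl : ∀ y ∈ Λk, ∑ Z ∈ Λl.powerset with ¬ Z ⊆ ΛM ∧ y ∈ Z, ‖Φl Z‖ ≤ βl y)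
    (hβk : ∀ y ∈ Λk, ∑ Z ∈ Λk.powerset with ¬ Z ⊆ ΛM ∧ y ∈ Z, ‖Φk Z‖ ≤ βk y)
    (hw : ∀ y ∈ Λk, |vl y - vk y| ≤ w y) :
    ‖⁅(∑ Z ∈ Λl.powerset, Φl Z + ∑ x ∈ Λl, ((vl x : ℝ) : ℂ) • n x)
        - (∑ Z ∈ Λk.powerset, Φk Z + ∑ x ∈ Λk, ((vk x : ℝ) : ℂ) • n x), a⁆‖
      ≤ ∑ y ∈ Λk, g y * (η + βl y + βk y + r * w y) := by
  have hsplit : ∀ (Λ : Finset ι) (Φ : Finset ι → 𝔄), ΛM ⊆ Λ → ∑ Z ∈ Λ.powerset, Φ Z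
      = ∑ Z ∈ ΛM.powerset, Φ Z + ∑ Z ∈ Λ.powerset with ¬ Z ⊆ ΛM, Φ Z := by
    intro Λ Φ hΛ
    rw [← Finset.sum_filter_add_sum_filter_not Λ.powerset (fun Z => Z ⊆ ΛM)]
    congr 2
    ext Z
    simp only [Finset.mem_filter, Finset.mem_powerset]
    exact ⟨fun h => h.2, fun h => ⟨h.trans hΛ, h⟩⟩
  have hpot : ∑ x ∈ Λl, ((vl x : ℝ) : ℂ) • n x
      = ∑ x ∈ Λk, ((vl x : ℝ) : ℂ) • n x + ∑ x ∈ Λl \ Λk, ((vl x : ℝ) : ℂ) • n x := by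
    rw [add_comm, Finset.sum_sdiff hkl]
  have hdecomp : (∑ Z ∈ Λl.powerset, Φl Z + ∑ x ∈ Λl, ((vl x : ℝ) : ℂ) • n x)
        - (∑ Z ∈ Λk.powerset, Φk Z + ∑ x ∈ Λk, ((vk x : ℝ) : ℂ) • n x)
      = ∑ Z ∈ ΛM.powerset, (Φl Z - Φk Z) + ∑ Z ∈ Λl.powerset with ¬ Z ⊆ ΛM, Φl Z
        - ∑ Z ∈ Λk.powerset with ¬ Z ⊆ ΛM, Φk Z
        + ∑ x ∈ Λk, ((vl x - vk x : ℝ) : ℂ) • n x + ∑ x ∈ Λl \ Λk, ((vl x : ℝ) : ℂ) • n x := by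
    rw [hsplit Λl Φl (hMk.trans hkl), hsplit Λk Φk hMk, hpot]
    simp only [Finset.sum_sub_distrib, Complex.ofReal_sub, sub_smul]
    abel
  have t1 : ‖⁅∑ Z ∈ ΛM.powerset, (Φl Z - Φk Z), a⁆‖ ≤ ∑ y ∈ Λk, g y * η := by
    refine (norm_comm_sum_le fun Z hZ => ha Z _ ?_).trans (Finset.sum_le_sum fun y hy =>
      mul_le_mul_of_nonneg_left ?_ (hg y hy))
    · rw [Finset.mem_powerset] at hZ
      exact Submodule.sub_mem _ (hΦl Z (hZ.trans (hMk.trans hkl))) (hΦk Z (hZ.trans hMk))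
    · by_cases hyM : y ∈ ΛM
      · exact hη y hyM
      · rw [Finset.sum_eq_zero]
        · exact hη0
        · intro Z hZ
          rw [Finset.mem_filter, Finset.mem_powerset] at hZ
          exact absurd (hZ.1 hZ.2) hyM
  have t2 : ‖⁅∑ Z ∈ Λl.powerset with ¬ Z ⊆ ΛM, Φl Z, a⁆‖ ≤ ∑ y ∈ Λk, g y * βl y := by
    refine (norm_comm_sum_le fun Z hZ => ha Z _ ?_).trans (Finset.sum_le_sum fun y hy =>
      mul_le_mul_of_nonneg_left ?_ (hg y hy))
    · exact hΦl Z (Finset.mem_powerset.1 (Finset.mem_filter.1 hZ).1)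
    · rw [Finset.filter_filter]
      exact hβl y hy
  have t3 : ‖⁅∑ Z ∈ Λk.powerset with ¬ Z ⊆ ΛM, Φk Z, a⁆‖ ≤ ∑ y ∈ Λk, g y * βk y := by
    refine (norm_comm_sum_le fun Z hZ => ha Z _ ?_).trans (Finset.sum_le_sum fun y hy =>
      mul_le_mul_of_nonneg_left ?_ (hg y hy))
    · exact hΦk Z (Finset.mem_powerset.1 (Finset.mem_filter.1 hZ).1)
    · rw [Finset.filter_filter]
      exact hβk y hy
  have hna : ∀ x ∈ Λk, ‖⁅n x, a⁆‖ ≤ r * g x := by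
    intro x hx
    refine (ha {x} _ (hn x)).trans ?_
    have : Λk.filter (· ∈ ({x} : Finset ι)) = {x} := by
      ext y
      simp only [Finset.mem_filter, Finset.mem_singleton]
      exact ⟨fun h => h.2, fun h => ⟨h ▸ hx, h⟩⟩
    rw [this, Finset.sum_singleton]
    exact mul_le_mul_of_nonneg_right (hnr x) (hg x hx)
  have t4 : ‖⁅∑ x ∈ Λk, ((vl x - vk x : ℝ) : ℂ) • n x, a⁆‖ ≤ ∑ y ∈ Λk, g y * (r * w y) := by
    rw [comm_sum_left]
    refine (norm_sum_le _ _).trans (Finset.sum_le_sum fun y hy => ?_)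
    rw [comm_smul_left, norm_smul, Complex.norm_real, Real.norm_eq_abs]
    have h1 := hw y hy
    have h2 := hna y hy
    calc |vl y - vk y| * ‖⁅n y, a⁆‖ ≤ w y * (r * g y) :=
          mul_le_mul h1 h2 (norm_nonneg _) ((abs_nonneg _).trans h1)
      _ = _ := by ring
  -- Outside Λk the bound `ha` is an empty sum, so these commutators vanish exactly; no bound on the
  -- size of vl is needed.
  have t5 : ⁅∑ x ∈ Λl \ Λk, ((vl x : ℝ) : ℂ) • n x, a⁆ = 0 := by
    rw [comm_sum_left]
    refine Finset.sum_eq_zero fun x hx => ?_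
    rw [comm_smul_left]
    have h := ha {x} _ (hn x)
    have : Λk.filter (· ∈ ({x} : Finset ι)) = ∅ := by
      refine Finset.filter_eq_empty_iff.2 fun y hy hyx => ?_
      rw [Finset.mem_singleton] at hyx
      exact (Finset.mem_sdiff.1 hx).2 (hyx ▸ hy)
    rw [this, Finset.sum_empty, mul_zero] at h
    rw [norm_le_zero_iff.1 h, smul_zero]
  rw [hdecomp, comm_add_left, t5, add_zero, comm_add_left, comm_sub_left, comm_add_left]
  have hs : ∑ y ∈ Λk, g y * (η + βl y + βk y + r * w y)
      = ∑ y ∈ Λk, g y * η + ∑ y ∈ Λk, g y * βl y + ∑ y ∈ Λk, g y * βk y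
        + ∑ y ∈ Λk, g y * (r * w y) := by
    simp only [mul_add, Finset.sum_add_distrib]
  rw [hs]
  exact (norm_add_le _ _).trans (add_le_add ((norm_sub_le _ _).trans
    (add_le_add ((norm_add_le _ _).trans (add_le_add t1 t2)) t3)) t4)

end LatticeFermions

/-! ### Potentials, and the abstract bounds applied to the lattice model. -/

namespace LatticeFermions

/-! ### On-site potentials -/

section Potential

theorem isSelfAdjoint_potential {𝔄 : Type*} [CStarAlgebra 𝔄] {ι : Type*} {n : ι → 𝔄}
    (hns : ∀ x, IsSelfAdjoint (n x)) (Λ : Finset ι) (v : ι → ℝ) :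
    IsSelfAdjoint (∑ x ∈ Λ, ((v x : ℝ) : ℂ) • n x) := by
  refine isSelfAdjoint_sum _ fun x _ => ?_
  rw [IsSelfAdjoint, star_smul, (hns x).star_eq]
  simp

variable {𝔄 : Type*} [CStarAlgebra 𝔄] {ι : Type*} [DecidableEq ι]
  {𝒜 : Finset ι → Subalgebra ℂ 𝔄} {n : ι → 𝔄}

theorem comm_potential_eq
    (h𝒜 : ∀ X Y : Finset ι, Disjoint X Y → ∀ A ∈ 𝒜 X, ∀ B ∈ 𝒜 Y, A * B = B * A)
    (hn : ∀ X : Finset ι, ∀ x ∈ X, n x ∈ 𝒜 X) (Λ : Finset ι) (v : ι → ℝ) {X : Finset ι} {A : 𝔄}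
    (hA : A ∈ 𝒜 X) :
    ⁅∑ x ∈ Λ, ((v x : ℝ) : ℂ) • n x, A⁆ = ⁅∑ x ∈ Λ with x ∈ X, ((v x : ℝ) : ℂ) • n x, A⁆ := by
  have h0 : ⁅∑ x ∈ Λ with x ∉ X, ((v x : ℝ) : ℂ) • n x, A⁆ = 0 := by
    rw [comm_sum_left]
    refine Finset.sum_eq_zero fun x hx => ?_
    rw [comm_smul_left, comm_eq_zero (h𝒜 {x} X (Finset.disjoint_singleton_left.2
      (Finset.mem_filter.1 hx).2) _ (hn _ x (Finset.mem_singleton_self x)) A hA), smul_zero]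
  rw [← Finset.sum_filter_add_sum_filter_not Λ (· ∈ X), comm_add_left, h0, add_zero]

theorem comm_potential_mem
    (h𝒜 : ∀ X Y : Finset ι, Disjoint X Y → ∀ A ∈ 𝒜 X, ∀ B ∈ 𝒜 Y, A * B = B * A)
    (hn : ∀ X : Finset ι, ∀ x ∈ X, n x ∈ 𝒜 X) (Λ : Finset ι) (v : ι → ℝ) {X : Finset ι} {A : 𝔄}
    (hA : A ∈ 𝒜 X) : ⁅∑ x ∈ Λ, ((v x : ℝ) : ℂ) • n x, A⁆ ∈ 𝒜 X := by
  rw [comm_potential_eq h𝒜 hn Λ v hA, Ring.lie_def]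
  have hmem : ∑ x ∈ Λ with x ∈ X, ((v x : ℝ) : ℂ) • n x ∈ 𝒜 X :=
    sum_mem fun x hx => (𝒜 X).smul_mem (hn X x (Finset.mem_filter.1 hx).2) _
  exact sub_mem (mul_mem hmem hA) (mul_mem hA hmem)

/-- The commutator of a Hamiltonian with an observable that conserves the particle number. -/
theorem norm_comm_hamiltonian_le
    (h𝒜 : ∀ X Y : Finset ι, Disjoint X Y → ∀ A ∈ 𝒜 X, ∀ B ∈ 𝒜 Y, A * B = B * A)
    (hn : ∀ X : Finset ι, ∀ x ∈ X, n x ∈ 𝒜 X) {r : ℝ} (hnr : ∀ x, ‖n x‖ ≤ r) {Λ X : Finset ι}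
    (hX : X ⊆ Λ) {Φ : Finset ι → 𝔄} (hΦ : ∀ Z ⊆ Λ, Φ Z ∈ 𝒜 Z) {v : ι → ℝ} {A : 𝔄}
    (hA : A ∈ 𝒜 X) (hnum : (∑ x ∈ X, n x) * A = A * ∑ x ∈ X, n x) {b c : ℝ}
    (hb : ∀ x ∈ X, ∑ Z ∈ Λ.powerset with x ∈ Z, ‖Φ Z‖ ≤ b)
    (hc : ∀ x ∈ X, ∀ y ∈ X, |v x - v y| ≤ c) :
    ‖⁅∑ Z ∈ Λ.powerset, Φ Z + ∑ x ∈ Λ, ((v x : ℝ) : ℂ) • n x, A⁆‖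
      ≤ 2 * ‖A‖ * X.card * (b + r * c) := by
  have t1 : ‖⁅∑ Z ∈ Λ.powerset, Φ Z, A⁆‖ ≤ 2 * ‖A‖ * X.card * b := by
    rw [comm_sum_left, ← Finset.sum_filter_add_sum_filter_not Λ.powerset (fun Z => Disjoint Z X),
      Finset.sum_eq_zero (s := Λ.powerset.filter fun Z => Disjoint Z X), zero_add]
    · calc ‖∑ Z ∈ Λ.powerset with ¬ Disjoint Z X, ⁅Φ Z, A⁆‖
          ≤ ∑ Z ∈ Λ.powerset with ¬ Disjoint Z X, 2 * ‖A‖ * ‖Φ Z‖ :=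
            (norm_sum_le _ _).trans (Finset.sum_le_sum fun Z _ =>
              (norm_comm_le _ _).trans (le_of_eq (by ring)))
        _ = 2 * ‖A‖ * ∑ Z ∈ Λ.powerset with ¬ Disjoint Z X, ‖Φ Z‖ := by rw [Finset.mul_sum]
        _ ≤ 2 * ‖A‖ * ∑ x ∈ X, b :=
            mul_le_mul_of_nonneg_left ((sum_not_disjoint_le fun _ _ => norm_nonneg _).trans
              (Finset.sum_le_sum hb)) (by positivity)
        _ = _ := by rw [Finset.sum_const, nsmul_eq_mul]; ring
    · intro Z hZ
      rw [Finset.mem_filter, Finset.mem_powerset] at hZ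
      exact comm_eq_zero (h𝒜 Z X hZ.2 _ (hΦ Z hZ.1) A hA)
  have t2 : ‖⁅∑ x ∈ Λ, ((v x : ℝ) : ℂ) • n x, A⁆‖ ≤ 2 * ‖A‖ * X.card * (r * c) := by
    rw [comm_potential_eq h𝒜 hn Λ v hA, Finset.filter_mem_eq_inter, Finset.inter_eq_right.2 hX]
    rcases X.eq_empty_or_nonempty with rfl | ⟨x₀, hx₀⟩
    · simp [comm_eq_zero]
    -- Since A commutes with N_X, the potential may be shifted by its value at x₀; only its
    -- oscillation on X counts.
    have e : ⁅∑ x ∈ X, ((v x : ℝ) : ℂ) • n x, A⁆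
        = ∑ x ∈ X, ((v x - v x₀ : ℝ) : ℂ) • ⁅n x, A⁆ := by
      have hz : ((v x₀ : ℝ) : ℂ) • ⁅∑ x ∈ X, n x, A⁆ = 0 := by rw [comm_eq_zero hnum, smul_zero]
      rw [comm_sum_left, Finset.smul_sum] at hz
      rw [comm_sum_left, ← sub_zero (∑ x ∈ X, ⁅((v x : ℝ) : ℂ) • n x, A⁆), ← hz,
        ← Finset.sum_sub_distrib]
      refine Finset.sum_congr rfl fun x _ => ?_
      rw [comm_smul_left, Complex.ofReal_sub, sub_smul]
    rw [e]
    calc ‖∑ x ∈ X, ((v x - v x₀ : ℝ) : ℂ) • ⁅n x, A⁆‖ ≤ ∑ _x ∈ X, c * (2 * r * ‖A‖) := by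
          refine (norm_sum_le _ _).trans (Finset.sum_le_sum fun x hx => ?_)
          rw [norm_smul, Complex.norm_real, Real.norm_eq_abs]
          have h1 := hc x hx x₀ hx₀
          refine mul_le_mul h1 ((norm_comm_le _ _).trans ?_) (norm_nonneg _)
            ((abs_nonneg _).trans h1)
          have := hnr x
          gcongr
      _ = _ := by rw [Finset.sum_const, nsmul_eq_mul]; ring
  rw [comm_add_left]
  refine (norm_add_le _ _).trans ((add_le_add t1 t2).trans (le_of_eq ?_))
  ring

end Potential

/-! ### The dynamics of a setting -/

variable {d r : ℕ}

/-- The even local algebras as a net of subspaces. -/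
def evenNet (r : ℕ) (X : Finset (Zd d)) : Submodule ℂ (Op d r) :=
  Subalgebra.toSubmodule (evenAlg r X).toSubalgebra

theorem isLocalNet_evenNet : IsLocalNet (evenNet (d := d) r) :=
  fun _ _ h _ hA _ hB => comm_eq_zero (evenAlg_commute h hA hB)

theorem sum_norm_le_of_boxNorm_le {ρ : Zd d → Zd d → ℝ} {ζ : ℝ → ℝ} {M : ℕ}
    {φ : Finset (Zd d) → Op d r} {c : ℝ} (hc : 0 ≤ c) (h : boxNorm ρ ζ M φ ≤ ENNReal.ofReal c)
    {x y : Zd d} (hx : x ∈ cube d M) (hy : y ∈ cube d M) (hF : 0 < Ffun d ζ (ρ x y)) :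
    ∑ X ∈ (cube d M).powerset with x ∈ X ∧ y ∈ X, ‖φ X‖ ≤ c * Ffun d ζ (ρ x y) := by
  have h1 : ∑ X ∈ (cube d M).powerset with x ∈ X ∧ y ∈ X,
      ENNReal.ofReal (‖φ X‖ / Ffun d ζ (ρ x y)) ≤ ENNReal.ofReal c :=
    le_trans (le_iSup₂_of_le x hx (le_iSup₂ (f := fun y (_ : y ∈ cube d M) =>
      ∑ X ∈ (cube d M).powerset with x ∈ X ∧ y ∈ X,
        ENNReal.ofReal (‖φ X‖ / Ffun d ζ (ρ x y))) y hy)) h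
  rw [← ENNReal.ofReal_sum_of_nonneg fun X _ => by positivity, ENNReal.ofReal_le_ofReal_iff hc,
    ← Finset.sum_div, div_le_iff₀ hF] at h1
  exact h1

namespace Setting

variable {ζ : ℝ → ℝ} {N Cv : ℝ≥0} {D : ℕ → Zd d → Zd d → ℝ} {J : Set ℝ}
  {Φ : ℕ → ℝ → Finset (Zd d) → Op d r} {v : ℕ → ℝ → Zd d → ℝ} {U : ℕ → ℝ → ℝ → Op d r}

theorem mem_gaugeAlg (st : Setting ζ N Cv D J Φ v U) {k : ℕ} {t : ℝ} (ht : t ∈ J)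
    {Z : Finset (Zd d)} (hZ : Z ⊆ cube d k) : Φ k t Z ∈ gaugeAlg r Z := by
  obtain ⟨ζs, -, h⟩ := st.interaction
  exact h.mem k t ht Z hZ

theorem mem_evenNet (st : Setting ζ N Cv D J Φ v U) {k : ℕ} {t : ℝ} (ht : t ∈ J)
    {Z : Finset (Zd d)} (hZ : Z ⊆ cube d k) : Φ k t Z ∈ evenNet r Z :=
  gaugeAlg_le_evenAlg Z (st.mem_gaugeAlg ht hZ)

theorem isSelfAdjoint (st : Setting ζ N Cv D J Φ v U) {k : ℕ} {t : ℝ} (ht : t ∈ J)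
    {Z : Finset (Zd d)} (hZ : Z ⊆ cube d k) : IsSelfAdjoint (Φ k t Z) := by
  obtain ⟨ζs, -, h⟩ := st.interaction
  exact h.selfAdjoint k t ht Z hZ

theorem sum_norm_le (st : Setting ζ N Cv D J Φ v U) (hζ : IsWeight ζ) {k : ℕ} {t : ℝ}
    (ht : t ∈ J) {x y : Zd d} (hx : x ∈ cube d k) (hy : y ∈ cube d k) :
    ∑ Z ∈ (cube d k).powerset with x ∈ Z ∧ y ∈ Z, ‖Φ k t Z‖ ≤ N * Ffun d ζ (D k x y) := by
  refine sum_norm_le_of_boxNorm_le N.coe_nonneg ?_ hx hy (Ffun_pos hζ (st.metric.nonneg hx hy))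
  rw [ENNReal.ofReal_coe_nnreal, ← st.norm_eq]
  refine le_trans (le_of_eq ?_) (le_iSup₂_of_le t ht (le_iSup_of_le k le_rfl))
  simp only [iteratedDeriv_zero]

theorem abs_potential_sub_le (st : Setting ζ N Cv D J Φ v U) {k : ℕ} {t : ℝ}
    (ht : t ∈ J) {x y : Zd d} (hx : x ∈ cube d k) (hy : y ∈ cube d k) :
    |v k t x - v k t y| ≤ Cv * D k x y := by
  by_cases hxy : x = y
  · simp [hxy, st.metric.self_eq hy]
  have hpos : 0 < D k x y := lt_of_le_of_ne (st.metric.nonneg hx hy)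
    fun h => hxy ((st.metric.eq_zero_iff k x hx y hy).1 h.symm)
  have h : ENNReal.ofReal (|v k t x - v k t y| / D k x y) ≤ Cv := by
    rw [← st.lip_eq]
    refine le_trans (le_of_eq ?_) (le_iSup₂_of_le t ht (le_iSup_of_le k
      (le_iSup₂_of_le x hx (le_iSup₂_of_le y hy le_rfl))))
    simp only [iteratedDeriv_zero]
  rw [← ENNReal.ofReal_coe_nnreal, ENNReal.ofReal_le_ofReal_iff Cv.coe_nonneg, div_le_iff₀ hpos] at h
  exact h

theorem isUnitaryPropagator (st : Setting ζ N Cv D J Φ v U) (k : ℕ) :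
    IsUnitaryPropagator J (fun t => ∑ Z ∈ (cube d k).powerset, Φ k t Z
      + ∑ x ∈ cube d k, ((v k t x : ℝ) : ℂ) • siteNumber r x) (U k) where
  ordConnected := st.interval
  isOpen := st.isOpen
  selfAdjoint _ ht := (isSelfAdjoint_sum _ fun _ hZ =>
    st.isSelfAdjoint ht (Finset.mem_powerset.1 hZ)).add
      (isSelfAdjoint_potential isSelfAdjoint_siteNumber _ _)
  self_eq s hs := (st.propagator k s hs).1
  hasDerivAt s hs t ht := (st.propagator k s hs).2 t ht

/-- Y need not lie in the box; only its points in the box are counted. The comparison of two boxes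
needs this for terms supported in the larger box. -/
theorem lieb_robinson (st : Setting ζ N Cv D J Φ v U) (hd : 1 ≤ d) (hζ : IsWeight ζ) {k : ℕ}
    {X Y : Finset (Zd d)} (hX : X ⊆ cube d k) {A B : Op d r} (hA : A ∈ evenAlg r X)
    (hB : B ∈ evenAlg r Y) {t s : ℝ} (ht : t ∈ J) (hs : s ∈ J) :
    ‖⁅conjStar (U k t s) A, B⁆‖ ≤ 2 / ζ 0 * ‖A‖ * ‖B‖
      * Real.exp (2 * convConst D ζ * |t - s| * N)
      * ∑ x ∈ X, ∑ y ∈ cube d k with y ∈ Y, Ffun d ζ (D k x y) :=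
  LatticeFermions.lieb_robinson (𝒜 := evenNet r) isLocalNet_evenNet (st.isUnitaryPropagator k)
    (fun _ _ => isSelfAdjoint_potential isSelfAdjoint_siteNumber _ _)
    (fun t _ _ _ _ hA => comm_potential_mem (𝒜 := fun X => (evenAlg r X).toSubalgebra)
      (fun _ _ h _ hA _ hB => evenAlg_commute h hA hB)
      (fun _ _ hx => siteNumber_mem_evenAlg hx) _ (v k t) hA)
    (fun _ ht _ hZ => st.mem_evenNet ht hZ) (fun _ ht _ hZ => st.isSelfAdjoint ht hZ)
    (F := fun x y => Ffun d ζ (D k x y)) (hζ.pos 0 le_rfl)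
    (fun _ hx _ hy => (Ffun_pos hζ (st.metric.nonneg hx hy)).le)
    (fun _ hx => by rw [st.metric.self_eq hx, Ffun_zero]) N.2
    (fun _ hx _ hy => sum_Ffun_mul_le hd st.metric hζ hx hy)
    (fun _ ht _ hx _ hy => st.sum_norm_le hζ ht hx hy) (Finset.filter_subset _ _)
    (fun W hW hWY A hA => comm_eq_zero (evenAlg_commute (Finset.disjoint_left.2 fun x hxW hxY =>
      Finset.disjoint_left.1 hWY hxW (Finset.mem_filter.2 ⟨hW hxW, hxY⟩)) hA hB))
    hX hA hs ht

end Setting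

end LatticeFermions

/-! ### Lattice sums near the boundary and comparison of two boxes. -/

namespace LatticeFermions

variable {d r : ℕ}

/-! ### Lattice sums for local perturbations -/

/-- Summing first over either variable gives a bound uniform in the other; the better order produces
the minimum. -/
theorem sum_sum_Ffun_le (hd : 1 ≤ d) {D : ℕ → Zd d → Zd d → ℝ} (hD : IsBoxMetric D) {ζ : ℝ → ℝ}
    (hζ : IsWeight ζ) {k : ℕ} {X Y : Finset (Zd d)} (hX : X ⊆ cube d k) (hY : Y ⊆ cube d k) :
    ∑ x ∈ X, ∑ y ∈ Y, Ffun d ζ (D k x y)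
      ≤ (min X.card Y.card : ℕ) * (ζ (setDist (D k) X Y) * latticeConst d) := by
  have hnn : ∀ x ∈ (X : Set (Zd d)), ∀ y ∈ (Y : Set (Zd d)), 0 ≤ D k x y :=
    fun x hx y hy => hD.nonneg (hX hx) (hY hy)
  set h := setDist (D k) X Y with hh
  have h0 : 0 ≤ h := setDist_nonneg hnn
  have hle : ζ h * (latticeConst d / (1 + h)) ≤ ζ h * latticeConst d :=
    mul_le_mul_of_nonneg_left (div_le_self (latticeConst_nonneg d) (by linarith)) (hζ.pos h h0).le
  rcases min_choice X.card Y.card with hm | hm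
  · rw [hm, ← nsmul_eq_mul]
    exact Finset.sum_le_card_nsmul _ _ _ fun x hx =>
      (tail_sum_Ffun_le hd hD hζ (hX hx) h0 hY fun y hy => setDist_le hnn hx hy).trans hle
  · rw [hm, ← nsmul_eq_mul, Finset.sum_comm]
    refine Finset.sum_le_card_nsmul _ _ _ fun y hy => ?_
    rw [Finset.sum_congr rfl fun x hx => by rw [hD.symm k x (hX hx) y (hY hy)]]
    refine (tail_sum_Ffun_le hd hD hζ (hY hy) h0 hX fun x hx => ?_).trans hle
    rw [hD.symm k y (hY hy) x (hX hx)]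
    exact setDist_le hnn hx hy

/-- Two-step paths that leave a box. The two steps may be measured in different box metrics. -/
theorem sum_Ffun_path_le (hd : 1 ≤ d) {D : ℕ → Zd d → Zd d → ℝ} (hD : IsBoxMetric D)
    (hS : RespectsShells D) {ζ : ℝ → ℝ} (hζ : IsWeight ζ) {R M k l : ℕ} (hRM : R ≤ M)
    (hMk : M ≤ k) (hkl : k ≤ l) {x : Zd d} (hx : x ∈ cube d R) :
    ∑ y ∈ cube d k, Ffun d ζ (D k x y) * ∑ z ∈ cube d l \ cube d M, Ffun d ζ (D l y z)
      ≤ ζ ((M : ℝ) + 1 - R) * latticeConst d ^ 2 := by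
  set h : ℝ := (M : ℝ) + 1 - R with hh
  have hRM' : (R : ℝ) ≤ M := by exact_mod_cast hRM
  have h0 : 0 ≤ h := by linarith
  have hxk : x ∈ cube d k := cube_mono (hRM.trans hMk) hx
  have hx' := norm_le_iff_mem_cube.1 hx
  have hζh := (hζ.pos h h0).le
  have hL := latticeConst_nonneg d
  calc ∑ y ∈ cube d k, Ffun d ζ (D k x y) * ∑ z ∈ cube d l \ cube d M, Ffun d ζ (D l y z)
      ≤ ∑ y ∈ cube d k, ζ h * (1 / (1 + D k x y) ^ (d + 1))
        * ∑ z ∈ cube d l \ cube d M, 1 / (1 + D l y z) ^ (d + 1) := by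
        refine Finset.sum_le_sum fun y hy => ?_
        rw [Finset.mul_sum, Finset.mul_sum]
        refine Finset.sum_le_sum fun z hz => ?_
        rw [Finset.mem_sdiff] at hz
        have hyl := cube_mono hkl hy
        have h1 := hD.nonneg hxk hy
        have h2 := hD.nonneg hyl hz.1
        have h3 := hS k y hy x hxk
        have h4 := hS l z hz.1 y hyl
        rw [hD.symm k y hy x hxk] at h3
        rw [hD.symm l z hz.1 y hyl] at h4
        have h5 := succ_le_norm_of_notMem_cube hz.2
        -- Along the path x → y → z the increments of the supremum norm bound the two distances from
        -- below and ‖y‖ cancels, although the two steps use different metrics.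
        have h6 : ζ (D k x y) * ζ (D l y z) ≤ ζ h :=
          (hζ.superadd _ _ h1 h2).trans (hζ.le_of_le h0 (by linarith))
        rw [Ffun_eq, Ffun_eq]
        calc ζ (D k x y) * (1 / (1 + D k x y) ^ (d + 1)) *
              (ζ (D l y z) * (1 / (1 + D l y z) ^ (d + 1)))
            = ζ (D k x y) * ζ (D l y z) *
              (1 / (1 + D k x y) ^ (d + 1) * (1 / (1 + D l y z) ^ (d + 1))) := by ring
          _ ≤ ζ h * (1 / (1 + D k x y) ^ (d + 1) * (1 / (1 + D l y z) ^ (d + 1))) :=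
              mul_le_mul_of_nonneg_right h6 (by positivity)
          _ = _ := by ring
    _ ≤ ∑ y ∈ cube d k, ζ h * (1 / (1 + D k x y) ^ (d + 1)) * latticeConst d := by
        refine Finset.sum_le_sum fun y hy => mul_le_mul_of_nonneg_left ?_ ?_
        · have hyl := cube_mono hkl hy
          simpa using tail_sum_le hd hD hyl le_rfl Finset.sdiff_subset
            fun z hz => hD.nonneg hyl (Finset.mem_sdiff.1 hz).1
        · have h1 := hD.nonneg hxk hy
          positivity
    _ = ζ h * latticeConst d * ∑ y ∈ cube d k, 1 / (1 + D k x y) ^ (d + 1) := by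
        rw [Finset.mul_sum]
        exact Finset.sum_congr rfl fun y _ => by ring
    _ ≤ ζ h * latticeConst d * latticeConst d :=
        mul_le_mul_of_nonneg_left (by
          simpa using tail_sum_le hd hD hxk le_rfl subset_rfl fun y hy => hD.nonneg hxk hy)
          (by positivity)
    _ = _ := by ring

theorem le_dist_of_notMem_cube {D : ℕ → Zd d → Zd d → ℝ} (hD : IsBoxMetric D)
    (hS : RespectsShells D) {R M k : ℕ} {x y : Zd d} (hx : x ∈ cube d R) (hRk : R ≤ k)
    (hy : y ∈ cube d k \ cube d M) :
    (M : ℝ) + 1 - R ≤ D k x y ∧ ‖y‖ - R ≤ D k x y := by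
  rw [Finset.mem_sdiff] at hy
  have hxk := cube_mono hRk hx
  have h1 := hS k y hy.1 x hxk
  rw [hD.symm k y hy.1 x hxk] at h1
  have h2 := succ_le_norm_of_notMem_cube hy.2
  have h3 := norm_le_iff_mem_cube.1 hx
  constructor <;> linarith

/-- When the shell is at most q times as wide as its distance h from Λ_R, the weight ‖y‖ - M is at
most q h, which the tail factor 1/(1+h) absorbs without loss in ζ. -/
theorem sum_Ffun_mul_norm_le_of_width (hd : 1 ≤ d) {D : ℕ → Zd d → Zd d → ℝ} (hD : IsBoxMetric D)
    (hS : RespectsShells D) {ζ : ℝ → ℝ} (hζ : IsWeight ζ) {R M k : ℕ} (hRM : R ≤ M)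
    (hMk : M ≤ k) {x : Zd d} (hx : x ∈ cube d R) {q : ℝ} (hq : (k : ℝ) - M ≤ q * (M + 1 - R)) :
    ∑ y ∈ cube d k \ cube d M, Ffun d ζ (D k x y) * (‖y‖ - M)
      ≤ ζ ((M : ℝ) + 1 - R) * latticeConst d * q := by
  set h : ℝ := (M : ℝ) + 1 - R with hh
  have hRM' : (R : ℝ) ≤ M := by exact_mod_cast hRM
  have hMk' : (M : ℝ) ≤ k := by exact_mod_cast hMk
  have h0 : 0 < h := by linarith
  have hxk : x ∈ cube d k := cube_mono (hRM.trans hMk) hx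
  have hζh := (hζ.pos h h0.le).le
  have hL := latticeConst_nonneg d
  have hq0 : 0 ≤ q := by
    by_contra! hneg
    nlinarith
  calc ∑ y ∈ cube d k \ cube d M, Ffun d ζ (D k x y) * (‖y‖ - M)
      ≤ ∑ y ∈ cube d k \ cube d M, Ffun d ζ (D k x y) * (q * h) := by
        refine Finset.sum_le_sum fun y hy => mul_le_mul_of_nonneg_left ?_ ?_
        · have := norm_le_iff_mem_cube.1 (Finset.mem_sdiff.1 hy).1
          linarith
        · exact (Ffun_pos hζ (hD.nonneg hxk (Finset.mem_sdiff.1 hy).1)).le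
    _ ≤ ζ h * (latticeConst d / (1 + h)) * (q * h) := by
        rw [← Finset.sum_mul]
        exact mul_le_mul_of_nonneg_right (tail_sum_Ffun_le hd hD hζ hxk h0.le Finset.sdiff_subset
          fun y hy => (le_dist_of_notMem_cube hD hS hx (hRM.trans hMk) hy).1) (by positivity)
    _ = ζ h * latticeConst d * q * (h / (1 + h)) := by field_simp
    _ ≤ ζ h * latticeConst d * q * 1 :=
        mul_le_mul_of_nonneg_left ((div_le_one (by linarith)).2 (by linarith)) (by positivity)
    _ = _ := by ring

/-- Without control of the width, ‖y‖ - M ≤ D(x,y) is absorbed by the decay of ρ ζ(ρ). -/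
theorem sum_Ffun_mul_norm_le_of_decay (hd : 1 ≤ d) {D : ℕ → Zd d → Zd d → ℝ} (hD : IsBoxMetric D)
    (hS : RespectsShells D) {ζ : ℝ → ℝ} (hζ : IsWeight ζ) {R M k : ℕ} (hRM : R ≤ M)
    (hMk : M ≤ k) {x : Zd d} (hx : x ∈ cube d R) {θ : ℝ}
    (hθ : ∀ ρ : ℝ, (M : ℝ) + 1 - R ≤ ρ → ρ * ζ ρ ≤ θ) :
    ∑ y ∈ cube d k \ cube d M, Ffun d ζ (D k x y) * (‖y‖ - M) ≤ θ * latticeConst d := by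
  have hRM' : (R : ℝ) ≤ M := by exact_mod_cast hRM
  have hxk : x ∈ cube d k := cube_mono (hRM.trans hMk) hx
  have hθ0 : 0 ≤ θ := le_trans (mul_nonneg (by linarith) (hζ.pos _ (by linarith)).le)
    (hθ ((M : ℝ) + 1 - R) le_rfl)
  calc ∑ y ∈ cube d k \ cube d M, Ffun d ζ (D k x y) * (‖y‖ - M)
      ≤ ∑ y ∈ cube d k \ cube d M, θ * (1 / (1 + D k x y) ^ (d + 1)) := by
        refine Finset.sum_le_sum fun y hy => ?_
        have h1 := le_dist_of_notMem_cube hD hS hx (hRM.trans hMk) hy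
        have h2 := hD.nonneg hxk (Finset.mem_sdiff.1 hy).1
        rw [Ffun_eq]
        calc ζ (D k x y) * (1 / (1 + D k x y) ^ (d + 1)) * (‖y‖ - M)
            ≤ ζ (D k x y) * (1 / (1 + D k x y) ^ (d + 1)) * D k x y := by
              refine mul_le_mul_of_nonneg_left (by linarith [h1.2]) ?_
              have := hζ.pos _ h2
              positivity
          _ = D k x y * ζ (D k x y) * (1 / (1 + D k x y) ^ (d + 1)) := by ring
          _ ≤ _ := mul_le_mul_of_nonneg_right (hθ _ h1.1) (by positivity)
    _ ≤ θ * latticeConst d := by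
        rw [← Finset.mul_sum]
        refine mul_le_mul_of_nonneg_left ?_ hθ0
        simpa using tail_sum_le hd hD hxk le_rfl Finset.sdiff_subset
          fun z hz => hD.nonneg hxk (Finset.mem_sdiff.1 hz).1

/-- Clamp every coordinate to the box; the factor d passes from the supremum norm to ℓ¹. -/
theorem exists_mem_cube_ell1_le {M : ℕ} {y : Zd d} (hy : y ∉ cube d M) :
    ∃ p ∈ cube d M, ell1 y p ≤ d * (‖y‖ - M) := by
  refine ⟨fun i => max (-(M : ℤ)) (min M (y i)), mem_cube.2 fun i => by omega, ?_⟩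
  rw [mem_cube_iff_supNorm, not_le] at hy
  have hi : ∀ i, (y i - max (-(M : ℤ)) (min M (y i))).natAbs ≤ supNorm y - M := by
    intro i
    have : (y i).natAbs ≤ supNorm y :=
      Finset.le_sup (f := fun i => (y i).natAbs) (Finset.mem_univ i)
    omega
  have h : l1Dist y (fun i => max (-(M : ℤ)) (min M (y i))) ≤ d * (supNorm y - M) := by
    refine (Finset.sum_le_sum fun i _ => hi i).trans (le_of_eq ?_)
    simp
  rw [norm_eq_supNorm, ← Nat.cast_sub hy.le]
  have hcast := (Nat.cast_le (α := ℝ)).2 h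
  rw [Nat.cast_mul] at hcast
  exact hcast

/-- The largest supremum norm of the points of `X`. -/
def radius (X : Finset (Zd d)) : ℕ := X.sup supNorm

theorem subset_cube_iff_radius_le {X : Finset (Zd d)} {m : ℕ} : X ⊆ cube d m ↔ radius X ≤ m := by
  simp only [radius, Finset.sup_le_iff, Finset.subset_iff, mem_cube_iff_supNorm]

/-- Upper bound for the distance of `X` to the complement of a box. -/
theorem setDist_compl_le (hd : 1 ≤ d) {X : Finset (Zd d)} {m : ℕ} {ρ : Zd d → Zd d → ℝ}
    {Y : Set (Zd d)} (hY1 : ∀ y ∈ cube d (m + 1), y ∉ cube d m → y ∈ Y)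
    (hY2 : ∀ x ∈ X, x ∉ cube d m → x ∈ Y) (hρ0 : ∀ x ∈ X, ∀ y ∈ Y, 0 ≤ ρ x y)
    (hρ : ∀ x ∈ X, ∀ y ∈ Y, ρ x y ≤ ell1 x y) :
    setDist ρ X Y ≤ (m + 1 - radius X : ℕ) := by
  rcases X.eq_empty_or_nonempty with rfl | hne
  · have : setDist ρ ((∅ : Finset (Zd d)) : Set (Zd d)) Y = 0 := by simp [setDist]
    rw [this]; positivity
  obtain ⟨x, hx, hxR⟩ := Finset.exists_mem_eq_sup X hne supNorm
  change radius X = supNorm x at hxR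
  by_cases hxm : x ∈ cube d m
  · rw [mem_cube_iff_supNorm] at hxm
    obtain ⟨i, -, hi⟩ := Finset.exists_mem_eq_sup (Finset.univ : Finset (Fin d))
      ⟨⟨0, hd⟩, Finset.mem_univ _⟩ fun i => (x i).natAbs
    change supNorm x = (x i).natAbs at hi
    -- The outermost point of X is pushed just across the boundary along a coordinate of maximal
    -- modulus, at cost m + 1 - ‖x‖.
    let y : Zd d := Function.update x i (if 0 ≤ x i then (m + 1 : ℤ) else -(m + 1 : ℤ))
    have hyi : y i = if 0 ≤ x i then (m + 1 : ℤ) else -(m + 1 : ℤ) := by simp [y]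
    have hyj : ∀ j, j ≠ i → y j = x j := fun j hj => by simp [y, hj]
    have hy1 : y ∈ cube d (m + 1) := mem_cube.2 fun j => by
      by_cases hj : j = i
      · rw [hj, hyi]; split_ifs <;> omega
      · rw [hyj j hj]
        have := mem_cube.1 (mem_cube_iff_supNorm.2 hxm) j
        omega
    have hy2 : y ∉ cube d m := fun h => by
      have := mem_cube.1 h i
      rw [hyi] at this
      split_ifs at this <;> omega
    have hyY := hY1 y hy1 hy2
    refine (setDist_le hρ0 hx hyY).trans ((hρ x hx y hyY).trans ?_)
    rw [ell1, l1Dist, Finset.sum_eq_single i (fun j _ hj => by simp [hyj j hj]) (by simp)]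
    refine Nat.cast_le.2 ?_
    rw [hxR, hi, hyi]
    split_ifs <;> omega
  · have hxY := hY2 x hx hxm
    refine (setDist_le hρ0 hx hxY).trans ((hρ x hx x hxY).trans ?_)
    rw [ell1, l1Dist_self, Nat.cast_zero]
    positivity

/-! ### Comparison of the dynamics on two boxes -/

namespace Setting

variable {ζ : ℝ → ℝ} {N Cv : ℝ≥0} {D : ℕ → Zd d → Zd d → ℝ} {J : Set ℝ}
  {Φ : ℕ → ℝ → Finset (Zd d) → Op d r} {v : ℕ → ℝ → Zd d → ℝ} {U : ℕ → ℝ → ℝ → Op d r}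

theorem sum_norm_outside_le (st : Setting ζ N Cv D J Φ v U) (hζ : IsWeight ζ) {k M : ℕ} {u : ℝ}
    (hu : u ∈ J) {y : Zd d} (hy : y ∈ cube d k) :
    ∑ Z ∈ (cube d k).powerset with ¬ Z ⊆ cube d M ∧ y ∈ Z, ‖Φ k u Z‖
      ≤ N * ∑ z ∈ cube d k \ cube d M, Ffun d ζ (D k y z) := by
  have hset : (cube d k).powerset.filter (fun Z => ¬ Z ⊆ cube d M ∧ y ∈ Z)
      = ((cube d k).powerset.filter (y ∈ ·)).filter
        (fun Z => ¬ Disjoint Z (cube d k \ cube d M)) := by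
    ext Z
    simp only [Finset.mem_filter, Finset.mem_powerset, Finset.not_disjoint_iff, Finset.mem_sdiff,
      Finset.not_subset]
    constructor
    · rintro ⟨hZ, ⟨z, hz, hzM⟩, hyZ⟩
      exact ⟨⟨hZ, hyZ⟩, z, hz, hZ hz, hzM⟩
    · rintro ⟨⟨hZ, hyZ⟩, z, hz, -, hzM⟩
      exact ⟨hZ, ⟨z, hz, hzM⟩, hyZ⟩
  rw [hset, Finset.mul_sum]
  refine (sum_not_disjoint_le fun _ _ => norm_nonneg _).trans (Finset.sum_le_sum fun z hz => ?_)
  rw [Finset.filter_filter]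
  exact st.sum_norm_le hζ hu hy (Finset.mem_sdiff.1 hz).1

/-- Both potentials agree at the projection p of y to Λ_M and are Lipschitz, so their difference
grows only with the distance to Λ_M. -/
theorem abs_potential_diff_le (st : Setting ζ N Cv D J Φ v U) {M k l : ℕ} (hMk : M ≤ k)
    (hkl : k ≤ l) {u : ℝ} (hu : u ∈ J) (hv : ∀ x ∈ cube d M, v l u x = v k u x) {y : Zd d}
    (hy : y ∈ cube d k) (hyM : y ∉ cube d M) :
    |v l u y - v k u y| ≤ 2 * Cv * d * (‖y‖ - M) := by
  obtain ⟨p, hp, hyp⟩ := exists_mem_cube_ell1_le hyM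
  have hpk := cube_mono hMk hp
  have hpl := cube_mono hkl hpk
  have hyl := cube_mono hkl hy
  have h1 := st.abs_potential_sub_le hu hyl hpl
  have h2 := st.abs_potential_sub_le hu hy hpk
  have h3 := (st.metric.le_ell1 l y hyl p hpl).trans hyp
  have h4 := (st.metric.le_ell1 k y hy p hpk).trans hyp
  have h5 := mul_le_mul_of_nonneg_left h3 Cv.coe_nonneg
  have h6 := mul_le_mul_of_nonneg_left h4 Cv.coe_nonneg
  have e : v l u y - v k u y = (v l u y - v l u p) - (v k u y - v k u p) := by
    rw [hv p hp]; ring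
  rw [e]
  refine (abs_sub _ _).trans ?_
  linarith

/-- Duhamel's formula with the density g(y) = c ∑ F(x,y) from the Lieb-Robinson bound in the smaller
box. Terms leaving Λ_M become two-step sums, one with its second step in `D l` and one in `D k`; the
potentials enter only through the shell sum τ. -/
theorem norm_evolution_sub_le (st : Setting ζ N Cv D J Φ v U) (hd : 1 ≤ d) (hζ : IsWeight ζ)
    (hS : RespectsShells D) {R M k l : ℕ} (hRM : R ≤ M) (hMk : M ≤ k) (hkl : k ≤ l)
    {X : Finset (Zd d)} (hX : X ⊆ cube d R) {A : Op d r} (hA : A ∈ evenAlg r X) {t s : ℝ}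
    (ht : t ∈ J) (hs : s ∈ J) {η τ : ℝ} (hη0 : 0 ≤ η)
    (hη : ∀ u ∈ J, ∀ y ∈ cube d M,
      ∑ Z ∈ (cube d M).powerset with y ∈ Z, ‖Φ l u Z - Φ k u Z‖ ≤ η)
    (hv : ∀ u ∈ J, ∀ x ∈ cube d M, v l u x = v k u x)
    (hτ : ∀ x ∈ X, ∑ y ∈ cube d k \ cube d M, Ffun d ζ (D k x y) * (‖y‖ - M) ≤ τ) :
    ‖conjStar (U l t s) A - conjStar (U k t s) A‖
      ≤ 2 / ζ 0 * ‖A‖ * Real.exp (2 * convConst D ζ * |t - s| * N) * |t - s| * X.card *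
        (ζ 0 * latticeConst d * η + 2 * N * (ζ ((M : ℝ) + 1 - R) * latticeConst d ^ 2)
          + 2 * r * Cv * d * τ) := by
  set E := Real.exp (2 * convConst D ζ * |t - s| * N) with hE
  set c := 2 / ζ 0 * ‖A‖ * E with hc
  have hζ0 := hζ.pos 0 le_rfl
  have hc0 : 0 ≤ c := by positivity
  have hXk : X ⊆ cube d k := hX.trans (cube_mono (hRM.trans hMk))
  have hF0 : ∀ x ∈ X, ∀ y ∈ cube d k, 0 ≤ Ffun d ζ (D k x y) := fun x hx y hy =>
    (Ffun_pos hζ (st.metric.nonneg (hXk hx) hy)).le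
  let g : Zd d → ℝ := fun y => c * ∑ x ∈ X, Ffun d ζ (D k x y)
  have hg : ∀ y ∈ cube d k, 0 ≤ g y := fun y hy =>
    mul_nonneg hc0 (Finset.sum_nonneg fun x hx => hF0 x hx y hy)
  let w : Zd d → ℝ := fun y => if y ∈ cube d M then 0 else 2 * Cv * d * (‖y‖ - M)
  let βl : Zd d → ℝ := fun y => N * ∑ z ∈ cube d l \ cube d M, Ffun d ζ (D l y z)
  let βk : Zd d → ℝ := fun y => N * ∑ z ∈ cube d k \ cube d M, Ffun d ζ (D k y z)
  have hmain : ∀ u ∈ Set.uIcc s t,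
      ‖⁅(∑ Z ∈ (cube d l).powerset, Φ l u Z
          + ∑ x ∈ cube d l, ((v l u x : ℝ) : ℂ) • siteNumber r x)
        - (∑ Z ∈ (cube d k).powerset, Φ k u Z
          + ∑ x ∈ cube d k, ((v k u x : ℝ) : ℂ) • siteNumber r x), conjStar (U k t u) A⁆‖
      ≤ ∑ y ∈ cube d k, g y * (η + βl y + βk y + r * w y) := by
    intro u hu
    have huJ : u ∈ J := st.interval.uIcc_subset hs ht hu
    refine norm_comm_hamiltonian_sub_le (𝒜 := evenNet r) (cube_mono hMk) (cube_mono hkl)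
      (fun Z hZ => st.mem_evenNet huJ hZ) (fun Z hZ => st.mem_evenNet huJ hZ)
      (fun x => siteNumber_mem_evenAlg (Finset.mem_singleton_self x)) norm_siteNumber_le hg ?_ hη0
      (hη u huJ) (fun y hy => st.sum_norm_outside_le hζ huJ (cube_mono hkl hy))
      (fun y hy => st.sum_norm_outside_le hζ huJ hy) ?_
    · intro Y B hB
      have h := st.lieb_robinson hd hζ hXk hA hB ht huJ
      rw [← comm_skew, norm_neg]
      refine h.trans ?_
      have hexp : Real.exp (2 * convConst D ζ * |t - u| * N) ≤ E := by
        rw [hE, Real.exp_le_exp]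
        have : |t - u| ≤ |t - s| := Set.abs_sub_right_of_mem_uIcc hu
        have h0 := convConst_nonneg D ζ
        gcongr
      have hsum0 : 0 ≤ ∑ x ∈ X, ∑ y ∈ cube d k with y ∈ Y, Ffun d ζ (D k x y) :=
        Finset.sum_nonneg fun x hx => Finset.sum_nonneg fun y hy =>
          hF0 x hx y (Finset.mem_filter.1 hy).1
      calc 2 / ζ 0 * ‖A‖ * ‖B‖ * Real.exp (2 * convConst D ζ * |t - u| * N)
            * ∑ x ∈ X, ∑ y ∈ cube d k with y ∈ Y, Ffun d ζ (D k x y)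
          ≤ 2 / ζ 0 * ‖A‖ * ‖B‖ * E
            * ∑ x ∈ X, ∑ y ∈ cube d k with y ∈ Y, Ffun d ζ (D k x y) := by gcongr
        _ = ‖B‖ * ∑ y ∈ cube d k with y ∈ Y, g y := by
            simp only [g]
            rw [← Finset.mul_sum, Finset.sum_comm, hc]
            ring
    · intro y hy
      simp only [w]
      split_ifs with hyM
      · rw [hv u huJ y hyM, sub_self, abs_zero]
      · exact st.abs_potential_diff_le hMk hkl huJ (hv u huJ) hy hyM
  have hD := (st.isUnitaryPropagator l).norm_conjStar_sub_le (st.isUnitaryPropagator k) hs ht hmain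
  have hbound : ∑ y ∈ cube d k, g y * (η + βl y + βk y + r * w y)
      ≤ c * (X.card * (ζ 0 * latticeConst d * η
        + 2 * N * (ζ ((M : ℝ) + 1 - R) * latticeConst d ^ 2) + 2 * r * Cv * d * τ)) := by
    have e : ∑ y ∈ cube d k, g y * (η + βl y + βk y + r * w y)
        = c * ∑ x ∈ X, ∑ y ∈ cube d k,
          Ffun d ζ (D k x y) * (η + βl y + βk y + r * w y) := by
      rw [Finset.sum_comm, Finset.mul_sum]
      refine Finset.sum_congr rfl fun y _ => ?_
      simp only [g]
      rw [mul_assoc, Finset.sum_mul]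
    rw [e, ← nsmul_eq_mul]
    refine mul_le_mul_of_nonneg_left (Finset.sum_le_card_nsmul _ _ _ fun x hx => ?_) hc0
    have hxR := hX hx
    have b1 := mul_le_mul_of_nonneg_right
      (sum_Ffun_le hd st.metric hζ (hXk hx) (subset_refl (cube d k))) hη0
    have b2 := mul_le_mul_of_nonneg_left
      (sum_Ffun_path_le hd st.metric hS hζ hRM hMk hkl hxR) N.coe_nonneg
    have b3 := mul_le_mul_of_nonneg_left
      (sum_Ffun_path_le hd st.metric hS hζ hRM hMk le_rfl hxR) N.coe_nonneg
    have b4 : ∑ y ∈ cube d k, Ffun d ζ (D k x y) * (r * w y) ≤ 2 * r * Cv * d * τ := by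
      rw [← Finset.sum_sdiff (cube_mono (d := d) hMk), Finset.sum_eq_zero (s := cube d M), add_zero]
      · calc ∑ y ∈ cube d k \ cube d M, Ffun d ζ (D k x y) * (r * w y)
            = 2 * r * Cv * d * ∑ y ∈ cube d k \ cube d M, Ffun d ζ (D k x y) * (‖y‖ - M) := by
              rw [Finset.mul_sum]
              refine Finset.sum_congr rfl fun y hy => ?_
              simp only [w, if_neg (Finset.mem_sdiff.1 hy).2]
              ring
          _ ≤ _ := mul_le_mul_of_nonneg_left (hτ x hx) (by positivity)
      · intro y hy
        simp [w, hy]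
    have es : ∑ y ∈ cube d k, Ffun d ζ (D k x y) * (η + βl y + βk y + r * w y)
        = (∑ y ∈ cube d k, Ffun d ζ (D k x y)) * η
          + N * ∑ y ∈ cube d k, Ffun d ζ (D k x y) * ∑ z ∈ cube d l \ cube d M, Ffun d ζ (D l y z)
          + N * ∑ y ∈ cube d k, Ffun d ζ (D k x y) * ∑ z ∈ cube d k \ cube d M, Ffun d ζ (D k y z)
          + ∑ y ∈ cube d k, Ffun d ζ (D k x y) * (r * w y) := by
      rw [Finset.sum_mul, Finset.mul_sum, Finset.mul_sum, ← Finset.sum_add_distrib,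
        ← Finset.sum_add_distrib, ← Finset.sum_add_distrib]
      refine Finset.sum_congr rfl fun y _ => ?_
      simp only [βl, βk]
      ring
    rw [es]
    linarith
  refine hD.trans ((mul_le_mul_of_nonneg_right hbound (abs_nonneg _)).trans (le_of_eq ?_))
  rw [hc]
  ring

/-- First order bound for the evolution of observables that conserve the particle number. -/
theorem norm_evolution_sub_self_le (st : Setting ζ N Cv D J Φ v U) (hζ : IsWeight ζ) {k : ℕ}
    {X : Finset (Zd d)} (hX : X ⊆ cube d k) {A : Op d r} (hA : A ∈ gaugeAlg r X) {t s : ℝ}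
    (ht : t ∈ J) (hs : s ∈ J) :
    ‖conjStar (U k t s) A - A‖
      ≤ 2 * ‖A‖ * X.card * (N * ζ 0 + r * (Cv * l1Diam X)) * |t - s| := by
  refine (st.isUnitaryPropagator k).norm_conjStar_sub_self_le hs ht fun u hu => ?_
  have huJ : u ∈ J := st.interval.uIcc_subset hs ht hu
  refine norm_comm_hamiltonian_le (𝒜 := fun X => (evenAlg r X).toSubalgebra)
    (fun _ _ h _ hA _ hB => evenAlg_commute h hA hB) (fun _ _ hx => siteNumber_mem_evenAlg hx)
    norm_siteNumber_le hX (fun Z hZ => st.mem_evenNet huJ hZ) (gaugeAlg_le_evenAlg X hA)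
    (LatticeFermions.mem_gaugeAlg hA).2 (fun x hx => ?_) (fun x hx y hy => ?_)
  · have := st.sum_norm_le hζ huJ (hX hx) (hX hx)
    simpa [st.metric.self_eq (hX hx), Ffun_zero] using this
  · refine (st.abs_potential_sub_le huJ (hX hx) (hX hy)).trans
      (mul_le_mul_of_nonneg_left ?_ Cv.coe_nonneg)
    exact (st.metric.le_ell1 k x (hX hx) y (hX hy)).trans
      (Nat.cast_le.2 (l1Dist_le_l1Diam hx hy))

theorem evolution_mem_quasiLocal (st : Setting ζ N Cv D J Φ v U) {k : ℕ} {X : Finset (Zd d)}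
    (hX : X ⊆ cube d k) {A : Op d r} (hA : A ∈ evenAlg r X) {t s : ℝ} (ht : t ∈ J) (hs : s ∈ J) :
    conjStar (U k t s) A ∈ quasiLocal d r := by
  have hmem := (st.isUnitaryPropagator k).conjStar_mem_closure (S := evenNet r (cube d k))
    (fun u hu σ hσ => ?_) hs ht (evenAlg_mono hX hA)
  · have hsub : (evenNet r (cube d k) : Set (Op d r)) ⊆ {A | ∃ X, A ∈ evenAlg r X} :=
      fun A hA => ⟨cube d k, hA⟩
    exact closure_mono hsub hmem
  · have hH : ∑ Z ∈ (cube d k).powerset, Φ k u Z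
        + ∑ x ∈ cube d k, ((v k u x : ℝ) : ℂ) • siteNumber r x ∈ evenAlg r (cube d k) := by
      refine add_mem (sum_mem fun Z hZ => ?_) (sum_mem fun x hx => ?_)
      · have hZ' := Finset.mem_powerset.1 hZ
        exact evenAlg_mono hZ' (st.mem_evenNet hu hZ')
      · exact (evenAlg r (cube d k)).toSubalgebra.smul_mem (siteNumber_mem_evenAlg hx) _
    have hσ' : σ ∈ evenAlg r (cube d k) := hσ
    exact (evenAlg r (cube d k)).toSubalgebra.sub_mem (mul_mem hH hσ') (mul_mem hσ' hH)

end Setting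

end LatticeFermions

/-! ### Infinite volume limit and rate of convergence. -/

namespace LatticeFermions

variable {d r : ℕ}

/-! ### Infinite volume -/

theorem IsWeight.exists_radius {ζ : ℝ → ℝ} (hζ : IsWeight ζ) (R : ℕ) {δ : ℝ} (hδ : 0 < δ) :
    ∃ M : ℕ, R ≤ M ∧ ζ ((M : ℝ) + 1 - R) ≤ δ ∧ ∀ ρ : ℝ, (M : ℝ) + 1 - R ≤ ρ → ρ * ζ ρ ≤ δ := by
  obtain ⟨a, ha⟩ := eventually_atTop.1 ((hζ.decay 1).eventually_le_const hδ)
  have hM : ∀ ρ : ℝ, ((R + ⌈a⌉₊ : ℕ) : ℝ) + 1 - R ≤ ρ → 1 ≤ ρ ∧ ρ * ζ ρ ≤ δ := by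
    intro ρ hρ
    push_cast at hρ
    have h1 := Nat.le_ceil a
    have h2 : (0 : ℝ) ≤ (⌈a⌉₊ : ℝ) := Nat.cast_nonneg _
    have h3 := ha ρ (by linarith)
    rw [pow_one] at h3
    exact ⟨by linarith, h3⟩
  refine ⟨R + ⌈a⌉₊, Nat.le_add_right _ _, ?_, fun ρ hρ => (hM ρ hρ).2⟩
  obtain ⟨h1, h2⟩ := hM _ le_rfl
  exact (le_mul_of_one_le_left (hζ.pos _ (by linarith)).le h1).trans h2

theorem sum_norm_le_of_iSup_boxNorm_le {J : Set ℝ} {ζ : ℝ → ℝ} (hζ : IsWeight ζ) {M : ℕ}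
    {f : ℝ → Finset (Zd d) → Op d r} {c : ℝ} (hc : 0 ≤ c)
    (h : (⨆ t ∈ J, boxNorm ell1 ζ M fun X => iteratedDeriv 0 (fun τ => f τ X) t)
      ≤ ENNReal.ofReal c) {u : ℝ} (hu : u ∈ J) {y : Zd d} (hy : y ∈ cube d M) :
    ∑ Z ∈ (cube d M).powerset with y ∈ Z, ‖f u Z‖ ≤ c * ζ 0 := by
  have h1 : boxNorm ell1 ζ M (f u) ≤ ENNReal.ofReal c := by
    simp only [iteratedDeriv_zero] at h
    exact (le_iSup₂ (f := fun t (_ : t ∈ J) => boxNorm ell1 ζ M fun X => f t X) u hu).trans h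
  have e : ell1 y y = 0 := by rw [ell1, l1Dist_self, Nat.cast_zero]
  have h2 := sum_norm_le_of_boxNorm_le hc h1 hy hy (Ffun_pos hζ e.ge)
  simpa [e, Ffun_zero] using h2

/-- Indices adapted to a rapid thermodynamic limit: `M` is far from the boundary of `Λ_k`, and the
inner box is far from the boundary of `Λ_M`, compared with the distance of the two boundaries. -/
theorem exists_intermediate_index {γ lam : ℝ} (hγ0 : 0 < γ) (hγ1 : γ < 1) (hlam : 0 ≤ lam) :
    ∃ k₀ : ℕ, ∀ k : ℕ, k₀ ≤ k → ∃ M : ℕ, 1 ≤ M ∧ M ≤ k ∧ (M : ℝ) + lam * (M : ℝ) ^ γ ≤ k ∧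
      innerIndex γ (lam + 3) (1 / 2) k + 1 ≤ M ∧
      (k : ℝ) - M ≤ (lam + 1) * (M - innerIndex γ (lam + 3) (1 / 2) k) := by
  obtain ⟨k₁, hk₁⟩ := eventually_atTop.1 (((tendsto_rpow_atTop (sub_pos.2 hγ1)).comp
    tendsto_natCast_atTop_atTop).eventually_ge_atTop (2 * (lam + 3)))
  refine ⟨max k₁ 1, fun k hk => ?_⟩
  have hk1 : (1 : ℝ) ≤ k := by exact_mod_cast (le_max_right _ _).trans hk
  have hk0 : (0 : ℝ) < k := by linarith
  have h1 : 2 * (lam + 3) ≤ (k : ℝ) ^ (1 - γ) := hk₁ k ((le_max_left _ _).trans hk)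
  set x : ℝ := (k : ℝ) ^ γ with hx
  have hx1 : 1 ≤ x := Real.one_le_rpow hk1 hγ0.le
  have hkx : (k : ℝ) = x * (k : ℝ) ^ (1 - γ) := by
    rw [hx, ← Real.rpow_add hk0]; simp
  -- This is what a large k₀ achieves: the entry with λ₂ = 1/2 is then not the larger one in the
  -- maximum.
  have hhalf : (lam + 3) * x ≤ k / 2 := by nlinarith
  have hM0 : 0 ≤ (k : ℝ) - lam * x := by nlinarith
  set M := ⌊(k : ℝ) - lam * x⌋₊ with hM
  have hM1 : (M : ℝ) ≤ k - lam * x := Nat.floor_le hM0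
  have hM2 : (k : ℝ) - lam * x < M + 1 := Nat.lt_floor_add_one _
  have hlx : 0 ≤ lam * x := by positivity
  have hm : innerIndex γ (lam + 3) (1 / 2) k = ⌈(k : ℝ) - (lam + 3) * x⌉₊ :=
    max_eq_left (Nat.ceil_le_ceil (by linarith))
  have hm1 : (innerIndex γ (lam + 3) (1 / 2) k : ℝ) < k - (lam + 3) * x + 1 := by
    rw [hm]; exact Nat.ceil_lt_add_one (by linarith)
  -- The gap before rounding is 3x; floor and ceiling cost at most 2 ≤ 2x. Hence the 3 in λ₁ = λ +
  -- 3. On the other side k - M < λ x + 1 ≤ (λ + 1) x.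
  have hmM : x ≤ M - innerIndex γ (lam + 3) (1 / 2) k := by nlinarith
  have hMk : (M : ℝ) ≤ k := by linarith
  have hlt : innerIndex γ (lam + 3) (1 / 2) k + 1 ≤ M := by
    have : ((innerIndex γ (lam + 3) (1 / 2) k + 1 : ℕ) : ℝ) ≤ M := by push_cast; linarith
    exact_mod_cast this
  refine ⟨M, by omega, by exact_mod_cast hMk, ?_, hlt, ?_⟩
  · have : (M : ℝ) ^ γ ≤ x := Real.rpow_le_rpow (Nat.cast_nonneg _) hMk hγ0.le
    nlinarith
  · nlinarith

theorem innerIndex_le {γ lam₁ lam₂ : ℝ} (h₁ : 0 ≤ lam₁) (h₂ : lam₂ ≤ 1) (k : ℕ) :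
    innerIndex γ lam₁ lam₂ k ≤ k := by
  have hk : (0 : ℝ) ≤ k := Nat.cast_nonneg k
  have hx : 0 ≤ (k : ℝ) ^ γ := Real.rpow_nonneg hk γ
  exact max_le (Nat.ceil_le.2 (by nlinarith)) (Nat.ceil_le.2 (by nlinarith))

theorem le_innerIndex {γ lam₁ : ℝ} {n k : ℕ} (h : 2 * n ≤ k) :
    n ≤ innerIndex γ lam₁ (1 / 2) k := by
  have h' : (2 : ℝ) * n ≤ k := by exact_mod_cast h
  have h1 : (n : ℝ) ≤ (⌈1 / 2 * (k : ℝ)⌉₊ : ℝ) := le_trans (by linarith) (Nat.le_ceil _)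
  exact (Nat.cast_le.1 h1).trans (le_max_right _ _)

theorem IsWeight.tendsto_zero {ζ : ℝ → ℝ} (hζ : IsWeight ζ) : Tendsto ζ atTop (𝓝 0) := by
  simpa using hζ.decay 0

namespace Setting

variable {ζ : ℝ → ℝ} {N Cv : ℝ≥0} {D : ℕ → Zd d → Zd d → ℝ} {J : Set ℝ}
  {Φ : ℕ → ℝ → Finset (Zd d) → Op d r} {v : ℕ → ℝ → Zd d → ℝ} {U : ℕ → ℝ → ℝ → Op d r}

theorem norm_comm_heisenberg_le (st : Setting ζ N Cv D J Φ v U) (hd : 1 ≤ d) (hζ : IsWeight ζ)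
    {k : ℕ} {X Y : Finset (Zd d)} (hX : X ⊆ cube d k) (hY : Y ⊆ cube d k) {A B : Op d r}
    (hA : A ∈ evenAlg r X) (hB : B ∈ evenAlg r Y) {t s : ℝ} (ht : t ∈ J) (hs : s ∈ J) :
    ‖heisenberg (U k t s) A * B - B * heisenberg (U k t s) A‖
      ≤ 2 / ζ 0 * latticeConst d * ‖A‖ * ‖B‖ * (min X.card Y.card : ℕ)
        * Real.exp (2 * convConst D ζ * |t - s| * N) * ζ (setDist (D k) X Y) := by
  have h := st.lieb_robinson hd hζ hX hA hB ht hs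
  have e : (cube d k).filter (· ∈ Y) = Y := by
    ext y
    simp only [Finset.mem_filter]
    exact ⟨fun h => h.2, fun h => ⟨hY h, h⟩⟩
  rw [e] at h
  have hζ0 := hζ.pos 0 le_rfl
  refine h.trans ((mul_le_mul_of_nonneg_left (sum_sum_Ffun_le hd st.metric hζ hX hY)
    (by positivity)).trans (le_of_eq ?_))
  ring

theorem cauchySeq_heisenberg (st : Setting ζ N Cv D J Φ v U) (hd : 1 ≤ d) (hζ : IsWeight ζ)
    (hS : RespectsShells D) (hΦ : HasLimit D J ζ Φ) (hv : PotentialHasLimit J v)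
    {X : Finset (Zd d)} {A : Op d r} (hA : A ∈ evenAlg r X) {t s : ℝ} (ht : t ∈ J) (hs : s ∈ J) :
    CauchySeq fun k => heisenberg (U k t s) A := by
  rw [Metric.cauchySeq_iff']
  intro ε hε
  have hζ0 := hζ.pos 0 le_rfl
  have hL := latticeConst_nonneg d
  set K : ℝ := 2 / ζ 0 * ‖A‖ * Real.exp (2 * convConst D ζ * |t - s| * N) * |t - s| * X.card *
    (ζ 0 * latticeConst d * ζ 0 + 2 * N * latticeConst d ^ 2 + 2 * r * Cv * d * latticeConst d)
    with hK
  have hK0 : 0 ≤ K := by positivity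
  have hδ : 0 < ε / (K + 1) := by positivity
  -- M is fixed from the decay of ζ alone, with K independent of M; only then are the boxes taken so
  -- large that the generators nearly agree on Λ_M.
  obtain ⟨M, hRM, hM1, hM2⟩ := hζ.exists_radius (radius X) hδ
  obtain ⟨ζs, hζs, -, hlim⟩ := hΦ
  obtain ⟨K₁, hMK₁, hK₁⟩ := hlim 0 M _ hδ
  obtain ⟨K₂, -, hK₂⟩ := hv M
  refine ⟨max K₁ K₂, fun l hl => ?_⟩
  have hX : X ⊆ cube d (radius X) := subset_cube_iff_radius_le.2 le_rfl
  have hMk : M ≤ max K₁ K₂ := hMK₁.trans (le_max_left _ _)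
  have h := st.norm_evolution_sub_le hd hζ hS hRM hMk hl hX hA ht hs
    (η := ε / (K + 1) * ζ 0) (by positivity)
    (fun u hu y hy => sum_norm_le_of_iSup_boxNorm_le hζ hδ.le
      (f := fun τ Z => Φ l τ Z - Φ (max K₁ K₂) τ Z)
      (by rw [← hζs]; exact hK₁ _ _ (le_max_left _ _) ((le_max_left _ _).trans hl)) hu hy)
    (fun u hu x hx => hK₂ _ _ (le_max_right _ _) ((le_max_right _ _).trans hl) u hu x hx)
    (fun x hx => sum_Ffun_mul_norm_le_of_decay hd st.metric hS hζ hRM hMk (hX hx) hM2)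
  rw [dist_eq_norm]
  refine lt_of_le_of_lt h (lt_of_le_of_lt (b := K * (ε / (K + 1))) ?_ ?_)
  · rw [hK]
    have hb : ζ 0 * latticeConst d * (ε / (K + 1) * ζ 0)
        + 2 * N * (ζ ((M : ℝ) + 1 - radius X) * latticeConst d ^ 2)
        + 2 * r * Cv * d * (ε / (K + 1) * latticeConst d)
        ≤ (ζ 0 * latticeConst d * ζ 0 + 2 * N * latticeConst d ^ 2
          + 2 * r * Cv * d * latticeConst d) * (ε / (K + 1)) := by
      have := mul_le_mul_of_nonneg_left hM1
        (show 0 ≤ 2 * (N : ℝ) * latticeConst d ^ 2 by positivity)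
      linarith
    exact (mul_le_mul_of_nonneg_left hb (by positivity)).trans_eq (mul_assoc _ _ _).symm
  · rw [mul_div_assoc', div_lt_iff₀ (by positivity)]
    nlinarith

theorem tendsto_bulkDynamics {t s : ℝ} {A : Op d r}
    (h : CauchySeq fun k => heisenberg (U k t s) A) :
    Tendsto (fun k => heisenberg (U k t s) A) atTop (𝓝 (bulkDynamics U t s A)) :=
  h.tendsto_limUnder

theorem bulkDynamics_mem_quasiLocal (st : Setting ζ N Cv D J Φ v U) {X : Finset (Zd d)}
    {A : Op d r} (hA : A ∈ evenAlg r X) {t s : ℝ} (ht : t ∈ J) (hs : s ∈ J)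
    (h : Tendsto (fun k => heisenberg (U k t s) A) atTop (𝓝 (bulkDynamics U t s A))) :
    bulkDynamics U t s A ∈ quasiLocal d r := by
  refine isClosed_closure.mem_of_tendsto h ?_
  filter_upwards [eventually_ge_atTop (radius X)] with k hk
  exact st.evolution_mem_quasiLocal (subset_cube_iff_radius_le.2 hk) hA ht hs

/-- Once k exceeds the diameter of X ∪ Y, the box metric equals the ℓ¹-distance between the sets, so
the finite volume bound no longer depends on k and passes to the limit. -/
theorem norm_comm_bulkDynamics_le (st : Setting ζ N Cv D J Φ v U) (hd : 1 ≤ d) (hζ : IsWeight ζ)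
    {X Y : Finset (Zd d)} {A B : Op d r} (hA : A ∈ evenAlg r X) (hB : B ∈ evenAlg r Y) {t s : ℝ}
    (ht : t ∈ J) (hs : s ∈ J)
    (h : Tendsto (fun k => heisenberg (U k t s) A) atTop (𝓝 (bulkDynamics U t s A))) :
    ‖bulkDynamics U t s A * B - B * bulkDynamics U t s A‖
      ≤ 2 / ζ 0 * latticeConst d * ‖A‖ * ‖B‖ * (min X.card Y.card : ℕ)
        * Real.exp (2 * convConst D ζ * |t - s| * N)
        * ζ (setDist ell1 (X : Set (Zd d)) Y) := by
  refine le_of_tendsto ((h.mul_const B).sub (h.const_mul B)).norm ?_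
  filter_upwards [eventually_ge_atTop (radius X), eventually_ge_atTop (radius Y),
    eventually_ge_atTop (l1Diam (X ∪ Y))] with k hX hY hk
  rw [← subset_cube_iff_radius_le] at hX hY
  have e : setDist (D k) X Y = setDist ell1 (X : Set (Zd d)) Y := by
    unfold setDist
    congr 1
    ext δ
    have hxy : ∀ x ∈ X, ∀ y ∈ Y, D k x y = ell1 x y := fun x hx y hy =>
      st.metric.eq_ell1 k x (hX hx) y (hY hy) (Nat.cast_le.2
        ((l1Dist_le_l1Diam (Finset.mem_union_left Y hx) (Finset.mem_union_right X hy)).trans hk))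
    constructor
    · rintro ⟨x, hx, y, hy, rfl⟩
      exact ⟨x, hx, y, hy, hxy x hx y hy⟩
    · rintro ⟨x, hx, y, hy, rfl⟩
      exact ⟨x, hx, y, hy, (hxy x hx y hy).symm⟩
  rw [← e]
  exact st.norm_comm_heisenberg_le hd hζ hX hY hA hB ht hs

/-! ### Rate of convergence -/

/-- With the depth δ = m + 1 - radius X ≥ 1, all errors are at most a multiple of ζ(δ^γ): the
interactions are compared through Ψ with error ζ(M^γ) and δ ≤ M, while the terms leaving Λ_M and the
potentials give ζ(M + 1 - radius X), where δ^γ ≤ δ ≤ M + 1 - radius X. -/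
theorem norm_heisenberg_sub_le_of_subset (st : Setting ζ N Cv D J Φ v U) (hd : 1 ≤ d)
    (hζ : IsWeight ζ) (hS : RespectsShells D) {γ lamΦ CΦ lamv lam : ℝ} (hγ0 : 0 < γ) (hγ1 : γ < 1)
    (hlam : 0 ≤ lam) (hlamΦ : lamΦ ≤ lam) (hlamv : lamv ≤ lam)
    (hΦ : HasRapidLimit D J ζ γ lamΦ CΦ Φ) (hv : PotentialHasRapidLimit J γ lamv v)
    {k l m M : ℕ} (hkl : k ≤ l) (hM1 : 1 ≤ M) (hMk : M ≤ k)
    (hMk' : (M : ℝ) + lam * (M : ℝ) ^ γ ≤ k) (hmM : m + 1 ≤ M)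
    (hq : (k : ℝ) - M ≤ (lam + 1) * (M - m)) {X : Finset (Zd d)} (hX : X ⊆ cube d m) {A : Op d r}
    (hA : A ∈ evenAlg r X) {t s : ℝ} (ht : t ∈ J) (hs : s ∈ J) :
    ‖heisenberg (U l t s) A - heisenberg (U k t s) A‖
      ≤ 2 / ζ 0 * ‖A‖ * Real.exp (2 * convConst D ζ * |t - s| * N) * |t - s| * X.card *
        ((ζ 0 * latticeConst d * (2 * CΦ * ζ 0) + 2 * N * latticeConst d ^ 2
          + 2 * r * Cv * d * (latticeConst d * (lam + 1)))
            * ζ (((m + 1 - radius X : ℕ) : ℝ) ^ γ)) := by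
  rw [subset_cube_iff_radius_le] at hX
  have hXR : X ⊆ cube d (radius X) := subset_cube_iff_radius_le.2 le_rfl
  have hζ0 := hζ.pos 0 le_rfl
  have hL := latticeConst_nonneg d
  set δ : ℕ := m + 1 - radius X with hδ
  have hδ1 : (1 : ℝ) ≤ δ := by exact_mod_cast (show 1 ≤ δ by omega)
  have hδ0 : (0 : ℝ) ≤ (δ : ℝ) ^ γ := by positivity
  have hδM : (δ : ℝ) ≤ M := by exact_mod_cast (show δ ≤ M by omega)
  have hRm : (radius X : ℝ) ≤ m := by exact_mod_cast hX
  have hδe : (δ : ℝ) = m + 1 - radius X := by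
    rw [hδ, Nat.cast_sub (by omega)]; push_cast; ring
  have hmM' : (m : ℝ) + 1 ≤ M := by exact_mod_cast hmM
  set z := ζ ((δ : ℝ) ^ γ) with hz
  have hz0 : 0 < z := hζ.pos _ hδ0
  have hzM : ζ ((M : ℝ) ^ γ) ≤ z :=
    hζ.le_of_le hδ0 (Real.rpow_le_rpow (by linarith) hδM hγ0.le)
  have hδγ : (δ : ℝ) ^ γ ≤ δ := Real.rpow_le_self_of_one_le hδ1 hγ1.le
  have hzR : ζ ((M : ℝ) + 1 - radius X) ≤ z := hζ.le_of_le hδ0 (by linarith)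
  have hMγ : (0 : ℝ) ≤ (M : ℝ) ^ γ := by positivity
  obtain ⟨ζs, hζs, -, Ψ, -, lams, Cs, hl0, hC0, hrapid⟩ := hΦ
  obtain ⟨-, hC0', hbox⟩ := hrapid 0
  rw [hl0, hC0, hζs] at hbox
  rw [hC0] at hC0'
  obtain ⟨w, -, -, hw⟩ := hv
  have hMlΦ : ∀ n : ℕ, k ≤ n → (M : ℝ) + lamΦ * (M : ℝ) ^ γ ≤ n := fun n hn => by
    have : (k : ℝ) ≤ n := by exact_mod_cast hn
    nlinarith
  have hMlv : ∀ n : ℕ, k ≤ n → (M : ℝ) + lamv * (M : ℝ) ^ γ ≤ n := fun n hn => by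
    have : (k : ℝ) ≤ n := by exact_mod_cast hn
    nlinarith
  have hΨ : ∀ n : ℕ, k ≤ n → ∀ u ∈ J, ∀ y ∈ cube d M,
      ∑ Z ∈ (cube d M).powerset with y ∈ Z, ‖Ψ u Z - Φ n u Z‖ ≤ CΦ * z * ζ 0 :=
    fun n hn u hu y hy => (sum_norm_le_of_iSup_boxNorm_le hζ (f := fun τ Z => Ψ τ Z - Φ n τ Z)
      (mul_nonneg hC0'.le (hζ.pos _ hMγ).le) (hbox M n hM1 (hMlΦ n hn)) hu hy).trans (by gcongr)
  have h := st.norm_evolution_sub_le hd hζ hS (η := 2 * CΦ * ζ 0 * z)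
    (τ := z * latticeConst d * (lam + 1)) (hX.trans (by omega)) hMk hkl hXR hA ht hs (by positivity)
    (fun u hu y hy => ?_)
    (fun u hu x hx => by
      rw [← hw M l hM1 (hMlv l hkl) u hu x hx, ← hw M k hM1 (hMlv k le_rfl) u hu x hx])
    (fun x hx => (sum_Ffun_mul_norm_le_of_width hd st.metric hS hζ (hX.trans (by omega)) hMk
      (hXR hx) (q := lam + 1) ?_).trans ?_)
  · refine h.trans (mul_le_mul_of_nonneg_left ?_ (by positivity))
    have := mul_le_mul_of_nonneg_left hzR
      (show 0 ≤ 2 * (N : ℝ) * latticeConst d ^ 2 by positivity)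
    linarith
  · calc ∑ Z ∈ (cube d M).powerset with y ∈ Z, ‖Φ l u Z - Φ k u Z‖
        ≤ ∑ Z ∈ (cube d M).powerset with y ∈ Z, (‖Ψ u Z - Φ k u Z‖ + ‖Ψ u Z - Φ l u Z‖) := by
          refine Finset.sum_le_sum fun Z _ => ?_
          have e : Φ l u Z - Φ k u Z = (Ψ u Z - Φ k u Z) - (Ψ u Z - Φ l u Z) := by abel
          rw [e]
          exact norm_sub_le _ _
      _ ≤ CΦ * z * ζ 0 + CΦ * z * ζ 0 := by
          rw [Finset.sum_add_distrib]
          exact add_le_add (hΨ k le_rfl u hu y hy) (hΨ l hkl u hu y hy)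
      _ = _ := by ring
  · refine hq.trans (mul_le_mul_of_nonneg_left (by linarith) (by linarith))
  · gcongr

/-- Both evolutions are compared with A itself. This is meant for the situations where the decay of
ζ gives no gain. -/
theorem norm_heisenberg_sub_le_of_mem_gaugeAlg (st : Setting ζ N Cv D J Φ v U) (hζ : IsWeight ζ)
    {k l : ℕ} (hkl : k ≤ l) {X : Finset (Zd d)} (hX : X ⊆ cube d k) {A : Op d r}
    (hA : A ∈ gaugeAlg r X) {t s : ℝ} (ht : t ∈ J) (hs : s ∈ J) :
    ‖heisenberg (U l t s) A - heisenberg (U k t s) A‖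
      ≤ 4 * ‖A‖ * X.card * (N * ζ 0 + r * (Cv * l1Diam X)) * |t - s| := by
  have h1 := st.norm_evolution_sub_self_le hζ hX hA ht hs
  have h2 := st.norm_evolution_sub_self_le hζ (hX.trans (cube_mono hkl)) hA ht hs
  have e : heisenberg (U l t s) A - heisenberg (U k t s) A
      = (conjStar (U l t s) A - A) - (conjStar (U k t s) A - A) := by
    simp only [heisenberg, conjStar]; abel
  rw [e]
  refine (norm_sub_le _ _).trans ?_
  linarith

/-- The rate of convergence in terms of the depth of `X` in the inner box. -/
theorem norm_heisenberg_sub_le (hd : 1 ≤ d) (hζ : IsWeight ζ) (N Cv : ℝ≥0) {γ : ℝ} (hγ0 : 0 < γ)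
    (hγ1 : γ < 1) (lamΦ CΦ lamv : ℝ) :
    ∃ (lam₁ C : ℝ) (k₀ : ℕ), 0 < lam₁ ∧ 0 ≤ C ∧ ∀ (D : ℕ → Zd d → Zd d → ℝ) (J : Set ℝ)
      (Φ : ℕ → ℝ → Finset (Zd d) → Op d r) (v : ℕ → ℝ → Zd d → ℝ) (U : ℕ → ℝ → ℝ → Op d r),
      Setting ζ N Cv D J Φ v U → RespectsShells D → HasRapidLimit D J ζ γ lamΦ CΦ Φ →
      PotentialHasRapidLimit J γ lamv v → ∀ k l : ℕ, k ≤ l → ∀ X ⊆ cube d k, ∀ A : Op d r,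
      RateAdmissible k₀ k (innerIndex γ lam₁ (1 / 2) k) X A → ∀ t ∈ J, ∀ s ∈ J,
        ‖heisenberg (U l t s) A - heisenberg (U k t s) A‖
          ≤ C * ‖A‖ * (max 1 (l1Diam X) : ℕ) ^ (d + 1)
            * Real.exp (2 * convConst D ζ * |t - s| * N) * |t - s|
            * ζ (((innerIndex γ lam₁ (1 / 2) k + 1 - radius X : ℕ) : ℝ) ^ γ) := by
  -- The constants are chosen before the limits are given, so nothing is known yet about the signs
  -- of lamΦ, lamv and CΦ; hence also the absolute value of CΦ in κ.
  set lam := max (max lamΦ lamv) 0 with hlam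
  have hlam0 : 0 ≤ lam := le_max_right _ _
  have hlamΦ : lamΦ ≤ lam := (le_max_left _ _).trans (le_max_left _ _)
  have hlamv : lamv ≤ lam := (le_max_right _ _).trans (le_max_left _ _)
  obtain ⟨k₀, hk₀⟩ := exists_intermediate_index hγ0 hγ1 hlam0
  have hζ0 := hζ.pos 0 le_rfl
  have hL := latticeConst_nonneg d
  set κ : ℝ := ζ 0 * latticeConst d * (2 * |CΦ| * ζ 0) + 2 * N * latticeConst d ^ 2
    + 2 * r * Cv * d * (latticeConst d * (lam + 1)) with hκ
  have hκ0 : 0 ≤ κ := by positivity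
  have hk1 : (0 : ℝ) ≤ ((k₀ : ℝ) + 1) ^ γ := by positivity
  set ζm := ζ (((k₀ : ℝ) + 1) ^ γ) with hζm
  have hζm0 : 0 < ζm := hζ.pos _ hk1
  set C₁ : ℝ := 2 / ζ 0 * 3 ^ d * κ with hC₁
  set C₂ : ℝ := 4 * 3 ^ d * (N * ζ 0 + r * Cv) / ζm with hC₂
  have hC₁0 : 0 ≤ C₁ := by positivity
  have hC₂0 : 0 ≤ C₂ := by positivity
  refine ⟨lam + 3, C₁ + C₂, k₀, by linarith, by positivity, ?_⟩
  intro D J Φ v U st hS hΦ hv k l hkl X hX A hA t ht s hs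
  set m := innerIndex γ (lam + 3) (1 / 2) k with hm
  have hmk : m ≤ k := innerIndex_le (by linarith) (by norm_num) k
  set P : ℝ := ((max 1 (l1Diam X) : ℕ) : ℝ) with hP
  have hP1 : 1 ≤ P := by rw [hP]; exact_mod_cast le_max_left _ _
  have hPd : (l1Diam X : ℝ) ≤ P := by rw [hP]; exact_mod_cast le_max_right _ _
  have hcard : (X.card : ℝ) ≤ 3 ^ d * P ^ d := card_le_diam_pow X
  set E := Real.exp (2 * convConst D ζ * |t - s| * N) with hE
  have hE1 : 1 ≤ E := by
    have := convConst_nonneg D ζ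
    exact Real.one_le_exp (by positivity)
  set δ : ℕ := m + 1 - radius X with hδ
  have hδ0 : (0 : ℝ) ≤ (δ : ℝ) ^ γ := by positivity
  set z := ζ ((δ : ℝ) ^ γ) with hz
  have hz0 : 0 < z := hζ.pos _ hδ0
  have hT := abs_nonneg (t - s)
  have hA0 := norm_nonneg A
  by_cases hcase : k₀ ≤ k ∧ X ⊆ cube d m
  · have hAe : A ∈ evenAlg r X := hA.elim (fun h => gaugeAlg_le_evenAlg X h) fun h => h.1
    obtain ⟨M, hM1, hMk, hMk', hmM, hq⟩ := hk₀ k hcase.1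
    have h := st.norm_heisenberg_sub_le_of_subset hd hζ hS hγ0 hγ1 hlam0 hlamΦ hlamv hΦ hv hkl hM1
      hMk hMk' hmM hq hcase.2 hAe ht hs
    have hcard' : (X.card : ℝ) ≤ 3 ^ d * P ^ (d + 1) :=
      hcard.trans (mul_le_mul_of_nonneg_left (pow_le_pow_right₀ hP1 (Nat.le_succ d))
        (by positivity))
    have hκle : ζ 0 * latticeConst d * (2 * CΦ * ζ 0) + 2 * N * latticeConst d ^ 2
        + 2 * r * Cv * d * (latticeConst d * (lam + 1)) ≤ κ := by
      rw [hκ]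
      gcongr
      exact le_abs_self CΦ
    refine (h.trans (mul_le_mul_of_nonneg_left
      (mul_le_mul_of_nonneg_right hκle hz0.le) (by positivity))).trans ?_
    calc _ ≤ 2 / ζ 0 * ‖A‖ * E * |t - s| * (3 ^ d * P ^ (d + 1)) * (κ * z) := by gcongr
      _ = C₁ * (‖A‖ * P ^ (d + 1) * E * |t - s| * z) := by rw [hC₁]; ring
      _ ≤ (C₁ + C₂) * (‖A‖ * P ^ (d + 1) * E * |t - s| * z) :=
          mul_le_mul_of_nonneg_right (by linarith) (by positivity)
      _ = _ := by ring
  · have hAg : A ∈ gaugeAlg r X := hA.resolve_right fun h => hcase h.2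
    -- If X leaves Λ_m the truncated depth is 0; if k < k₀ it is at most k + 1. So ζ(δ^γ) is at
    -- least ζm, by which C₂ is divided.
    have hδk : δ ≤ k₀ + 1 := by
      by_cases hk : k₀ ≤ k
      · have : ¬ radius X ≤ m := fun h => hcase ⟨hk, subset_cube_iff_radius_le.2 h⟩
        omega
      · omega
    have hδk' : (δ : ℝ) ≤ (k₀ : ℝ) + 1 := by exact_mod_cast hδk
    have hzm : ζm ≤ z := hζ.le_of_le hδ0 (Real.rpow_le_rpow (Nat.cast_nonneg _) hδk' hγ0.le)
    refine (st.norm_heisenberg_sub_le_of_mem_gaugeAlg hζ hkl hX hAg ht hs).trans ?_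
    -- The oscillation of the potential on X contributes one power of the diameter beyond the d
    -- powers from the cardinality.
    have h1 : (N : ℝ) * ζ 0 + r * (Cv * l1Diam X) ≤ (N * ζ 0 + r * Cv) * P := by
      have h2 : (N : ℝ) * ζ 0 ≤ N * ζ 0 * P := le_mul_of_one_le_right (by positivity) hP1
      have h3 := mul_le_mul_of_nonneg_left hPd (show 0 ≤ (r : ℝ) * Cv by positivity)
      linarith
    calc 4 * ‖A‖ * X.card * (N * ζ 0 + r * (Cv * l1Diam X)) * |t - s|
        ≤ 4 * ‖A‖ * (3 ^ d * P ^ d) * ((N * ζ 0 + r * Cv) * P) * |t - s| := by gcongr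
      _ = C₂ * (‖A‖ * P ^ (d + 1) * 1 * |t - s| * ζm) := by
          rw [hC₂]; field_simp; ring
      _ ≤ C₂ * (‖A‖ * P ^ (d + 1) * E * |t - s| * z) := by gcongr
      _ ≤ (C₁ + C₂) * (‖A‖ * P ^ (d + 1) * E * |t - s| * z) :=
          mul_le_mul_of_nonneg_right (by linarith) (by positivity)
      _ = _ := by ring

end Setting

end LatticeFermions

/-! ### From the depth of X to set distances, and convergence. -/

namespace LatticeFermions

variable {d r : ℕ}

theorem setDist_cube_sdiff_le (hd : 1 ≤ d) {D : ℕ → Zd d → Zd d → ℝ} (hD : IsBoxMetric D) {m l : ℕ}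
    {X : Finset (Zd d)} (hX : X ⊆ cube d l) :
    setDist (D l) X (cube d l \ cube d m : Finset (Zd d)) ≤ (m + 1 - radius X : ℕ) := by
  rcases le_or_gt l m with hml | hml
  · have e : cube d l \ cube d m = ∅ := Finset.sdiff_eq_empty_iff_subset.2 (cube_mono hml)
    have : setDist (D l) (X : Set (Zd d)) ((∅ : Finset (Zd d)) : Set (Zd d)) = 0 := by
      simp [setDist]
    rw [e, this]
    positivity
  · have hY : ∀ y ∈ ((cube d l \ cube d m : Finset (Zd d)) : Set (Zd d)), y ∈ cube d l :=
      fun y hy => (Finset.mem_sdiff.1 hy).1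
    exact setDist_compl_le hd (fun y hy hym => Finset.mem_sdiff.2 ⟨cube_mono hml hy, hym⟩)
      (fun x hx hxm => Finset.mem_sdiff.2 ⟨hX hx, hxm⟩)
      (fun x hx y hy => hD.nonneg (hX hx) (hY y hy))
      (fun x hx y hy => hD.le_ell1 l x (hX hx) y (hY y hy))

theorem ell1_nonneg (x y : Zd d) : 0 ≤ ell1 x y := Nat.cast_nonneg _

theorem setDist_compl_cube_le (hd : 1 ≤ d) {m : ℕ} {X : Finset (Zd d)} :
    setDist ell1 (X : Set (Zd d)) {x | x ∉ cube d m} ≤ (m + 1 - radius X : ℕ) :=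
  setDist_compl_le hd (fun _ _ h => h) (fun _ _ h => h) (fun _ _ _ _ => ell1_nonneg _ _)
    fun _ _ _ _ => le_rfl

namespace Setting

variable {ζ : ℝ → ℝ} {U : ℕ → ℝ → ℝ → Op d r}

/-- A rate of convergence in terms of the depth of `X` in the inner boxes gives convergence. -/
theorem cauchySeq_of_rate (hζ : IsWeight ζ) {γ lam₁ K : ℝ} (hγ : 0 < γ) (hK : 0 ≤ K) {k₀ : ℕ}
    {X : Finset (Zd d)} {A : Op d r} {t s : ℝ}
    (h : ∀ k l : ℕ, k ≤ l → k₀ ≤ k → X ⊆ cube d (innerIndex γ lam₁ (1 / 2) k) →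
      ‖heisenberg (U l t s) A - heisenberg (U k t s) A‖
        ≤ K * ζ (((innerIndex γ lam₁ (1 / 2) k + 1 - radius X : ℕ) : ℝ) ^ γ)) :
    CauchySeq fun k => heisenberg (U k t s) A := by
  rw [Metric.cauchySeq_iff']
  intro ε hε
  have hδ : 0 < ε / (K + 1) := by positivity
  obtain ⟨n, hn⟩ := eventually_atTop.1
    (((hζ.tendsto_zero.comp (tendsto_rpow_atTop hγ)).comp
      tendsto_natCast_atTop_atTop).eventually_le_const hδ)
  -- As the inner index is at least k/2, this k makes the depth of X exceed n.
  set k := max k₀ (2 * (radius X + n)) with hk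
  have hm : radius X + n ≤ innerIndex γ lam₁ (1 / 2) k := le_innerIndex (le_max_right _ _)
  refine ⟨k, fun l hl => ?_⟩
  rw [dist_eq_norm]
  refine lt_of_le_of_lt ((h k l hl (le_max_left _ _)
    (subset_cube_iff_radius_le.2 (by omega))).trans
    (mul_le_mul_of_nonneg_left (hn _ (by omega)) hK)) ?_
  rw [mul_div_assoc', div_lt_iff₀ (by positivity)]
  nlinarith

end Setting

end LatticeFermions

end

/-! ### Assembly of the theorem. -/

theorem propositionB1 (d r : ℕ) (hd : 1 ≤ d) (ζ : ℝ → ℝ) (hζ : IsWeight ζ) (N Cv : ℝ≥0) :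
    -- Lieb-Robinson bounds, in finite and in infinite volume
    (∃ C : ℝ, ∀ (D : ℕ → Zd d → Zd d → ℝ) (J : Set ℝ)
        (Φ : ℕ → ℝ → Finset (Zd d) → Op d r) (v : ℕ → ℝ → Zd d → ℝ)
        (U : ℕ → ℝ → ℝ → Op d r), Setting ζ N Cv D J Φ v U →
      (∀ k : ℕ, ∀ X ⊆ cube d k, ∀ Y ⊆ cube d k, ∀ A ∈ evenAlg r X, ∀ B ∈ evenAlg r Y,
        ∀ t ∈ J, ∀ s ∈ J,
          ‖heisenberg (U k t s) A * B - B * heisenberg (U k t s) A‖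
            ≤ C * ‖A‖ * ‖B‖ * (min X.card Y.card : ℕ)
              * Real.exp (2 * convConst D ζ * |t - s| * N) * ζ (setDist (D k) X Y)) ∧
      (∀ a : ℝ, 0 < a → ζ = expWeight a →
        ∀ k : ℕ, ∀ X ⊆ cube d k, ∀ Y ⊆ cube d k, ∀ A ∈ evenAlg r X, ∀ B ∈ evenAlg r Y,
        ∀ t ∈ J, ∀ s ∈ J,
          ‖heisenberg (U k t s) A * B - B * heisenberg (U k t s) A‖
            ≤ C * ‖A‖ * ‖B‖ * (min X.card Y.card : ℕ)
              * Real.exp (a * (lrVelocity D a N * |t - s| - setDist (D k) X Y))) ∧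
      (RespectsShells D → HasLimit D J ζ Φ → PotentialHasLimit J v →
        ∀ X Y : Finset (Zd d), ∀ A ∈ evenAlg r X, ∀ B ∈ evenAlg r Y,
        ∀ t ∈ J, ∀ s ∈ J,
          Tendsto (fun k => heisenberg (U k t s) A) atTop (𝓝 (bulkDynamics U t s A)) ∧
          bulkDynamics U t s A ∈ quasiLocal d r ∧
          ‖bulkDynamics U t s A * B - B * bulkDynamics U t s A‖
            ≤ C * ‖A‖ * ‖B‖ * (min X.card Y.card : ℕ)
              * Real.exp (2 * convConst D ζ * |t - s| * N) * ζ (setDist ell1 (X : Set (Zd d)) Y))) ∧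
    -- rate of convergence for generators with a rapid thermodynamic limit
    (∀ γ : ℝ, 0 < γ → γ < 1 → ∀ lamΦ CΦ lamv : ℝ,
      ∃ (lam₁ lam₂ C : ℝ) (k₀ : ℕ), 0 < lam₁ ∧ 0 < lam₂ ∧ lam₂ < 1 ∧
      ∀ (D : ℕ → Zd d → Zd d → ℝ) (J : Set ℝ)
        (Φ : ℕ → ℝ → Finset (Zd d) → Op d r) (v : ℕ → ℝ → Zd d → ℝ)
        (U : ℕ → ℝ → ℝ → Op d r), Setting ζ N Cv D J Φ v U → RespectsShells D →
        HasRapidLimit D J ζ γ lamΦ CΦ Φ → PotentialHasRapidLimit J γ lamv v →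
      (∀ k l : ℕ, k ≤ l → ∀ X ⊆ cube d k, ∀ A : Op d r,
        RateAdmissible k₀ k (innerIndex γ lam₁ lam₂ k) X A → ∀ t ∈ J, ∀ s ∈ J,
          ‖heisenberg (U l t s) A - heisenberg (U k t s) A‖
            ≤ C * ‖A‖ * (max 1 (l1Diam X) : ℕ) ^ (d + 1)
              * Real.exp (2 * convConst D ζ * |t - s| * N) * |t - s|
              * ζ (setDist (D l) X (cube d l \ cube d (innerIndex γ lam₁ lam₂ k) : Finset (Zd d)) ^ γ)) ∧
      (∀ k : ℕ, ∀ X ⊆ cube d k, ∀ A : Op d r,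
        RateAdmissible k₀ k (innerIndex γ lam₁ lam₂ k) X A → ∀ t ∈ J, ∀ s ∈ J,
          Tendsto (fun k => heisenberg (U k t s) A) atTop (𝓝 (bulkDynamics U t s A)) ∧
          ‖bulkDynamics U t s A - heisenberg (U k t s) A‖
            ≤ C * ‖A‖ * (max 1 (l1Diam X) : ℕ) ^ (d + 1)
              * Real.exp (2 * convConst D ζ * |t - s| * N) * |t - s|
              * ζ (setDist ell1 (X : Set (Zd d)) {x | x ∉ cube d (innerIndex γ lam₁ lam₂ k)} ^ γ))) := by
  refine ⟨⟨2 / ζ 0 * latticeConst d, fun D J Φ v U st => ⟨?_, ?_, ?_⟩⟩, ?_⟩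
  · intro k X hX Y hY A hA B hB t ht s hs
    exact st.norm_comm_heisenberg_le hd hζ hX hY hA hB ht hs
  · intro a ha hζa k X hX Y hY A hA B hB t ht s hs
    refine (st.norm_comm_heisenberg_le hd hζ hX hY hA hB ht hs).trans (le_of_eq ?_)
    have e : a * (lrVelocity D a N * |t - s| - setDist (D k) X Y)
        = 2 * convConst D ζ * |t - s| * N + -(a * setDist (D k) X Y) := by
      rw [lrVelocity, hζa]
      field_simp
      ring
    rw [e, Real.exp_add, ← mul_assoc]
    congr 1
    rw [hζa, expWeight]
  · intro hS hΦ hv X Y A hA B hB t ht s hs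
    have h := Setting.tendsto_bulkDynamics (st.cauchySeq_heisenberg hd hζ hS hΦ hv hA ht hs)
    exact ⟨h, st.bulkDynamics_mem_quasiLocal hA ht hs h,
      st.norm_comm_bulkDynamics_le hd hζ hA hB ht hs h⟩
  · intro γ hγ0 hγ1 lamΦ CΦ lamv
    obtain ⟨lam₁, C, k₀, hlam₁, hC, hrate⟩ :=
      Setting.norm_heisenberg_sub_le (r := r) hd hζ N Cv hγ0 hγ1 lamΦ CΦ lamv
    refine ⟨lam₁, 1 / 2, C, k₀, hlam₁, by norm_num, by norm_num, ?_⟩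
    intro D J Φ v U st hS hΦ hv
    have hbound := hrate D J Φ v U st hS hΦ hv
    -- The rate was proved with the depth of X; the set distances are at most the depth, so
    -- replacing it can only increase ζ.
    have hpow : ∀ {a : ℝ} {n : ℕ}, 0 ≤ a → a ≤ n → ζ ((n : ℝ) ^ γ) ≤ ζ (a ^ γ) :=
      fun ha han => hζ.le_of_le (Real.rpow_nonneg ha γ) (Real.rpow_le_rpow ha han hγ0.le)
    refine ⟨fun k l hkl X hX A hA t ht s hs => ?_, fun k X hX A hA t ht s hs => ?_⟩
    · have hXl := hX.trans (cube_mono hkl)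
      refine (hbound k l hkl X hX A hA t ht s hs).trans (mul_le_mul_of_nonneg_left
        (hpow (setDist_nonneg fun x hx y hy => st.metric.nonneg (hXl hx) (Finset.mem_sdiff.1 hy).1)
          (setDist_cube_sdiff_le hd st.metric hXl)) (by positivity))
    · have hAe : A ∈ evenAlg r X := hA.elim (fun h => gaugeAlg_le_evenAlg X h) fun h => h.1
      -- Convergence concerns only large k, where every even observable is admissible. The bound at
      -- the given k then follows by letting l tend to infinity.
      have hlim := Setting.tendsto_bulkDynamics (Setting.cauchySeq_of_rate (U := U) (t := t) (s := s)
        hζ hγ0 (by positivity) fun k l hkl hk hXk => hbound k l hkl X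
          (hXk.trans (cube_mono (innerIndex_le hlam₁.le (by norm_num) k))) A
          (Or.inr ⟨hAe, hk, hXk⟩) t ht s hs)
      refine ⟨hlim, ?_⟩
      refine (le_of_tendsto (hlim.sub_const _).norm (eventually_atTop.2 ⟨k, fun l hl =>
        hbound k l hl X hX A hA t ht s hs⟩)).trans (mul_le_mul_of_nonneg_left
        (hpow (setDist_nonneg fun _ _ _ _ => ell1_nonneg _ _) (setDist_compl_cube_le hd))
        (by positivity))
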